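/- Write $\langle\lambda\rangle=(1+\lambda^2)^{1/2}$. Let $w\ge 0$ be a weight on $\mathbb R$ and $d\sigma=w(\lambda)\,\frac{d\lambda}{2\pi}$. An accelerant of $\sigma$ is a function $H\in L^2_{loc}(\mathbb R)$ with $H(-x)=\overline{H(x)}$ such that for some $\beta\in\mathbb R$ and all $x\in\mathbb R$, $$\int_0^x (x-s)H(s)\,ds=i\beta x+\int_{-\infty}^\infty\Big(1+\frac{i\lambda x}{1+\lambda^2}-e^{i\lambda x}\Big)\frac1{\lambda^2}\Big(d\sigma(\lambda)-\frac{d\lambda}{2\pi}\Big).$$ For $r>0$ let $\mathcal H_rf(x)=\int_0^rH(x-y)f(y)\,dy$ on $L^2([0,r])$, and let $\Gamma_r(s,t)$ be the continuous kernel on $[0,r]^2$ of the integral operator $I-(I+\mathcal H_r)^{-1}$. For an integer $k\ge 0$ put $$R_{k,r}(\lambda)=-i^k\int_0^r\big(\partial_t^k\Gamma_r(r,t)\big)e^{i\lambda t}\,dt .$$ Theorem. For all integers $k\ge0$, all $\delta\in[0,1)$ and all weights $w\geq 0$ with $$(w-1)\langle\lambda\rangle^k\in L^1(\mathbb R),\qquad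 \|(w-1)\langle\lambda\rangle^k\|_{L^\infty(\mathbb R)}\le\delta ,\tag{$*$}$$ the accelerant and the kernels $\Gamma_r$ ($r>0$) exist, and $t\mapsto\Gamma_r(r,t)$ is $C^k$ on $[0,r]$, so that $R_{k,r}$ is well defined. Moreover: (a) There is a function $\epsilon:[0,1)\to(0,\frac12)$ with $\lim_{\delta\to0^+}\epsilon(\delta)=\frac12$ such that for all $k,\delta,w$ satisfying $(*)$ and all real $p$ with $|\frac12-\frac1p|<\epsilon(\delta)$, $$\sup_{r>0}\|R_{k,r}\|_{L^p(\mathbb R)}<\infty .$$ (b) For every $p\in(1,\infty)$ there is $\delta_0(p)>0$, and for every integer $k\ge 0$ a constant $C_{p,k}$, such that for all $\delta\in(0,\delta_0(p))$ with $\delta<1$ and all $w$ satisfying $(*)$, $$\sup_{r>0}\|R_{k,r}\|_{L^p(\mathbb R)}\le C_{p,k}\,\delta^{1-\frac1p}\Big(\|\langle\lambda\rangle^k(w-1)\|_{L^1(\mathbb R)}^{\frac1p}+\|\langle\lambda\rangle^k(w-1)\|_{L^1(\mathbb R)}^{1+\frac1p}\Big).$$ -/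

import Mathlib

open MeasureTheory Filter Topology Set

noncomputable section

namespace Krein

/-- The Japanese bracket `⟨x⟩ = (1 + x²)^{1/2}`. -/
def bracket (x : ℝ) : ℝ := Real.sqrt (1 + x ^ 2)

/-- The weighted perturbation `⟨x⟩^k (w(x) - 1)`. -/
def weightedDiff (k : ℕ) (w : ℝ → ℝ) (x : ℝ) : ℝ := (w x - 1) * bracket x ^ k

/-- `H` is an accelerant of the measure `dσ = w(x) dx / (2π)`: it is Hermitian, locally square
integrable, and there is a real `β` with
`∫₀ˣ (x - s) H(s) ds = iβx + ∫ (1 + iξx / (1 + ξ²) - e^{iξx}) ξ⁻² (dσ(ξ) - dξ / (2π))`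
for all real `x`. -/
structure IsAccelerant (w : ℝ → ℝ) (H : ℝ → ℂ) : Prop where
  hermitian : ∀ x : ℝ, H (-x) = (starRingEnd ℂ) (H x)
  locally_sq_integrable : ∀ a b : ℝ, MemLp H 2 (volume.restrict (Icc a b))
  equation : ∃ β : ℝ, ∀ x : ℝ,
    ∫ s in (0 : ℝ)..x, ((x - s : ℝ) : ℂ) * H s =
      Complex.I * β * x +
        ∫ ξ : ℝ, (1 + Complex.I * ξ * x / (1 + (ξ : ℂ) ^ 2) - Complex.exp (Complex.I * ξ * x))
          / (ξ : ℂ) ^ 2 * (((w ξ - 1) / (2 * Real.pi) : ℝ) : ℂ)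

/-- The operator `I + ℋ_r`, where `(ℋ_r f)(x) = ∫₀ʳ H(x - y) f(y) dy`. -/
def onePlusConv (H : ℝ → ℂ) (r : ℝ) (f : ℝ → ℂ) (x : ℝ) : ℂ :=
  f x + ∫ y in (0 : ℝ)..r, H (x - y) * f y

/-- The operator `I - 𝒢`, where `𝒢` is the integral operator on `[0,r]` with kernel `G`. -/
def oneMinusKernel (G : ℝ → ℝ → ℂ) (r : ℝ) (f : ℝ → ℂ) (x : ℝ) : ℂ :=
  f x - ∫ y in (0 : ℝ)..r, G x y * f y

/-- `G` is the (continuous) kernel on `[0,r]²` of the resolvent operator `I - (I + ℋ_r)⁻¹` on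
`L²([0,r])`, i.e. `I - 𝒢` is a two-sided inverse of `I + ℋ_r`. -/
structure IsResolventKernel (H : ℝ → ℂ) (r : ℝ) (G : ℝ → ℝ → ℂ) : Prop where
  continuousOn : ContinuousOn (fun q : ℝ × ℝ => G q.1 q.2) (Icc 0 r ×ˢ Icc 0 r)
  right_inverse : ∀ f : ℝ → ℂ, MemLp f 2 (volume.restrict (Icc 0 r)) →
    onePlusConv H r (oneMinusKernel G r f) =ᵐ[volume.restrict (Icc 0 r)] f
  left_inverse : ∀ f : ℝ → ℂ, MemLp f 2 (volume.restrict (Icc 0 r)) →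
    oneMinusKernel G r (onePlusConv H r f) =ᵐ[volume.restrict (Icc 0 r)] f

/-- `Γ r s t = Γ_r(s,t)` is the resolvent kernel, for every `r > 0`, associated with an accelerant
of `w(x) dx / (2π)`. -/
def IsResolventFamily (w : ℝ → ℝ) (Γ : ℝ → ℝ → ℝ → ℂ) : Prop :=
  ∃ H : ℝ → ℂ, IsAccelerant w H ∧ ∀ r : ℝ, 0 < r → IsResolventKernel H r (Γ r)

/-- The remainder `R_{k,r}(x) = -i^k ∫₀ʳ (∂_t^k Γ_r(r,t)) e^{ixt} dt`. -/
def remainder (Γ : ℝ → ℝ → ℝ → ℂ) (k : ℕ) (r x : ℝ) : ℂ :=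
  -Complex.I ^ k * ∫ t in (0 : ℝ)..r,
    iteratedDerivWithin k (fun u : ℝ => Γ r r u) (Icc 0 r) t * Complex.exp (Complex.I * x * t)

/-- `sup_{r > 0} ‖R_{k,r}‖_{L^p(ℝ)}`, as an extended nonnegative real. -/
def supNorm (Γ : ℝ → ℝ → ℝ → ℂ) (k : ℕ) (p : ℝ) : ENNReal :=
  ⨆ (r : ℝ) (_ : 0 < r), eLpNorm (remainder Γ k r) (ENNReal.ofReal p) volume

/-- The standing assumptions: `w ≥ 0`, `⟨x⟩^k (w - 1) ∈ L¹(ℝ)`, `0 ≤ δ < 1` and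
`‖⟨x⟩^k (w - 1)‖_∞ ≤ δ`. -/
structure Admissible (k : ℕ) (δ : ℝ) (w : ℝ → ℝ) : Prop where
  nonneg : ∀ᵐ x : ℝ, 0 ≤ w x
  integrable : Integrable (weightedDiff k w) volume
  delta_mem : δ ∈ Ico (0 : ℝ) 1
  bound : eLpNorm (weightedDiff k w) ⊤ volume ≤ ENNReal.ofReal δ

end Krein

end

/-!
Write `v = w - 1` and `P_r(λ) = e^{iλr} + R_{0,r}(λ)`. The accelerant is the Fourier transform of
`v dλ / 2π`, so by Plancherel's theorem `ℋ_r` is a compression of the multiplier `v` and has norm at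
most `δ < 1` on `L²([0, r])`. Hence `I + ℋ_r` is invertible, and its inverse differs from `I` by an
operator with continuous kernel (`exists_isResolventKernel`). The accelerant is unique almost
everywhere (`IsAccelerant.ae_eq`), so nothing depends on its choice.

The last row of the resolvent equation `Γ + Γ ℋ = ℋ` says that `Γ_r(r, t)` is the Fourier integral
of `v P_r / 2π` at `-t`. It is therefore as smooth in `t` as `v` has moments, and differentiation
under the integral gives `R_{k,r} = -B_r(λ^k v P_r)` (`Admissible.remainder_eq`), where `B_r` is the
projection onto the frequencies in `[0, r]`. For `k = 0` this is the equation
`P_r = e^{iλr} - B_r(v P_r)`.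

The rest is harmonic analysis of `B_r`, with constants independent of `r`. It is a contraction of
`L²`. On `L^n` with `n` even it has norm at most `24 n` (`eLpNorm_bandProj_even_le`): this is the
theorem of M. Riesz, proved for Cauchy transforms `F` on horizontal lines from `∫ F^n = 0` and the
pointwise inequality `|z|^n ≤ 3 (4n)^n |Im z|^n + 2 Re z^n`. Duality gives the conjugate exponents.
All other exponents are reached by the log-convexity of `p ↦ ‖f‖_p` in `1/p` for fixed functions
`f`, applied to the terms of the Neumann series, so no interpolation theorem for operators is needed.
Let `b = ⟨λ⟩^k v` and let `θ` be defined by `|1/2 - 1/p| = θ (1/2 - 1/n)`.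

* In `L^p` the Neumann series is dominated by a geometric series of ratio `δ (24 n)^θ`
  (`eLpNorm_bandStep_solution_le_of_lt_one`). For every `δ < 1` this ratio is less than `1` for some
  `n` and some `θ > 0`, and as `δ → 0` the values `θ (1/2 - 1/n)` with this property approach `1/2`
  (`exponentRadius`).
* If `24 n δ ≤ 1/2`, then `‖R_{k,r}‖_q ≤ 48 n ‖b‖_q` for `q = 2`, `q = n` and the conjugate exponent
  of `n` (`eLpNorm_bandStep_solution_le`), and `‖b‖_q ≤ δ^{1 - 1/q} ‖b‖_1^{1/q}`. Log-convexity
  gives the same bound for `p`.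
-/

noncomputable section

namespace Krein

/-! ### The Fourier transform on `L¹ ∩ L²` -/

open scoped FourierTransform SchwartzMap ContDiff in
/-- On `L¹ ∩ L²` the `L²` Fourier transform is given by the Fourier integral. Both sides define
the same tempered distribution. -/
theorem coeFn_fourier_toLp {f : ℝ → ℂ} (hf : Integrable f) (hf2 : MemLp f 2) :
    (𝓕 (hf2.toLp f) : Lp ℂ 2 (volume : Measure ℝ)) =ᵐ[volume] 𝓕 f := by
  have hcont : Continuous (𝓕 f) := by
    refine VectorFourier.fourierIntegral_continuous Real.continuous_fourierChar ?_ hf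
    exact continuous_inner
  refine ae_eq_of_integral_contDiff_smul_eq
    ((Lp.memLp _).locallyIntegrable (by norm_num)) hcont.locallyIntegrable ?_
  intro g hg hgc
  have hgc' : HasCompactSupport (fun x => (g x : ℂ)) := hgc.comp_left (g := fun y : ℝ => (y : ℂ)) rfl
  have hg' : ContDiff ℝ ∞ (fun x => (g x : ℂ)) := Complex.ofRealCLM.contDiff.comp hg
  set φ : 𝓢(ℝ, ℂ) := hgc'.toSchwartzMap hg' with hφ
  have hφg : ∀ x, φ x = (g x : ℂ) := fun x => rfl
  have h1 := congrArg (fun T : 𝓢'(ℝ, ℂ) => T φ)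
    (Lp.fourier_toTemperedDistribution_eq (hf2.toLp f))
  simp only [TemperedDistribution.fourier_apply, Lp.toTemperedDistribution_apply] at h1
  have h2 : ∫ x, (𝓕 φ) x • (hf2.toLp f) x = ∫ x, (𝓕 (φ : ℝ → ℂ)) x • f x := by
    refine integral_congr_ae ?_
    filter_upwards [hf2.coeFn_toLp] with x hx
    rw [hx, SchwartzMap.fourier_coe]
  have h3 : ∫ x, (𝓕 (φ : ℝ → ℂ)) x • f x = ∫ x, φ x • (𝓕 f) x := by
    simpa using! (VectorFourier.integral_fourierIntegral_smul_eq_flip (L := innerₗ ℝ)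
      Real.continuous_fourierChar continuous_inner φ.integrable hf)
  rw [h2, h3] at h1
  simp only [hφg] at h1
  simpa [Complex.real_smul] using h1.symm

open scoped FourierTransform in
theorem eLpNorm_two_fourier {f : ℝ → ℂ} (hf : Integrable f) (hf2 : MemLp f 2) :
    eLpNorm (𝓕 f) 2 volume = eLpNorm f 2 volume := by
  have h := Lp.norm_fourier_eq (hf2.toLp f)
  rw [← eLpNorm_congr_ae (coeFn_fourier_toLp hf hf2)]
  rw [Lp.norm_def, Lp.norm_def, ENNReal.toReal_eq_toReal_iff' (Lp.eLpNorm_ne_top _)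
    (Lp.eLpNorm_ne_top _)] at h
  rw [h]
  exact eLpNorm_congr_ae hf2.coeFn_toLp

/-- The Fourier integral `x ↦ ∫ e^{ixt} f(t) dt`, with the sign and normalization of Krein
systems. -/
def expIntegral (f : ℝ → ℂ) (x : ℝ) : ℂ := ∫ t : ℝ, Complex.exp (Complex.I * x * t) * f t

theorem norm_exp_I_mul_mul (x t : ℝ) : ‖Complex.exp (Complex.I * x * t)‖ = 1 := by
  rw [show Complex.I * x * t = ((x * t : ℝ) : ℂ) * Complex.I by push_cast; ring,
    Complex.norm_exp_ofReal_mul_I]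

theorem continuous_exp_I_mul_mul : Continuous fun p : ℝ × ℝ => Complex.exp (Complex.I * p.1 * p.2) := by
  fun_prop

theorem integrable_exp_mul {μ : Measure ℝ} {f : ℝ → ℂ} (hf : Integrable f μ) (x : ℝ) :
    Integrable (fun t : ℝ => Complex.exp (Complex.I * x * t) * f t) μ := by
  refine hf.bdd_mul (c := 1) ?_ (Eventually.of_forall fun t => (norm_exp_I_mul_mul x t).le)
  exact (by fun_prop : Continuous fun t : ℝ => Complex.exp (Complex.I * x * t)).aestronglyMeasurable

open scoped FourierTransform in
theorem expIntegral_eq_fourier (f : ℝ → ℂ) (x : ℝ) :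
    expIntegral f x = 𝓕 f ((-(2 * Real.pi)⁻¹) * x) := by
  rw [Real.fourier_eq', expIntegral]
  refine integral_congr_ae (Eventually.of_forall fun t => ?_)
  simp only [smul_eq_mul]
  congr 2
  have : (Real.pi : ℂ) ≠ 0 := by exact_mod_cast Real.pi_ne_zero
  simp
  field_simp

theorem continuous_expIntegral {f : ℝ → ℂ} (hf : Integrable f) : Continuous (expIntegral f) := by
  refine continuous_of_dominated (bound := fun t => ‖f t‖) ?_ ?_ hf.norm ?_
  · exact fun x => (integrable_exp_mul hf x).1
  · intro x
    filter_upwards with t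
    rw [norm_mul, norm_exp_I_mul_mul, one_mul]
  · filter_upwards with t
    fun_prop

theorem norm_expIntegral_le (f : ℝ → ℂ) (x : ℝ) : ‖expIntegral f x‖ ≤ ∫ t, ‖f t‖ := by
  refine (norm_integral_le_integral_norm _).trans (le_of_eq ?_)
  refine integral_congr_ae (Eventually.of_forall fun t => ?_)
  simp only [norm_mul, norm_exp_I_mul_mul, one_mul]

theorem eLpNorm_two_eq_lintegral {α E : Type*} [MeasurableSpace α] [NormedAddCommGroup E]
    (μ : Measure α) (f : α → E) :
    eLpNorm f 2 μ ^ (2 : ℝ) = ∫⁻ x, ‖f x‖ₑ ^ (2 : ℝ) ∂μ := by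
  rw [eLpNorm_eq_lintegral_rpow_enorm_toReal (by norm_num) (by norm_num), ← ENNReal.rpow_mul]
  norm_num

open scoped FourierTransform in
/-- Plancherel's theorem. -/
theorem lintegral_enorm_expIntegral_sq {f : ℝ → ℂ} (hf : Integrable f) (hf2 : MemLp f 2) :
    ∫⁻ x, ‖expIntegral f x‖ₑ ^ (2 : ℝ) =
      ENNReal.ofReal (2 * Real.pi) * ∫⁻ x, ‖f x‖ₑ ^ (2 : ℝ) := by
  have ha : (-(2 * Real.pi)⁻¹ : ℝ) ≠ 0 := by simp [Real.pi_ne_zero]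
  have hcont : Continuous (𝓕 f) := by
    refine VectorFourier.fourierIntegral_continuous Real.continuous_fourierChar ?_ hf
    exact continuous_inner
  simp_rw [expIntegral_eq_fourier]
  rw [← eLpNorm_two_eq_lintegral volume f, ← eLpNorm_two_fourier hf hf2,
    eLpNorm_two_eq_lintegral]
  have hm : Measurable fun y : ℝ => ‖𝓕 f y‖ₑ ^ (2 : ℝ) :=
    (hcont.measurable.enorm).pow_const _
  rw [← lintegral_map (μ := volume) (f := fun y : ℝ => ‖𝓕 f y‖ₑ ^ (2 : ℝ)) hm
    (measurable_const_mul (-(2 * Real.pi)⁻¹ : ℝ)), Real.map_volume_mul_left ha,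
    lintegral_smul_measure, smul_eq_mul]
  congr 2
  rw [inv_neg, inv_inv, abs_neg, abs_of_pos (by positivity)]

theorem eLpNorm_two_le_of_lintegral {α E F : Type*} [MeasurableSpace α] [NormedAddCommGroup E]
    [NormedAddCommGroup F] {μ ν : Measure α} {f : α → E} {g : α → F}
    (h : ∫⁻ x, ‖f x‖ₑ ^ (2 : ℝ) ∂μ ≤ ∫⁻ x, ‖g x‖ₑ ^ (2 : ℝ) ∂ν) :
    eLpNorm f 2 μ ≤ eLpNorm g 2 ν := by
  rw [← eLpNorm_two_eq_lintegral, ← eLpNorm_two_eq_lintegral] at h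
  exact (ENNReal.rpow_le_rpow_iff (by norm_num)).1 h

/-! ### Young's inequality and a pointwise inequality -/

/-- Young's convolution inequality `‖k * b‖_q ≤ ‖k‖_1 ‖b‖_q`. -/
theorem lintegral_conv_rpow_le {k b : ℝ → ENNReal} (hk : AEMeasurable k) (hb : Measurable b)
    {q : ℝ} (hq : 1 ≤ q) :
    ∫⁻ x, (∫⁻ t, k t * b (x - t)) ^ q ≤ (∫⁻ t, k t) ^ q * ∫⁻ x, b x ^ q := by
  have hq0 : 0 < q := by linarith
  have hb' : ∀ x : ℝ, Measurable fun t => b (x - t) := fun x =>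
    hb.comp (measurable_const.sub measurable_id)
  -- Hölder's inequality with respect to the weight `k`
  have h1 : ∀ x, (∫⁻ t, k t * b (x - t)) ^ q ≤
      (∫⁻ t, k t) ^ (q - 1) * ∫⁻ t, k t * b (x - t) ^ q := by
    intro x
    have h := ENNReal.lintegral_mul_norm_pow_le (μ := volume) (f := k)
      (g := fun t => k t * b (x - t) ^ q) hk (hk.mul ((hb' x).pow_const q).aemeasurable)
      (p := 1 - 1 / q) (q := 1 / q) (by rw [sub_nonneg, div_le_one hq0]; exact hq) (by positivity)
      (by ring)
    have h2 : ∀ t, k t ^ (1 - 1 / q) * (k t * b (x - t) ^ q) ^ (1 / q) = k t * b (x - t) := by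
      intro t
      rw [ENNReal.mul_rpow_of_nonneg _ _ (by positivity), ← ENNReal.rpow_mul, ← mul_assoc,
        ← ENNReal.rpow_add_of_nonneg _ _ (by rw [sub_nonneg, div_le_one hq0]; exact hq)
          (by positivity)]
      rw [mul_one_div_cancel hq0.ne']
      simp
    simp_rw [h2] at h
    calc (∫⁻ t, k t * b (x - t)) ^ q
        ≤ ((∫⁻ t, k t) ^ (1 - 1 / q) * (∫⁻ t, k t * b (x - t) ^ q) ^ (1 / q)) ^ q :=
          ENNReal.rpow_le_rpow h hq0.le
      _ = _ := by
          rw [ENNReal.mul_rpow_of_nonneg _ _ hq0.le, ← ENNReal.rpow_mul, ← ENNReal.rpow_mul,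
            one_div_mul_cancel hq0.ne', ENNReal.rpow_one]
          congr 2
          field_simp
  calc ∫⁻ x, (∫⁻ t, k t * b (x - t)) ^ q
      ≤ ∫⁻ x, (∫⁻ t, k t) ^ (q - 1) * ∫⁻ t, k t * b (x - t) ^ q := lintegral_mono h1
    _ = (∫⁻ t, k t) ^ (q - 1) * ∫⁻ x, ∫⁻ t, k t * b (x - t) ^ q := by
        refine lintegral_const_mul'' _ ?_
        refine AEMeasurable.lintegral_prod_right' (f := fun p : ℝ × ℝ => k p.2 * b (p.1 - p.2) ^ q) ?_
        refine (hk.comp_quasiMeasurePreserving Measure.quasiMeasurePreserving_snd).mul ?_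
        exact ((hb.comp (measurable_fst.sub measurable_snd)).pow_const q).aemeasurable
    _ = (∫⁻ t, k t) ^ (q - 1) * ∫⁻ t, ∫⁻ x, k t * b (x - t) ^ q := by
        rw [lintegral_lintegral_swap]
        refine (hk.comp_quasiMeasurePreserving Measure.quasiMeasurePreserving_snd).mul ?_
        exact ((hb.comp (measurable_fst.sub measurable_snd)).pow_const q).aemeasurable
    _ = (∫⁻ t, k t) ^ (q - 1) * ∫⁻ t, k t * ∫⁻ x, b x ^ q := by
        congr 1
        refine lintegral_congr fun t => ?_
        have hm : Measurable fun x => b (x - t) ^ q :=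
          (hb.comp (measurable_id.sub_const t)).pow_const q
        rw [lintegral_const_mul _ hm, lintegral_sub_right_eq_self (fun x => b x ^ q) t]
    _ = (∫⁻ t, k t) ^ q * ∫⁻ x, b x ^ q := by
        rw [lintegral_mul_const'' _ hk, ← mul_assoc]
        congr 1
        nth_rewrite 2 [← ENNReal.rpow_one (∫⁻ t, k t)]
        rw [← ENNReal.rpow_add_of_nonneg _ _ (by linarith) zero_le_one, sub_add_cancel]

theorem norm_pow_sub_pow_le_of_norm_le {z a : ℂ} (h : ‖a‖ ≤ ‖z‖) (n : ℕ) :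
    ‖z ^ (n + 1) - a ^ (n + 1)‖ ≤ (n + 1) * ‖z - a‖ * ‖z‖ ^ n := by
  induction n with
  | zero => simp
  | succ n ih =>
    have : z ^ (n + 1 + 1) - a ^ (n + 1 + 1) =
        z * (z ^ (n + 1) - a ^ (n + 1)) + (z - a) * a ^ (n + 1) := by ring
    rw [this]
    refine (norm_add_le _ _).trans ?_
    rw [norm_mul, norm_mul, norm_pow]
    have h2 : ‖a‖ ^ (n + 1) ≤ ‖z‖ ^ (n + 1) := by gcongr
    calc ‖z‖ * ‖z ^ (n + 1) - a ^ (n + 1)‖ + ‖z - a‖ * ‖a‖ ^ (n + 1)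
        ≤ ‖z‖ * ((n + 1) * ‖z - a‖ * ‖z‖ ^ n) + ‖z - a‖ * ‖z‖ ^ (n + 1) := by gcongr
      _ = _ := by push_cast; ring

/-- The pointwise inequality behind the theorem of M. Riesz: for even `n` the modulus is controlled
by the imaginary part and the real part of the `n`-th power. -/
theorem norm_pow_le_im_add_re {n : ℕ} (hn : Even n) (hn0 : 0 < n) (z : ℂ) :
    ‖z‖ ^ n ≤ 3 * (4 * n) ^ n * |z.im| ^ n + 2 * (z ^ n).re := by
  have hn1 : (1 : ℝ) ≤ n := by exact_mod_cast hn0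
  rcases le_or_gt (4 * n * |z.im|) ‖z‖ with h | h
  · -- near the real axis `z ^ n` is close to the nonnegative number `(re z) ^ n`
    obtain ⟨m, rfl⟩ : ∃ m, n = m + 1 := ⟨n - 1, by omega⟩
    have h1 : ‖((z.re : ℝ) : ℂ)‖ ≤ ‖z‖ := by
      rw [Complex.norm_real]; exact Complex.abs_re_le_norm z
    have h2 := norm_pow_sub_pow_le_of_norm_le h1 m
    have h3 : ‖z - (z.re : ℂ)‖ = |z.im| := by
      have : z - (z.re : ℂ) = (z.im : ℂ) * Complex.I := by
        apply Complex.ext <;> simp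
      rw [this]; simp
    rw [h3] at h2
    have h4 := (Complex.abs_re_le_norm (z ^ (m + 1) - (z.re : ℂ) ^ (m + 1))).trans h2
    rw [Complex.sub_re, ← Complex.ofReal_pow, Complex.ofReal_re] at h4
    have h5 := abs_pow_sub_pow_le ‖z‖ |z.re| (m + 1)
    have h6 : |(‖z‖ - |z.re|)| ≤ |z.im| := by
      rw [abs_of_nonneg (sub_nonneg.2 (Complex.abs_re_le_norm z))]
      have := Complex.norm_le_abs_re_add_abs_im z
      linarith
    have h7 : max |(‖z‖)| |(|z.re|)| = ‖z‖ := by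
      rw [abs_abs, abs_norm, max_eq_left (Complex.abs_re_le_norm z)]
    rw [h7, hn.pow_abs, Nat.add_sub_cancel] at h5
    have h8 : ‖z‖ ^ (m + 1) - z.re ^ (m + 1) ≤ (m + 1) * |z.im| * ‖z‖ ^ m := by
      refine (le_abs_self _).trans (h5.trans ?_)
      push_cast
      calc |(‖z‖ - |z.re|)| * ((m : ℝ) + 1) * ‖z‖ ^ m ≤ |z.im| * ((m : ℝ) + 1) * ‖z‖ ^ m := by gcongr
        _ = _ := by ring
    have h9 := (abs_le.1 h4).1
    push_cast at h
    have h10 : 4 * ((m + 1) * |z.im| * ‖z‖ ^ m) ≤ ‖z‖ ^ (m + 1) := by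
      calc 4 * ((m + 1) * |z.im| * ‖z‖ ^ m) = (4 * (m + 1) * |z.im|) * ‖z‖ ^ m := by ring
        _ ≤ ‖z‖ * ‖z‖ ^ m := by gcongr
        _ = _ := by ring
    have h11 : 0 ≤ 3 * (4 * ((m + 1 : ℕ) : ℝ)) ^ (m + 1) * |z.im| ^ (m + 1) := by positivity
    linarith
  · have h1 : ‖z‖ ^ n ≤ (4 * n) ^ n * |z.im| ^ n := by
      rw [← mul_pow]; gcongr
    have h2 : -‖z‖ ^ n ≤ (z ^ n).re := by
      have := (abs_le.1 (Complex.abs_re_le_norm (z ^ n))).1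
      rwa [norm_pow] at this
    linarith

/-! ### The Cauchy transform in the upper half plane -/

/-- The Cauchy transform `z ↦ ∫ f(t) / (z - t) dt`. -/
def cauchyTransform (f : ℝ → ℂ) (z : ℂ) : ℂ := ∫ t : ℝ, (z - t)⁻¹ * f t

theorem im_le_norm_sub_ofReal (z : ℂ) (t : ℝ) : z.im ≤ ‖z - t‖ := by
  have := Complex.abs_im_le_norm (z - t)
  rw [Complex.sub_im, Complex.ofReal_im, sub_zero] at this
  exact (le_abs_self _).trans this

theorem norm_inv_sub_ofReal_le {z : ℂ} (hz : 0 < z.im) (t : ℝ) : ‖(z - t)⁻¹‖ ≤ z.im⁻¹ := by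
  rw [norm_inv]
  exact inv_anti₀ hz (im_le_norm_sub_ofReal z t)

theorem sub_ofReal_ne_zero {z : ℂ} (hz : 0 < z.im) (t : ℝ) : z - t ≠ 0 :=
  norm_pos_iff.1 (hz.trans_le (im_le_norm_sub_ofReal z t))

theorem integrable_cauchy_integrand {f : ℝ → ℂ} (hf : Integrable f) {z : ℂ} (hz : 0 < z.im) :
    Integrable fun t : ℝ => (z - t)⁻¹ * f t := by
  refine hf.bdd_mul (c := z.im⁻¹) ?_ (Eventually.of_forall (norm_inv_sub_ofReal_le hz))
  exact (by fun_prop : Measurable fun t : ℝ => (z - t)⁻¹).aestronglyMeasurable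

theorem norm_cauchyTransform_le {f : ℝ → ℂ} (hf : Integrable f) {z : ℂ} (hz : 0 < z.im) :
    ‖cauchyTransform f z‖ ≤ z.im⁻¹ * ∫ t, ‖f t‖ := by
  rw [← integral_const_mul]
  refine norm_integral_le_of_norm_le (hf.norm.const_mul _) (Eventually.of_forall fun t => ?_)
  rw [norm_mul]
  gcongr
  exact norm_inv_sub_ofReal_le hz t

theorem differentiableAt_cauchyTransform {f : ℝ → ℂ} (hf : Integrable f) {z : ℂ}
    (hz : 0 < z.im) : DifferentiableAt ℂ (cauchyTransform f) z := by
  set s : Set ℂ := {w | z.im / 2 < w.im} with hs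
  have hso : IsOpen s := isOpen_lt continuous_const Complex.continuous_im
  have hzs : z ∈ s := by simp only [hs, mem_ofPred_eq]; linarith
  have hpos : ∀ w ∈ s, 0 < w.im := fun w hw => lt_trans (by linarith) (show z.im / 2 < w.im from hw)
  refine (hasDerivAt_integral_of_dominated_loc_of_deriv_le (μ := volume) (𝕜 := ℂ) (s := s)
    (bound := fun t => (z.im / 2)⁻¹ ^ 2 * ‖f t‖)
    (F := fun (w : ℂ) (t : ℝ) => (w - t)⁻¹ * f t)
    (F' := fun (w : ℂ) (t : ℝ) => (-1 / (w - t) ^ 2) * f t) (hso.mem_nhds hzs) ?_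
    (integrable_cauchy_integrand hf hz) ?_ ?_ (hf.norm.const_mul _) ?_).2.differentiableAt
  · filter_upwards [hso.mem_nhds hzs] with w hw
    exact (integrable_cauchy_integrand hf (hpos w hw)).1
  · exact ((by fun_prop : Measurable fun t : ℝ => (-1 / (z - t) ^ 2 : ℂ)).aestronglyMeasurable).mul hf.1
  · refine Eventually.of_forall fun t w hw => ?_
    rw [norm_mul]
    gcongr
    rw [norm_div, norm_neg, norm_one, norm_pow, one_div, ← inv_pow, ← norm_inv]
    gcongr
    refine (norm_inv_sub_ofReal_le (hpos w hw) t).trans ?_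
    exact inv_anti₀ (by linarith) (le_of_lt hw)
  · refine Eventually.of_forall fun t w hw => ?_
    refine HasDerivAt.mul_const ?_ _
    have h := ((hasDerivAt_id w).sub_const (t : ℂ)).inv (sub_ofReal_ne_zero (hpos w hw) t)
    simpa using! h

theorem tendsto_cauchyTransform_zero {f : ℝ → ℂ} (hf : Integrable f) {l : Filter ℝ}
    [l.IsCountablyGenerated] (hl : Tendsto (fun x : ℝ => |x|) l atTop) {y : ℝ} (hy : 0 < y) :
    Tendsto (fun x : ℝ => cauchyTransform f (x + y * Complex.I)) l (𝓝 0) := by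
  have him : ∀ x : ℝ, ((x : ℂ) + y * Complex.I).im = y := fun x => by simp
  have h := tendsto_integral_filter_of_dominated_convergence (μ := volume) (l := l)
    (F := fun (x : ℝ) (t : ℝ) => ((x + y * Complex.I : ℂ) - t)⁻¹ * f t) (f := fun _ => 0)
    (fun t => y⁻¹ * ‖f t‖) ?_ ?_ (hf.norm.const_mul _) ?_
  · simpa [cauchyTransform] using! h
  · exact Eventually.of_forall fun x => (integrable_cauchy_integrand hf (by rw [him]; exact hy)).1
  · refine Eventually.of_forall fun x => Eventually.of_forall fun t => ?_
    rw [norm_mul]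
    gcongr
    have := norm_inv_sub_ofReal_le (z := x + y * Complex.I) (by rw [him]; exact hy) t
    rwa [him] at this
  · refine Eventually.of_forall fun t => ?_
    rw [← zero_mul (f t)]
    refine Tendsto.mul_const _ ?_
    refine tendsto_inv₀_cobounded.comp ?_
    rw [← tendsto_norm_atTop_iff_cobounded]
    refine tendsto_atTop_mono (f := fun x : ℝ => |x| + (-|t|)) (fun x => ?_)
      (tendsto_atTop_add_const_right _ _ hl)
    have h1 := Complex.abs_re_le_norm ((x + y * Complex.I : ℂ) - t)
    have h2 : ((x + y * Complex.I : ℂ) - t).re = x - t := by simp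
    rw [h2] at h1
    have h3 := abs_sub_abs_le_abs_sub x t
    linarith

theorem lintegral_ofReal_poisson {y : ℝ} (hy : 0 < y) :
    ∫⁻ t : ℝ, ENNReal.ofReal (y / (t ^ 2 + y ^ 2)) = ENNReal.ofReal Real.pi := by
  have hγ : (y.toNNReal : ℝ) = y := Real.coe_toNNReal y hy.le
  have h := ProbabilityTheory.lintegral_cauchyPDF_eq_one 0 (γ := y.toNNReal)
    (Real.toNNReal_pos.2 hy).ne'
  have h2 : ∀ t : ℝ, ENNReal.ofReal (y / (t ^ 2 + y ^ 2)) =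
      ENNReal.ofReal Real.pi * ProbabilityTheory.cauchyPDF 0 y.toNNReal t := by
    intro t
    rw [ProbabilityTheory.cauchyPDF_def, ProbabilityTheory.cauchyPDFReal_def,
      ← ENNReal.ofReal_mul Real.pi_pos.le, hγ]
    congr 1
    have := Real.pi_ne_zero
    field_simp
    simp
  simp_rw [h2]
  rw [lintegral_const_mul _ (ProbabilityTheory.measurable_cauchyPDF _ _), h, mul_one]

theorem enorm_inv_add_mul_I_sq {y : ℝ} (hy : 0 < y) (x : ℝ) :
    ‖((x : ℂ) + y * Complex.I)⁻¹‖ₑ ^ (2 : ℝ) =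
      ENNReal.ofReal y⁻¹ * ENNReal.ofReal (y / (x ^ 2 + y ^ 2)) := by
  rw [← ENNReal.ofReal_mul (by positivity), ← ofReal_norm,
    ENNReal.ofReal_rpow_of_nonneg (norm_nonneg _) (by norm_num)]
  congr 1
  rw [norm_inv, Real.rpow_two, inv_pow, ← Complex.normSq_eq_norm_sq, Complex.normSq_add_mul_I]
  field_simp

theorem cauchyTransform_add_mul_I (f : ℝ → ℂ) (x y : ℝ) :
    cauchyTransform f (x + y * Complex.I) =
      ∫ t : ℝ, ((((x - t : ℝ) : ℂ)) + y * Complex.I)⁻¹ * f t := by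
  rw [cauchyTransform]
  refine integral_congr_ae (Eventually.of_forall fun t => ?_)
  simp only
  congr 2
  push_cast
  ring

theorem lintegral_enorm_cauchyTransform_sq_le {f : ℝ → ℂ} (hf : Integrable f) {y : ℝ}
    (hy : 0 < y) :
    ∫⁻ x : ℝ, ‖cauchyTransform f (x + y * Complex.I)‖ₑ ^ (2 : ℝ) ≤
      (∫⁻ t, ‖f t‖ₑ) ^ (2 : ℝ) * ENNReal.ofReal (Real.pi / y) := by
  have hb : Measurable fun x : ℝ => ‖((x : ℂ) + y * Complex.I)⁻¹‖ₑ := by fun_prop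
  have h := lintegral_conv_rpow_le (k := fun t => ‖f t‖ₑ) hf.1.enorm hb (q := 2) (by norm_num)
  simp_rw [enorm_inv_add_mul_I_sq hy] at h
  rw [lintegral_const_mul _ (by fun_prop), lintegral_ofReal_poisson hy,
    ← ENNReal.ofReal_mul (by positivity), ← div_eq_inv_mul] at h
  refine le_trans (lintegral_mono fun x => ?_) h
  rw [cauchyTransform_add_mul_I]
  gcongr
  refine (enorm_integral_le_lintegral_enorm _).trans (le_of_eq ?_)
  refine lintegral_congr fun t => ?_
  rw [enorm_mul, mul_comm]

theorem continuous_cauchyTransform_line {f : ℝ → ℂ} (hf : Integrable f) {y : ℝ} (hy : 0 < y) :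
    Continuous fun x : ℝ => cauchyTransform f (x + y * Complex.I) := by
  refine continuous_iff_continuousAt.2 fun x => ?_
  have h : ContinuousAt (cauchyTransform f) (x + y * Complex.I) :=
    (differentiableAt_cauchyTransform hf (by simpa using hy)).continuousAt
  exact ContinuousAt.comp (f := fun x : ℝ => (x + y * Complex.I : ℂ)) h (by fun_prop)

theorem memLp_two_cauchyTransform_line {f : ℝ → ℂ} (hf : Integrable f) {y : ℝ} (hy : 0 < y) :
    MemLp (fun x : ℝ => cauchyTransform f (x + y * Complex.I)) 2 := by
  refine ⟨(continuous_cauchyTransform_line hf hy).aestronglyMeasurable, ?_⟩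
  have h := lintegral_enorm_cauchyTransform_sq_le hf hy
  rw [← eLpNorm_two_eq_lintegral] at h
  have h2 : eLpNorm (fun x : ℝ => cauchyTransform f (x + y * Complex.I)) 2 volume ^ (2 : ℝ) < ⊤ := by
    refine h.trans_lt (ENNReal.mul_lt_top ?_ ENNReal.ofReal_lt_top)
    exact ENNReal.rpow_lt_top_of_nonneg (by norm_num) hf.2.ne
  exact (ENNReal.rpow_lt_top_iff_of_pos (by norm_num)).1 h2

theorem integral_norm_cauchyTransform_sq_le {f : ℝ → ℂ} (hf : Integrable f) {y : ℝ}
    (hy : 0 < y) :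
    ∫ x : ℝ, ‖cauchyTransform f (x + y * Complex.I)‖ ^ 2 ≤ (∫ t, ‖f t‖) ^ 2 * (Real.pi / y) := by
  have h := lintegral_enorm_cauchyTransform_sq_le hf hy
  have h1 : ∫⁻ t, ‖f t‖ₑ = ENNReal.ofReal (∫ t, ‖f t‖) :=
    (ofReal_integral_norm_eq_lintegral_enorm hf).symm
  have h0 : 0 ≤ ∫ t, ‖f t‖ := integral_nonneg fun _ => norm_nonneg _
  rw [h1, ENNReal.ofReal_rpow_of_nonneg h0 (by norm_num), ← ENNReal.ofReal_mul (by positivity)] at h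
  have hi := (memLp_two_iff_integrable_sq_norm
    (continuous_cauchyTransform_line hf hy).aestronglyMeasurable).1
    (memLp_two_cauchyTransform_line hf hy)
  rw [← ENNReal.ofReal_le_ofReal_iff (by positivity)]
  rw [ofReal_integral_eq_lintegral_ofReal hi (Eventually.of_forall fun _ => by positivity)]
  rw [Real.rpow_two] at h
  refine le_trans (le_of_eq (lintegral_congr fun x => ?_)) h
  rw [← ofReal_norm, ENNReal.ofReal_rpow_of_nonneg (norm_nonneg _) (by norm_num),
    Real.rpow_two]

theorem norm_cauchyTransform_pow_le {f : ℝ → ℂ} (hf : Integrable f) {y : ℝ} (hy : 0 < y) (n : ℕ)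
    (x : ℝ) :
    ‖cauchyTransform f (x + y * Complex.I) ^ (n + 2)‖ ≤
      (y⁻¹ * ∫ t, ‖f t‖) ^ n * ‖cauchyTransform f (x + y * Complex.I)‖ ^ 2 := by
  rw [norm_pow, pow_add]
  gcongr
  have := norm_cauchyTransform_le hf (z := x + y * Complex.I) (by simpa using hy)
  simpa using this

theorem integrable_cauchyTransform_pow {f : ℝ → ℂ} (hf : Integrable f) {y : ℝ} (hy : 0 < y)
    (n : ℕ) : Integrable fun x : ℝ => cauchyTransform f (x + y * Complex.I) ^ (n + 2) := by
  have hi := (memLp_two_iff_integrable_sq_norm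
    (continuous_cauchyTransform_line hf hy).aestronglyMeasurable).1
    (memLp_two_cauchyTransform_line hf hy)
  exact (hi.const_mul _).mono' ((continuous_cauchyTransform_line hf hy).pow _).aestronglyMeasurable
    (Eventually.of_forall (norm_cauchyTransform_pow_le hf hy n))

/-- Integrals of powers of a Cauchy transform over horizontal lines do not depend on the line, by
Cauchy's theorem on rectangles. The exponent `n + 2` makes the powers integrable. -/
theorem integral_cauchyTransform_pow_eq {f : ℝ → ℂ} (hf : Integrable f) {y₁ y₂ : ℝ}
    (h₁ : 0 < y₁) (h₁₂ : y₁ ≤ y₂) (n : ℕ) :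
    ∫ x : ℝ, cauchyTransform f (x + y₁ * Complex.I) ^ (n + 2) =
      ∫ x : ℝ, cauchyTransform f (x + y₂ * Complex.I) ^ (n + 2) := by
  have h₂ : 0 < y₂ := h₁.trans_le h₁₂
  set G : ℂ → ℂ := fun z => cauchyTransform f z ^ (n + 2) with hG
  have hdiff : ∀ z : ℂ, 0 < z.im → DifferentiableAt ℂ G z := fun z hz =>
    (differentiableAt_cauchyTransform hf hz).pow _
  have hrect : ∀ R : ℝ, (((∫ x in (-R)..R, G (x + y₁ * Complex.I)) -
      ∫ x in (-R)..R, G (x + y₂ * Complex.I)) +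
      Complex.I • ∫ y in y₁..y₂, G ((R : ℝ) + y * Complex.I)) -
      Complex.I • ∫ y in y₁..y₂, G ((-R : ℝ) + y * Complex.I) = 0 := by
    intro R
    have h := Complex.integral_boundary_rect_eq_zero_of_differentiableOn G
      ((-R : ℝ) + y₁ * Complex.I) ((R : ℝ) + y₂ * Complex.I) ?_
    · simpa using! h
    · intro z hz
      refine (hdiff z ?_).differentiableWithinAt
      have := hz.2
      simp only [Complex.add_im, Complex.ofReal_im, Complex.mul_im, Complex.ofReal_re,
        Complex.I_im, mul_one, Complex.I_re, mul_zero, add_zero, zero_add, mem_preimage,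
        uIcc_of_le h₁₂] at this
      exact h₁.trans_le this.1
  have hside : ∀ σ : ℝ → ℝ, Tendsto (fun R => |σ R|) atTop atTop →
      Tendsto (fun R : ℝ => ∫ y in y₁..y₂, G ((σ R : ℝ) + y * Complex.I)) atTop (𝓝 0) := by
    intro σ hσ
    have h := intervalIntegral.tendsto_integral_filter_of_dominated_convergence
      (μ := volume) (a := y₁) (b := y₂) (l := atTop)
      (F := fun (R : ℝ) (y : ℝ) => G ((σ R : ℝ) + y * Complex.I)) (f := fun _ => 0)
      (fun _ => (y₁⁻¹ * ∫ t, ‖f t‖) ^ (n + 2)) ?_ ?_ intervalIntegrable_const ?_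
    · simpa using h
    · refine Eventually.of_forall fun R => ?_
      refine ContinuousOn.aestronglyMeasurable (fun y hy => ?_) measurableSet_uIoc
      rw [uIoc_of_le h₁₂] at hy
      have hc : ContinuousAt G ((σ R : ℝ) + y * Complex.I) :=
        (hdiff _ (by simpa using h₁.trans hy.1)).continuousAt
      exact (ContinuousAt.comp (f := fun y : ℝ => ((σ R : ℝ) + y * Complex.I : ℂ)) hc
        (by fun_prop)).continuousWithinAt
    · refine Eventually.of_forall fun R => Eventually.of_forall fun y hy => ?_
      rw [uIoc_of_le h₁₂] at hy
      have hy0 : 0 < y := h₁.trans hy.1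
      simp only [hG, norm_pow]
      gcongr
      have := norm_cauchyTransform_le hf (z := (σ R : ℝ) + y * Complex.I) (by simpa using hy0)
      refine this.trans ?_
      have h0 : 0 ≤ ∫ t, ‖f t‖ := integral_nonneg fun _ => norm_nonneg _
      have : ((σ R : ℝ) + y * Complex.I : ℂ).im = y := by simp
      rw [this]
      gcongr
      exact hy.1.le
    · refine Eventually.of_forall fun y hy => ?_
      rw [uIoc_of_le h₁₂] at hy
      have h := tendsto_cauchyTransform_zero hf (l := map σ atTop) (by simpa [tendsto_map'_iff] using! hσ)
        (h₁.trans hy.1)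
      have h' := (tendsto_map'_iff.1 h).pow (n + 2)
      simpa [hG] using! h'
  have hA := intervalIntegral_tendsto_integral (integrable_cauchyTransform_pow hf h₁ n)
    tendsto_neg_atTop_atBot tendsto_id
  have hB := intervalIntegral_tendsto_integral (integrable_cauchyTransform_pow hf h₂ n)
    tendsto_neg_atTop_atBot tendsto_id
  have hC := hside (fun R => R) tendsto_abs_atTop_atTop
  have hD := hside (fun R => -R) (by simpa using tendsto_abs_atTop_atTop)
  have hlim := ((hA.sub hB).add (hC.const_smul Complex.I)).sub (hD.const_smul Complex.I)
  have hlim0 := hlim.congr (fun R => hrect R)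
  have := tendsto_nhds_unique hlim0 tendsto_const_nhds
  simp only [smul_zero, add_zero, sub_zero] at this
  exact sub_eq_zero.1 this

/-- Powers of a Cauchy transform have mean zero on horizontal lines: shift the line to infinity. -/
theorem integral_cauchyTransform_pow_eq_zero {f : ℝ → ℂ} (hf : Integrable f) {y : ℝ} (hy : 0 < y)
    (n : ℕ) : ∫ x : ℝ, cauchyTransform f (x + y * Complex.I) ^ (n + 2) = 0 := by
  set A : ℝ := ∫ t, ‖f t‖ with hA
  have hA0 : 0 ≤ A := integral_nonneg fun _ => norm_nonneg _
  have hbound : ∀ Y : ℝ, max y 1 ≤ Y →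
      ‖∫ x : ℝ, cauchyTransform f (x + y * Complex.I) ^ (n + 2)‖ ≤ A ^ n * (A ^ 2 * Real.pi) * Y⁻¹ := by
    intro Y hY
    have hY1 : 1 ≤ Y := (le_max_right _ _).trans hY
    have hY0 : 0 < Y := by linarith
    rw [integral_cauchyTransform_pow_eq hf hy ((le_max_left _ _).trans hY) n]
    have hi := (memLp_two_iff_integrable_sq_norm
      (continuous_cauchyTransform_line hf hY0).aestronglyMeasurable).1
      (memLp_two_cauchyTransform_line hf hY0)
    refine (norm_integral_le_of_norm_le (hi.const_mul _)
      (Eventually.of_forall (norm_cauchyTransform_pow_le hf hY0 n))).trans ?_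
    rw [integral_const_mul, ← hA]
    have h1 := integral_norm_cauchyTransform_sq_le hf hY0
    have h2 : (Y⁻¹ * A) ^ n ≤ A ^ n := by
      refine pow_le_pow_left₀ (by positivity) ?_ n
      exact mul_le_of_le_one_left hA0 (inv_le_one_of_one_le₀ hY1)
    calc (Y⁻¹ * A) ^ n * ∫ x : ℝ, ‖cauchyTransform f (x + Y * Complex.I)‖ ^ 2
        ≤ A ^ n * (A ^ 2 * (Real.pi / Y)) := by gcongr
      _ = _ := by ring
  have hlim : Tendsto (fun Y : ℝ => A ^ n * (A ^ 2 * Real.pi) * Y⁻¹) atTop (𝓝 0) := by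
    simpa using tendsto_inv_atTop_zero.const_mul (A ^ n * (A ^ 2 * Real.pi))
  have := ge_of_tendsto hlim ((eventually_ge_atTop (max y 1)).mono hbound)
  exact norm_le_zero_iff.1 this

/-! ### The theorem of M. Riesz -/

theorem lintegral_conv_rpow_le_of_aemeasurable {k b : ℝ → ENNReal} (hk : AEMeasurable k)
    (hb : AEMeasurable b) {q : ℝ} (hq : 1 ≤ q) :
    ∫⁻ x, (∫⁻ t, k t * b (x - t)) ^ q ≤ (∫⁻ t, k t) ^ q * ∫⁻ x, b x ^ q := by
  have h := lintegral_conv_rpow_le hk hb.measurable_mk hq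
  have h1 : ∀ x : ℝ, ∫⁻ t, k t * b (x - t) = ∫⁻ t, k t * hb.mk b (x - t) := by
    intro x
    refine lintegral_congr_ae ?_
    have := (Measure.measurePreserving_sub_left volume x).quasiMeasurePreserving.ae_eq_comp hb.ae_eq_mk
    filter_upwards [this] with t ht
    simp only [Function.comp_apply] at ht
    rw [ht]
  have h2 : ∫⁻ x, b x ^ q = ∫⁻ x, hb.mk b x ^ q := by
    refine lintegral_congr_ae ?_
    filter_upwards [hb.ae_eq_mk] with x hx
    rw [hx]
  rw [h2]
  simp_rw [h1]
  exact h

/-- The imaginary part of the Cauchy transform of a real function is, up to the factor `-π`, its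
Poisson integral. -/
theorem lintegral_enorm_im_cauchyTransform_le {g : ℝ → ℝ} (hg : Integrable g) {y : ℝ}
    (hy : 0 < y) {q : ℝ} (hq : 1 ≤ q) :
    ∫⁻ x : ℝ, ‖(cauchyTransform (fun t => (g t : ℂ)) (x + y * Complex.I)).im‖ₑ ^ q ≤
      ENNReal.ofReal Real.pi ^ q * ∫⁻ x, ‖g x‖ₑ ^ q := by
  have hk : Measurable fun t : ℝ => ENNReal.ofReal (y / (t ^ 2 + y ^ 2)) := by fun_prop
  have h := lintegral_conv_rpow_le_of_aemeasurable hk.aemeasurable hg.1.enorm hq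
  rw [lintegral_ofReal_poisson hy] at h
  refine le_trans (lintegral_mono fun x => ?_) h
  have hint := integrable_cauchy_integrand hg.ofReal (z := x + y * Complex.I)
    (by simpa using hy)
  have him : (cauchyTransform (fun t => (g t : ℂ)) (x + y * Complex.I)).im =
      ∫ t : ℝ, (((x + y * Complex.I : ℂ) - t)⁻¹ * (g t : ℂ)).im :=
    (Complex.imCLM.integral_comp_comm hint).symm
  rw [him]
  refine ENNReal.rpow_le_rpow ?_ (by linarith)
  refine (enorm_integral_le_lintegral_enorm _).trans (le_of_eq ?_)
  rw [← lintegral_sub_left_eq_self _ x]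
  refine lintegral_congr fun t => ?_
  rw [Complex.im_mul_ofReal, enorm_mul]
  congr 1
  have h1 : (x + y * Complex.I : ℂ) - ((x - t : ℝ) : ℂ) = (t : ℂ) + y * Complex.I := by
    push_cast; ring
  rw [h1, Complex.inv_im, Complex.normSq_add_mul_I, ← ofReal_norm]
  congr 1
  have h2 : ((t : ℂ) + y * Complex.I).im = y := by simp
  rw [h2, Real.norm_eq_abs, neg_div, abs_neg, abs_of_nonneg (by positivity)]

/-- For real `g` the imaginary part of the Cauchy transform is controlled by `g`, the modulus by the
imaginary part since the `n`-th power has mean zero. -/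
theorem lintegral_enorm_cauchyTransform_ofReal_le {g : ℝ → ℝ} (hg : Integrable g) {y : ℝ}
    (hy : 0 < y) {n : ℕ} (hn : Even n) (hn0 : 0 < n) :
    ∫⁻ x : ℝ, ‖cauchyTransform (fun t => (g t : ℂ)) (x + y * Complex.I)‖ₑ ^ (n : ℝ) ≤
      ENNReal.ofReal (12 * n * Real.pi) ^ (n : ℝ) * ∫⁻ x, ‖g x‖ₑ ^ (n : ℝ) := by
  set F : ℝ → ℂ := fun x => cauchyTransform (fun t => (g t : ℂ)) (x + y * Complex.I) with hF
  obtain ⟨m, rfl⟩ : ∃ m, n = m + 2 := ⟨n - 2, by rcases hn with ⟨k, rfl⟩; omega⟩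
  have hcont : Continuous F := continuous_cauchyTransform_line hg.ofReal hy
  have hint : Integrable fun x => F x ^ (m + 2) := integrable_cauchyTransform_pow hg.ofReal hy m
  have hzero : ∫ x, F x ^ (m + 2) = 0 := integral_cauchyTransform_pow_eq_zero hg.ofReal hy m
  have hre : ∫ x, (F x ^ (m + 2)).re = 0 := by
    rw [show (∫ x, (F x ^ (m + 2)).re) = (∫ x, F x ^ (m + 2)).re from
      Complex.reCLM.integral_comp_comm hint, hzero, Complex.zero_re]
  have hn1 : Integrable fun x => ‖F x‖ ^ (m + 2) := by simpa [norm_pow] using hint.norm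
  have hi1 : Integrable fun x => |(F x).im| ^ (m + 2) := by
    refine hn1.mono' ((Complex.continuous_im.comp hcont).abs.pow _).aestronglyMeasurable
      (Eventually.of_forall fun x => ?_)
    rw [Real.norm_eq_abs, abs_of_nonneg (by positivity)]
    gcongr
    exact Complex.abs_im_le_norm _
  have hreal : ∫ x, ‖F x‖ ^ (m + 2) ≤
      3 * (4 * ((m + 2 : ℕ) : ℝ)) ^ (m + 2) * ∫ x, |(F x).im| ^ (m + 2) := by
    have h := integral_mono hn1 ((hi1.const_mul (3 * (4 * ((m + 2 : ℕ) : ℝ)) ^ (m + 2))).add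
      (hint.re.const_mul 2)) (fun x => norm_pow_le_im_add_re hn hn0 (F x))
    refine h.trans (le_of_eq ?_)
    have h2 := integral_add (hi1.const_mul (3 * (4 * ((m + 2 : ℕ) : ℝ)) ^ (m + 2)))
      (hint.re.const_mul 2)
    refine h2.trans ?_
    rw [integral_const_mul, integral_const_mul]
    have : (∫ x, RCLike.re (F x ^ (m + 2))) = 0 := hre
    rw [this, mul_zero, add_zero]
  have hconv : ∀ u : ℝ → ℝ, (∀ x, 0 ≤ u x) → Integrable (fun x => u x ^ (m + 2)) →
      ∫⁻ x, ENNReal.ofReal (u x) ^ ((m + 2 : ℕ) : ℝ) = ENNReal.ofReal (∫ x, u x ^ (m + 2)) := by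
    intro u hu hui
    rw [ofReal_integral_eq_lintegral_ofReal hui (Eventually.of_forall fun x => pow_nonneg (hu x) _)]
    refine lintegral_congr fun x => ?_
    rw [ENNReal.rpow_natCast, ENNReal.ofReal_pow (hu x)]
  have hlhs : ∫⁻ x : ℝ, ‖F x‖ₑ ^ ((m + 2 : ℕ) : ℝ) = ENNReal.ofReal (∫ x, ‖F x‖ ^ (m + 2)) := by
    rw [← hconv _ (fun x => norm_nonneg _) hn1]
    simp_rw [ofReal_norm]
  have him : ∫⁻ x : ℝ, ‖(F x).im‖ₑ ^ ((m + 2 : ℕ) : ℝ) =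
      ENNReal.ofReal (∫ x, |(F x).im| ^ (m + 2)) := by
    rw [← hconv _ (fun x => abs_nonneg _) hi1]
    simp_rw [← Real.norm_eq_abs, ofReal_norm]
  have hP := lintegral_enorm_im_cauchyTransform_le hg hy (q := ((m + 2 : ℕ) : ℝ))
    (by exact_mod_cast hn0)
  calc ∫⁻ x : ℝ, ‖F x‖ₑ ^ ((m + 2 : ℕ) : ℝ)
      = ENNReal.ofReal (∫ x, ‖F x‖ ^ (m + 2)) := hlhs
    _ ≤ ENNReal.ofReal (3 * (4 * ((m + 2 : ℕ) : ℝ)) ^ (m + 2) * ∫ x, |(F x).im| ^ (m + 2)) :=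
        ENNReal.ofReal_le_ofReal hreal
    _ = ENNReal.ofReal (3 * (4 * ((m + 2 : ℕ) : ℝ)) ^ (m + 2)) *
          ∫⁻ x : ℝ, ‖(F x).im‖ₑ ^ ((m + 2 : ℕ) : ℝ) := by
        rw [ENNReal.ofReal_mul (by positivity), him]
    _ ≤ ENNReal.ofReal (3 * (4 * ((m + 2 : ℕ) : ℝ)) ^ (m + 2)) *
          (ENNReal.ofReal Real.pi ^ ((m + 2 : ℕ) : ℝ) * ∫⁻ x, ‖g x‖ₑ ^ ((m + 2 : ℕ) : ℝ)) := by
        gcongr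
    _ ≤ _ := by
        rw [← mul_assoc]
        gcongr
        rw [ENNReal.rpow_natCast, ENNReal.rpow_natCast, ← ENNReal.ofReal_pow Real.pi_pos.le,
          ← ENNReal.ofReal_mul (by positivity), ← ENNReal.ofReal_pow (by positivity)]
        refine ENNReal.ofReal_le_ofReal ?_
        have h3 : (3 : ℝ) ≤ 3 ^ (m + 2) := le_self_pow₀ (by norm_num) (by omega)
        calc 3 * (4 * ((m + 2 : ℕ) : ℝ)) ^ (m + 2) * Real.pi ^ (m + 2)
            ≤ 3 ^ (m + 2) * (4 * ((m + 2 : ℕ) : ℝ)) ^ (m + 2) * Real.pi ^ (m + 2) := by gcongr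
          _ = _ := by rw [← mul_pow, ← mul_pow]; ring

theorem eLpNorm_ofReal_rpow {α E : Type*} [MeasurableSpace α] [NormedAddCommGroup E]
    (μ : Measure α) (f : α → E) {q : ℝ} (hq : 0 < q) :
    eLpNorm f (ENNReal.ofReal q) μ ^ q = ∫⁻ x, ‖f x‖ₑ ^ q ∂μ := by
  rw [eLpNorm_eq_lintegral_rpow_enorm_toReal (by simpa using hq) (by simp),
    ENNReal.toReal_ofReal hq.le, ← ENNReal.rpow_mul, one_div_mul_cancel hq.ne', ENNReal.rpow_one]

theorem eLpNorm_le_of_lintegral_rpow_le {α E F : Type*} [MeasurableSpace α] [NormedAddCommGroup E]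
    [NormedAddCommGroup F] {μ ν : Measure α} {f : α → E} {g : α → F} {q : ℝ} (hq : 0 < q)
    {C : ENNReal} (h : ∫⁻ x, ‖f x‖ₑ ^ q ∂μ ≤ C ^ q * ∫⁻ x, ‖g x‖ₑ ^ q ∂ν) :
    eLpNorm f (ENNReal.ofReal q) μ ≤ C * eLpNorm g (ENNReal.ofReal q) ν := by
  rw [← eLpNorm_ofReal_rpow μ f hq, ← eLpNorm_ofReal_rpow ν g hq,
    ← ENNReal.mul_rpow_of_nonneg _ _ hq.le] at h
  exact (ENNReal.rpow_le_rpow_iff hq).1 h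

/-- The theorem of M. Riesz: Cauchy transforms on horizontal lines are bounded on `L^n`, `n` even,
uniformly in the line. -/
theorem eLpNorm_cauchyTransform_le {f : ℝ → ℂ} (hf : Integrable f) {y : ℝ}
    (hy : 0 < y) {n : ℕ} (hn : Even n) (hn0 : 0 < n) :
    eLpNorm (fun x : ℝ => cauchyTransform f (x + y * Complex.I)) (ENNReal.ofReal n) volume ≤
      ENNReal.ofReal (24 * n * Real.pi) * eLpNorm f (ENNReal.ofReal n) volume := by
  have hn' : (0 : ℝ) < n := by exact_mod_cast hn0
  have hn1 : (1 : ENNReal) ≤ ENNReal.ofReal n := by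
    rw [ENNReal.one_le_ofReal]; exact_mod_cast hn0
  have hre := hf.re
  have him := hf.im
  have h1 := eLpNorm_le_of_lintegral_rpow_le hn'
    (lintegral_enorm_cauchyTransform_ofReal_le hre hy hn hn0)
  have h2 := eLpNorm_le_of_lintegral_rpow_le hn'
    (lintegral_enorm_cauchyTransform_ofReal_le him hy hn hn0)
  have hm1 : eLpNorm (fun x => RCLike.re (f x)) (ENNReal.ofReal n) volume ≤
      eLpNorm f (ENNReal.ofReal n) volume :=
    eLpNorm_mono fun x => RCLike.norm_re_le_norm (f x)
  have hm2 : eLpNorm (fun x => RCLike.im (f x)) (ENNReal.ofReal n) volume ≤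
      eLpNorm f (ENNReal.ofReal n) volume :=
    eLpNorm_mono fun x => RCLike.norm_im_le_norm (f x)
  have hsplit : (fun x : ℝ => cauchyTransform f (x + y * Complex.I)) =
      (fun x : ℝ => cauchyTransform (fun t => ((RCLike.re (f t) : ℝ) : ℂ)) (x + y * Complex.I)) +
      Complex.I • fun x : ℝ =>
        cauchyTransform (fun t => ((RCLike.im (f t) : ℝ) : ℂ)) (x + y * Complex.I) := by
    funext x
    simp only [Pi.add_apply, Pi.smul_apply, smul_eq_mul, cauchyTransform]
    rw [← integral_const_mul, ← integral_add]
    · refine integral_congr_ae (Eventually.of_forall fun t => ?_)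
      have : f t = ((RCLike.re (f t) : ℝ) : ℂ) + ((RCLike.im (f t) : ℝ) : ℂ) * Complex.I :=
        (Complex.re_add_im (f t)).symm
      simp only
      nth_rewrite 1 [this]
      ring
    · exact integrable_cauchy_integrand hre.ofReal (by simpa using hy)
    · exact (integrable_cauchy_integrand him.ofReal (by simpa using hy)).const_mul _
  rw [hsplit]
  refine (eLpNorm_add_le (continuous_cauchyTransform_line hre.ofReal hy).aestronglyMeasurable
    ((continuous_cauchyTransform_line him.ofReal hy).aestronglyMeasurable.const_smul _) hn1).trans ?_
  rw [eLpNorm_const_smul]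
  have hI : ‖Complex.I‖ₑ = 1 := by rw [← ofReal_norm]; simp
  rw [hI, one_mul]
  calc _ ≤ ENNReal.ofReal (12 * n * Real.pi) * eLpNorm f (ENNReal.ofReal n) volume +
        ENNReal.ofReal (12 * n * Real.pi) * eLpNorm f (ENNReal.ofReal n) volume := by
        gcongr
        · exact h1.trans (by gcongr)
        · exact h2.trans (by gcongr)
    _ = _ := by
        rw [← add_mul, ← ENNReal.ofReal_add (by positivity) (by positivity)]
        congr 2
        ring

/-! ### Projections onto frequency bands -/

/-- The kernel `(2π)⁻¹ ∫₀ʳ e^{ixs} ds` of the projection onto the frequencies in `[0, r]`. -/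
def dirichletKernel (r x : ℝ) : ℂ :=
  (2 * Real.pi : ℂ)⁻¹ * ∫ s in (0 : ℝ)..r, Complex.exp (Complex.I * x * s)

/-- The projection onto the functions whose frequencies lie in `[0, r]`, as a convolution. It is used
only for integrable `f`, where the integral converges absolutely. -/
def bandProj (r : ℝ) (f : ℝ → ℂ) (x : ℝ) : ℂ := ∫ t : ℝ, dirichletKernel r (x - t) * f t

theorem continuous_dirichletKernel (r : ℝ) : Continuous (dirichletKernel r) := by
  refine continuous_const.mul ?_
  exact intervalIntegral.continuous_parametric_intervalIntegral_of_continuous' (by fun_prop) 0 r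

theorem norm_two_pi_inv : ‖(2 * Real.pi : ℂ)⁻¹‖ = (2 * Real.pi)⁻¹ := by
  rw [norm_inv, norm_mul, Complex.norm_real, Real.norm_eq_abs, abs_of_pos Real.pi_pos]
  simp

theorem norm_dirichletKernel_le (r x : ℝ) : ‖dirichletKernel r x‖ ≤ (2 * Real.pi)⁻¹ * |r| := by
  rw [dirichletKernel, norm_mul, norm_two_pi_inv]
  gcongr
  have := intervalIntegral.norm_integral_le_of_norm_le_const (a := 0) (b := r) (C := 1)
    (f := fun s : ℝ => Complex.exp (Complex.I * x * s)) fun s _ => (norm_exp_I_mul_mul x s).le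
  simpa using this

theorem dirichletKernel_of_ne_zero (r : ℝ) {x : ℝ} (hx : x ≠ 0) :
    dirichletKernel r x = (2 * Real.pi * Complex.I : ℂ)⁻¹ *
      ((Complex.exp (Complex.I * r * x) - 1) * (x : ℂ)⁻¹) := by
  have hx' : (x : ℂ) ≠ 0 := by exact_mod_cast hx
  rw [dirichletKernel, integral_exp_mul_complex (mul_ne_zero Complex.I_ne_zero hx')]
  have : (Real.pi : ℂ) ≠ 0 := by exact_mod_cast Real.pi_ne_zero
  have hI := Complex.I_ne_zero
  rw [show Complex.I * x * r = Complex.I * r * x by ring]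
  simp
  field_simp
  rw [Complex.I_sq]
  ring

theorem integrable_dirichletKernel_mul (r x : ℝ) {f : ℝ → ℂ} (hf : Integrable f) :
    Integrable fun t : ℝ => dirichletKernel r (x - t) * f t := by
  refine hf.bdd_mul (c := (2 * Real.pi)⁻¹ * |r|) ?_
    (Eventually.of_forall fun t => norm_dirichletKernel_le r _)
  exact ((continuous_dirichletKernel r).comp (continuous_const.sub continuous_id)).aestronglyMeasurable

theorem continuous_bandProj (r : ℝ) {f : ℝ → ℂ} (hf : Integrable f) :
    Continuous (bandProj r f) := by
  refine continuous_of_dominated (bound := fun t => (2 * Real.pi)⁻¹ * |r| * ‖f t‖)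
    (fun x => (integrable_dirichletKernel_mul r x hf).1) (fun x => ?_) (hf.norm.const_mul _) ?_
  · filter_upwards with t
    rw [norm_mul]
    gcongr
    exact norm_dirichletKernel_le r _
  · filter_upwards with t
    exact ((continuous_dirichletKernel r).comp (continuous_id.sub continuous_const)).mul_const _

theorem norm_bandProj_le (r : ℝ) {f : ℝ → ℂ} (hf : Integrable f) (x : ℝ) :
    ‖bandProj r f x‖ ≤ (2 * Real.pi)⁻¹ * |r| * ∫ t, ‖f t‖ := by
  rw [← integral_const_mul]
  refine norm_integral_le_of_norm_le (hf.norm.const_mul _) (Eventually.of_forall fun t => ?_)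
  rw [norm_mul]
  gcongr
  exact norm_dirichletKernel_le r _

/-- A difference of two modulated Cauchy transforms, which approximates `bandProj r f` as the line
approaches the real axis. -/
def bandProjApprox (r y : ℝ) (f : ℝ → ℂ) (x : ℝ) : ℂ :=
  (2 * Real.pi * Complex.I : ℂ)⁻¹ *
    (Complex.exp (Complex.I * r * x) *
      cauchyTransform (fun t => Complex.exp (Complex.I * (-r : ℝ) * t) * f t) (x + y * Complex.I) -
    cauchyTransform f (x + y * Complex.I))

theorem bandProjApprox_eq_integral (r : ℝ) {y : ℝ} (hy : 0 < y) {f : ℝ → ℂ} (hf : Integrable f)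
    (x : ℝ) :
    bandProjApprox r y f x = ∫ t : ℝ, (2 * Real.pi * Complex.I : ℂ)⁻¹ *
      ((Complex.exp (Complex.I * r * (x - t : ℝ)) - 1) *
        (((x - t : ℝ) : ℂ) + y * Complex.I)⁻¹) * f t := by
  have hz : 0 < (x + y * Complex.I : ℂ).im := by simpa using hy
  rw [bandProjApprox, cauchyTransform, cauchyTransform, ← integral_const_mul, ← integral_sub,
    ← integral_const_mul]
  · refine integral_congr_ae (Eventually.of_forall fun t => ?_)
    have h1 : Complex.exp (Complex.I * r * (x - t : ℝ)) =
        Complex.exp (Complex.I * r * x) * Complex.exp (Complex.I * (-r : ℝ) * t) := by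
      rw [← Complex.exp_add]; congr 1; push_cast; ring
    have h2 : ((x - t : ℝ) : ℂ) + y * Complex.I = x + y * Complex.I - t := by push_cast; ring
    simp only [h1, h2]
    ring
  · exact (integrable_cauchy_integrand (integrable_exp_mul hf _) hz).const_mul _
  · exact integrable_cauchy_integrand hf hz

theorem tendsto_bandProjApprox (r : ℝ) {f : ℝ → ℂ} (hf : Integrable f) (x : ℝ)
    {y : ℕ → ℝ} (hy : ∀ n, 0 < y n) (hy0 : Tendsto y atTop (𝓝 0)) :
    Tendsto (fun n => bandProjApprox r (y n) f x) atTop (𝓝 (bandProj r f x)) := by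
  simp_rw [bandProjApprox_eq_integral r (hy _) hf]
  have hne : ∀ᵐ t : ℝ, x - t ≠ 0 := by
    have : ∀ᵐ t : ℝ, t ≠ x := by simp [ae_iff]
    filter_upwards [this] with t ht
    exact sub_ne_zero.2 (Ne.symm ht)
  refine tendsto_integral_of_dominated_convergence (fun t => (2 * Real.pi)⁻¹ * |r| * ‖f t‖)
    (fun n => ?_) (hf.norm.const_mul _) (fun n => ?_) ?_
  · refine AEStronglyMeasurable.mul (Measurable.aestronglyMeasurable ?_) hf.1
    fun_prop
  · filter_upwards [hne] with t ht
    rw [norm_mul]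
    gcongr
    refine le_trans ?_ (norm_dirichletKernel_le r (x - t))
    rw [dirichletKernel_of_ne_zero r ht, norm_mul, norm_mul, norm_mul, norm_mul]
    gcongr
    rw [norm_inv, norm_inv]
    refine inv_anti₀ (norm_pos_iff.2 (Complex.ofReal_ne_zero.2 ht)) ?_
    have h := Complex.abs_re_le_norm (((x - t : ℝ) : ℂ) + y n * Complex.I)
    rw [Complex.norm_real, Real.norm_eq_abs]
    simpa using h
  · filter_upwards [hne] with t ht
    refine Tendsto.mul_const _ ?_
    rw [dirichletKernel_of_ne_zero r ht]
    refine Tendsto.const_mul _ (Tendsto.const_mul _ (Tendsto.inv₀ ?_ (by exact_mod_cast ht)))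
    have h1 : Tendsto (fun n => ((y n : ℝ) : ℂ)) atTop (𝓝 ((0 : ℝ) : ℂ)) :=
      (Complex.continuous_ofReal.tendsto 0).comp hy0
    have h2 := (h1.mul_const Complex.I).const_add (((x - t : ℝ) : ℂ))
    simpa using! h2

/-- `bandProj r` is bounded on `L^n` for even `n`, uniformly in `r`, as a limit of differences of
modulated Cauchy transforms. -/
theorem eLpNorm_bandProj_even_le (r : ℝ) {f : ℝ → ℂ} (hf : Integrable f) {n : ℕ} (hn : Even n)
    (hn0 : 0 < n) :
    eLpNorm (bandProj r f) (ENNReal.ofReal n) volume ≤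
      ENNReal.ofReal (24 * n) * eLpNorm f (ENNReal.ofReal n) volume := by
  have hn1 : (1 : ENNReal) ≤ ENNReal.ofReal n := by
    rw [ENNReal.one_le_ofReal]; exact_mod_cast hn0
  set y : ℕ → ℝ := fun m => 1 / ((m : ℝ) + 1) with hy
  have hypos : ∀ m, 0 < y m := fun m => by positivity
  have hylim : Tendsto y atTop (𝓝 0) := tendsto_one_div_add_atTop_nhds_zero_nat
  set e : ℝ → ℂ := fun t => Complex.exp (Complex.I * (-r : ℝ) * t) * f t with he
  have heint : Integrable e := integrable_exp_mul hf _
  have henorm : eLpNorm e (ENNReal.ofReal n) volume = eLpNorm f (ENNReal.ofReal n) volume :=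
    eLpNorm_congr_norm_ae (Eventually.of_forall fun t => by
      simp only [he]; rw [norm_mul, norm_exp_I_mul_mul, one_mul])
  have hcont1 : ∀ m, Continuous fun x : ℝ => Complex.exp (Complex.I * r * x) *
      cauchyTransform e (x + y m * Complex.I) := fun m =>
    (by fun_prop : Continuous fun x : ℝ => Complex.exp (Complex.I * r * x)).mul
      (continuous_cauchyTransform_line heint (hypos m))
  have hcont2 := fun m => continuous_cauchyTransform_line hf (hypos m)
  have hbound : ∀ m, eLpNorm (bandProjApprox r (y m) f) (ENNReal.ofReal n) volume ≤
      ENNReal.ofReal (24 * n) * eLpNorm f (ENNReal.ofReal n) volume := by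
    intro m
    have h1 : bandProjApprox r (y m) f = (2 * Real.pi * Complex.I : ℂ)⁻¹ •
        ((fun x : ℝ => Complex.exp (Complex.I * r * x) * cauchyTransform e (x + y m * Complex.I)) -
          fun x : ℝ => cauchyTransform f (x + y m * Complex.I)) := rfl
    rw [h1, eLpNorm_const_smul]
    have h2 : ‖(2 * Real.pi * Complex.I : ℂ)⁻¹‖ₑ = ENNReal.ofReal (2 * Real.pi)⁻¹ := by
      rw [← ofReal_norm, mul_inv, norm_mul, norm_two_pi_inv]
      simp
    have h3 : eLpNorm (fun x : ℝ => Complex.exp (Complex.I * r * x) *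
        cauchyTransform e (x + y m * Complex.I)) (ENNReal.ofReal n) volume =
        eLpNorm (fun x : ℝ => cauchyTransform e (x + y m * Complex.I)) (ENNReal.ofReal n) volume :=
      eLpNorm_congr_norm_ae (Eventually.of_forall fun x => by
        rw [norm_mul, norm_exp_I_mul_mul, one_mul])
    have h4 := eLpNorm_sub_le (hcont1 m).aestronglyMeasurable (μ := volume)
      (hcont2 m).aestronglyMeasurable hn1
    rw [h3] at h4
    have h5 := eLpNorm_cauchyTransform_le heint (hypos m) hn hn0
    rw [henorm] at h5
    have h6 := eLpNorm_cauchyTransform_le hf (hypos m) hn hn0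
    rw [h2]
    calc _ ≤ ENNReal.ofReal (2 * Real.pi)⁻¹ *
          (ENNReal.ofReal (24 * n * Real.pi) * eLpNorm f (ENNReal.ofReal n) volume +
          ENNReal.ofReal (24 * n * Real.pi) * eLpNorm f (ENNReal.ofReal n) volume) := by
          gcongr
          exact h4.trans (add_le_add h5 h6)
      _ = _ := by
          rw [← add_mul, ← ENNReal.ofReal_add (by positivity) (by positivity), ← mul_assoc,
            ← ENNReal.ofReal_mul (by positivity)]
          congr 2
          have := Real.pi_ne_zero
          field_simp
          ring
  have hmeas : ∀ m, AEStronglyMeasurable (bandProjApprox r (y m) f) volume := fun m =>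
    (continuous_const.mul ((hcont1 m).sub (hcont2 m))).aestronglyMeasurable
  refine (Lp.eLpNorm_lim_le_liminf_eLpNorm hmeas (bandProj r f) (Eventually.of_forall fun x =>
    tendsto_bandProjApprox r hf x hypos hylim)).trans ?_
  refine (liminf_le_liminf (Eventually.of_forall hbound)).trans ?_
  simp

/-! ### The projection in `L²`, duality and log-convexity -/

theorem integrable_mul_mul_prod {α β : Type*} [MeasurableSpace α] [MeasurableSpace β]
    {μ : Measure α} {ν : Measure β} [SFinite ν] {f : α → ℂ} {g : β → ℂ} {k : α × β → ℂ}
    (hf : Integrable f μ) (hg : Integrable g ν) {c : ℝ}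
    (hk : AEStronglyMeasurable k (μ.prod ν)) (hkc : ∀ p, ‖k p‖ ≤ c) :
    Integrable (fun p : α × β => k p * (f p.1 * g p.2)) (μ.prod ν) :=
  (hf.mul_prod hg).bdd_mul hk (Eventually.of_forall hkc)

/-- `bandProj r` restricts the Fourier transform to `[0, r]`. -/
theorem bandProj_eq_expIntegral {r : ℝ} (hr : 0 ≤ r) {f : ℝ → ℂ} (hf : Integrable f) :
    bandProj r f = expIntegral
      ((Ioc 0 r).indicator fun s => (2 * Real.pi : ℂ)⁻¹ * expIntegral f (-s)) := by
  funext x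
  rw [bandProj, expIntegral]
  have hind : ∀ s : ℝ, Complex.exp (Complex.I * x * s) *
      (Ioc 0 r).indicator (fun s => (2 * Real.pi : ℂ)⁻¹ * expIntegral f (-s)) s =
      (Ioc 0 r).indicator (fun s => Complex.exp (Complex.I * x * s) *
        ((2 * Real.pi : ℂ)⁻¹ * expIntegral f (-s))) s := by
    intro s
    by_cases hs : s ∈ Ioc 0 r <;> simp [hs]
  simp_rw [hind]
  rw [integral_indicator measurableSet_Ioc]
  have hL : ∀ t : ℝ, dirichletKernel r (x - t) * f t =
      ∫ s in Ioc 0 r, (2 * Real.pi : ℂ)⁻¹ *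
        (Complex.exp (Complex.I * (x - t : ℝ) * s) * (f t * 1)) := by
    intro t
    rw [dirichletKernel, intervalIntegral.integral_of_le hr, integral_const_mul,
      integral_mul_const, mul_assoc, mul_one]
  have hR : ∀ s : ℝ, Complex.exp (Complex.I * x * s) * ((2 * Real.pi : ℂ)⁻¹ * expIntegral f (-s)) =
      ∫ t, (2 * Real.pi : ℂ)⁻¹ * (Complex.exp (Complex.I * (x - t : ℝ) * s) * (f t * 1)) := by
    intro s
    rw [integral_const_mul, expIntegral, mul_left_comm, ← integral_const_mul]
    congr 1
    refine integral_congr_ae (Eventually.of_forall fun t => ?_)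
    simp only
    rw [← mul_assoc, ← Complex.exp_add, mul_one]
    congr 2
    push_cast
    ring
  simp_rw [hL, hR]
  refine integral_integral_swap (μ := volume) (ν := volume.restrict (Ioc 0 r))
    (f := fun t s => (2 * Real.pi : ℂ)⁻¹ *
        (Complex.exp (Complex.I * (x - t : ℝ) * s) * (f t * 1))) ?_
  refine Integrable.const_mul ?_ _
  refine integrable_mul_mul_prod (ν := volume.restrict (Ioc 0 r)) (k := fun p : ℝ × ℝ =>
    Complex.exp (Complex.I * (x - p.1 : ℝ) * p.2)) (g := fun _ => 1) (c := 1) hf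
    (integrable_const _) ?_ (fun p => (norm_exp_I_mul_mul _ _).le)
  exact (by fun_prop : Continuous fun p : ℝ × ℝ =>
    Complex.exp (Complex.I * (x - p.1 : ℝ) * p.2)).aestronglyMeasurable

theorem lintegral_enorm_expIntegral_neg_sq {f : ℝ → ℂ} (hf : Integrable f) (hf2 : MemLp f 2) :
    ∫⁻ s : ℝ, ‖(2 * Real.pi : ℂ)⁻¹ * expIntegral f (-s)‖ₑ ^ (2 : ℝ) =
      ENNReal.ofReal (2 * Real.pi)⁻¹ * ∫⁻ x, ‖f x‖ₑ ^ (2 : ℝ) := by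
  have h1 : ‖(2 * Real.pi : ℂ)⁻¹‖ₑ = ENNReal.ofReal (2 * Real.pi)⁻¹ := by
    rw [← ofReal_norm, norm_two_pi_inv]
  have hm : Measurable fun s : ℝ => ‖expIntegral f s‖ₑ ^ (2 : ℝ) :=
    (continuous_expIntegral hf).measurable.enorm.pow_const _
  simp_rw [enorm_mul, h1, ENNReal.mul_rpow_of_nonneg _ _ (show (0 : ℝ) ≤ 2 by norm_num)]
  have hm' : Measurable fun s : ℝ => ‖expIntegral f (-s)‖ₑ ^ (2 : ℝ) := hm.comp measurable_neg
  rw [lintegral_const_mul _ hm',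
    lintegral_neg_eq_self (fun s => ‖expIntegral f s‖ₑ ^ (2 : ℝ)),
    lintegral_enorm_expIntegral_sq hf hf2, ← mul_assoc]
  congr 1
  rw [ENNReal.rpow_two, ← ENNReal.ofReal_pow (by positivity), ← ENNReal.ofReal_mul (by positivity)]
  congr 1
  have := Real.pi_ne_zero
  field_simp

/-- `bandProj r` is a contraction of `L²`. -/
theorem eLpNorm_two_bandProj_le {r : ℝ} (hr : 0 ≤ r) {f : ℝ → ℂ} (hf : Integrable f) :
    eLpNorm (bandProj r f) 2 volume ≤ eLpNorm f 2 volume := by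
  by_cases htop : eLpNorm f 2 volume = ⊤
  · rw [htop]; exact le_top
  have hf2 : MemLp f 2 := ⟨hf.1, lt_top_iff_ne_top.2 htop⟩
  set u : ℝ → ℂ := fun s => (2 * Real.pi : ℂ)⁻¹ * expIntegral f (-s) with hu
  have hucont : Continuous u :=
    continuous_const.mul ((continuous_expIntegral hf).comp continuous_neg)
  have hu2 : MemLp u 2 := by
    refine ⟨hucont.aestronglyMeasurable, ?_⟩
    have h : eLpNorm u 2 volume ^ (2 : ℝ) < ⊤ := by
      rw [eLpNorm_two_eq_lintegral, lintegral_enorm_expIntegral_neg_sq hf hf2,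
        ← eLpNorm_two_eq_lintegral]
      exact ENNReal.mul_lt_top ENNReal.ofReal_lt_top
        (ENNReal.rpow_lt_top_of_nonneg (by norm_num) htop)
    exact (ENNReal.rpow_lt_top_iff_of_pos (by norm_num)).1 h
  have hui : Integrable ((Ioc 0 r).indicator u) := by
    rw [integrable_indicator_iff measurableSet_Ioc]
    exact (hucont.integrableOn_Icc (a := 0) (b := r)).mono_set Ioc_subset_Icc_self
  refine eLpNorm_two_le_of_lintegral ?_
  rw [bandProj_eq_expIntegral hr hf, lintegral_enorm_expIntegral_sq hui
    (hu2.indicator measurableSet_Ioc)]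
  calc _ ≤ ENNReal.ofReal (2 * Real.pi) * ∫⁻ x, ‖u x‖ₑ ^ (2 : ℝ) := by
        gcongr with x
        exact enorm_indicator_le_enorm_self _ _
    _ = _ := by
        rw [lintegral_enorm_expIntegral_neg_sq hf hf2, ← mul_assoc,
          ← ENNReal.ofReal_mul (by positivity), mul_inv_cancel₀ (by positivity)]
        simp

theorem dirichletKernel_neg (r x : ℝ) :
    dirichletKernel r (-x) = (starRingEnd ℂ) (dirichletKernel r x) := by
  rw [dirichletKernel, dirichletKernel, map_mul, intervalIntegral, intervalIntegral, map_sub,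
    ← integral_conj, ← integral_conj]
  have h : ∀ s : ℝ, Complex.exp (Complex.I * (-x : ℝ) * s) =
      (starRingEnd ℂ) (Complex.exp (Complex.I * x * s)) := by
    intro s
    rw [← Complex.exp_conj]
    simp
  simp_rw [h]
  congr 1
  rw [map_inv₀, map_mul, Complex.conj_ofReal, Complex.conj_ofNat]

/-- The transpose of `bandProj r` is its complex conjugate. -/
theorem integral_bandProj_mul (r : ℝ) {f g : ℝ → ℂ} (hf : Integrable f) (hg : Integrable g) :
    ∫ x, bandProj r f x * g x =
      ∫ t, f t * (starRingEnd ℂ) (bandProj r (fun x => (starRingEnd ℂ) (g x)) t) := by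
  have hL : ∀ x, bandProj r f x * g x = ∫ t, dirichletKernel r (x - t) * (g x * f t) := by
    intro x
    rw [bandProj, ← integral_mul_const]
    refine integral_congr_ae (Eventually.of_forall fun t => ?_)
    simp only
    ring
  have hR : ∀ t, f t * (starRingEnd ℂ) (bandProj r (fun x => (starRingEnd ℂ) (g x)) t) =
      ∫ x, dirichletKernel r (x - t) * (g x * f t) := by
    intro t
    rw [bandProj, ← integral_conj, ← integral_const_mul]
    refine integral_congr_ae (Eventually.of_forall fun x => ?_)
    simp only [map_mul, Complex.conj_conj]
    rw [← dirichletKernel_neg, neg_sub]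
    ring
  simp_rw [hL, hR]
  refine integral_integral_swap (f := fun x t => dirichletKernel r (x - t) * (g x * f t)) ?_
  refine integrable_mul_mul_prod (k := fun p : ℝ × ℝ => dirichletKernel r (p.1 - p.2))
    (c := (2 * Real.pi)⁻¹ * |r|) hg hf ?_ (fun p => norm_dirichletKernel_le r _)
  exact ((continuous_dirichletKernel r).comp (continuous_fst.sub continuous_snd)).aestronglyMeasurable

/-- Boundedness on `L^q` passes to the conjugate exponent. -/
theorem eLpNorm_bandProj_le_of_dual (r : ℝ) {q a : ℝ} (hqa : q.HolderConjugate a) {C : ENNReal}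
    (hC : ∀ g : ℝ → ℂ, Integrable g →
      eLpNorm (bandProj r g) (ENNReal.ofReal q) volume ≤ C * eLpNorm g (ENNReal.ofReal q) volume)
    {f : ℝ → ℂ} (hf : Integrable f) :
    eLpNorm (bandProj r f) (ENNReal.ofReal a) volume ≤
      C * eLpNorm f (ENNReal.ofReal a) volume := by
  have hq0 : 0 < q := hqa.pos
  have ha0 : 0 < a := hqa.symm.pos
  have ha1 : 1 < a := hqa.symm.lt
  set h : ℝ → ℂ := bandProj r f with hh
  have hcont : Continuous h := continuous_bandProj r hf
  set M : ℝ := (2 * Real.pi)⁻¹ * |r| * ∫ t, ‖f t‖ with hM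
  have hM0 : 0 ≤ M := by
    have : 0 ≤ ∫ t, ‖f t‖ := integral_nonneg fun _ => norm_nonneg _
    positivity
  have hbound : ∀ x, ‖h x‖ ≤ M := norm_bandProj_le r hf
  -- the truncated norms are bounded, by testing against `‖h‖^(a-2) conj h` on `[-R, R]`
  have key : ∀ R : ℝ, eLpNorm ((Icc (-R) R).indicator h) (ENNReal.ofReal a) volume ≤
      C * eLpNorm f (ENNReal.ofReal a) volume := by
    intro R
    set S : Set ℝ := Icc (-R) R with hS
    have hSm : MeasurableSet S := measurableSet_Icc
    set g : ℝ → ℂ := S.indicator fun x => ((‖h x‖ ^ (a - 2) : ℝ) : ℂ) * (starRingEnd ℂ) (h x) with hg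
    have hgm : Measurable g := by
      refine Measurable.indicator ?_ hSm
      have h1 : Measurable h := hcont.measurable
      have h2 : Measurable fun x => ((‖h x‖ ^ (a - 2) : ℝ) : ℂ) :=
        Complex.measurable_ofReal.comp (h1.norm.pow_const _)
      exact h2.mul (Complex.continuous_conj.measurable.comp h1)
    have hgn : ∀ x ∈ S, ‖g x‖ = ‖h x‖ ^ (a - 1) := by
      intro x hx
      rw [hg, indicator_of_mem hx, norm_mul, Complex.norm_real, RCLike.norm_conj,
        Real.norm_of_nonneg (by positivity)]
      rcases eq_or_ne (h x) 0 with h0 | h0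
      · rw [h0, norm_zero, mul_zero, Real.zero_rpow (by linarith)]
      · rw [← Real.rpow_add_one (norm_ne_zero_iff.2 h0)]
        congr 1
        ring
    have hg0 : ∀ x ∉ S, g x = 0 := fun x hx => indicator_of_notMem hx _
    have hgi : Integrable g := by
      have hdom : Integrable (S.indicator fun _ => M ^ (a - 1)) := by
        rw [integrable_indicator_iff hSm]
        exact (continuous_const.integrableOn_Icc)
      refine hdom.mono' hgm.aestronglyMeasurable (Eventually.of_forall fun x => ?_)
      by_cases hx : x ∈ S
      · rw [hgn x hx, indicator_of_mem hx]
        exact Real.rpow_le_rpow (norm_nonneg _) (hbound x) (by linarith)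
      · rw [hg0 x hx, indicator_of_notMem hx, norm_zero]
    set J : ENNReal := ∫⁻ x, ‖S.indicator h x‖ₑ ^ a with hJ
    have hJn : eLpNorm (S.indicator h) (ENNReal.ofReal a) volume ^ a = J :=
      eLpNorm_ofReal_rpow _ _ ha0
    have hgq : eLpNorm g (ENNReal.ofReal q) volume ^ q = J := by
      rw [eLpNorm_ofReal_rpow _ _ hq0]
      refine lintegral_congr fun x => ?_
      by_cases hx : x ∈ S
      · rw [indicator_of_mem hx, ← ofReal_norm (g x), hgn x hx, ← ofReal_norm (h x),
          ← ENNReal.ofReal_rpow_of_nonneg (norm_nonneg _) (by linarith), ← ENNReal.rpow_mul,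
          hqa.symm.sub_one_mul_conj]
      · rw [hg0 x hx, indicator_of_notMem hx, enorm_zero, ENNReal.zero_rpow_of_pos hq0,
          ENNReal.zero_rpow_of_pos ha0]
    have hpair : ∀ x, h x * g x = ((‖S.indicator h x‖ ^ a : ℝ) : ℂ) := by
      intro x
      by_cases hx : x ∈ S
      · rw [hg, indicator_of_mem hx, indicator_of_mem hx, mul_left_comm, Complex.mul_conj,
          Complex.normSq_eq_norm_sq, ← Complex.ofReal_mul]
        congr 1
        rcases eq_or_ne (h x) 0 with h0 | h0
        · rw [h0, norm_zero, Real.zero_rpow ha0.ne']; simp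
        · rw [← Real.rpow_natCast, ← Real.rpow_add (norm_pos_iff.2 h0)]
          congr 1
          push_cast
          ring
      · rw [hg0 x hx, indicator_of_notMem hx, norm_zero, Real.zero_rpow ha0.ne']
        simp
    have hhgi : Integrable fun x => h x * g x :=
      hgi.bdd_mul hcont.aestronglyMeasurable (Eventually.of_forall hbound)
    have hri : Integrable fun x => ‖S.indicator h x‖ ^ a := by
      have := hhgi.re
      refine this.congr (Eventually.of_forall fun x => ?_)
      simp only [hpair]
      exact Complex.ofReal_re _
    have hJi : J = ‖∫ x, h x * g x‖ₑ := by
      simp_rw [hpair]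
      rw [integral_complex_ofReal, ← ofReal_norm, Complex.norm_real,
        Real.norm_of_nonneg (integral_nonneg fun x => by positivity),
        ofReal_integral_eq_lintegral_ofReal hri (Eventually.of_forall fun x => by positivity)]
      refine lintegral_congr fun x => ?_
      rw [← ofReal_norm, ENNReal.ofReal_rpow_of_nonneg (norm_nonneg _) ha0.le]
    have hJtop : J ≠ ⊤ := by rw [hJi]; exact enorm_ne_top
    have hgci : Integrable fun x => (starRingEnd ℂ) (g x) :=
      hgi.mono (Complex.continuous_conj.comp_aestronglyMeasurable hgi.1)
        (Eventually.of_forall fun x => by simp)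
    have hgcn : eLpNorm (fun x => (starRingEnd ℂ) (g x)) (ENNReal.ofReal q) volume =
        eLpNorm g (ENNReal.ofReal q) volume :=
      eLpNorm_congr_norm_ae (Eventually.of_forall fun x => by simp)
    have hJle : J ≤ C * eLpNorm f (ENNReal.ofReal a) volume * J ^ (1 / q) := by
      have h2 : eLpNorm g (ENNReal.ofReal q) volume = J ^ (1 / q) := by
        rw [← hgq, ← ENNReal.rpow_mul, mul_one_div_cancel hq0.ne', ENNReal.rpow_one]
      have h3 := hC _ hgci
      rw [hgcn, h2] at h3
      have hfe : eLpNorm f (ENNReal.ofReal a) volume = (∫⁻ x, ‖f x‖ₑ ^ a) ^ (1 / a) := by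
        rw [← eLpNorm_ofReal_rpow volume f ha0, ← ENNReal.rpow_mul, mul_one_div_cancel ha0.ne',
          ENNReal.rpow_one]
      have hge : eLpNorm (bandProj r fun x => (starRingEnd ℂ) (g x)) (ENNReal.ofReal q) volume =
          (∫⁻ x, ‖bandProj r (fun x => (starRingEnd ℂ) (g x)) x‖ₑ ^ q) ^ (1 / q) := by
        rw [← eLpNorm_ofReal_rpow volume _ hq0, ← ENNReal.rpow_mul, mul_one_div_cancel hq0.ne',
          ENNReal.rpow_one]
      calc J = ‖∫ t, f t * (starRingEnd ℂ) (bandProj r (fun x => (starRingEnd ℂ) (g x)) t)‖ₑ := by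
            rw [hJi, integral_bandProj_mul r hf hgi]
        _ ≤ ∫⁻ t, ‖f t‖ₑ * ‖bandProj r (fun x => (starRingEnd ℂ) (g x)) t‖ₑ := by
            refine (enorm_integral_le_lintegral_enorm _).trans (le_of_eq ?_)
            refine lintegral_congr fun t => ?_
            rw [enorm_mul, ← ofReal_norm ((starRingEnd ℂ) _), RCLike.norm_conj, ofReal_norm]
        _ ≤ (∫⁻ x, ‖f x‖ₑ ^ a) ^ (1 / a) *
            (∫⁻ x, ‖bandProj r (fun x => (starRingEnd ℂ) (g x)) x‖ₑ ^ q) ^ (1 / q) :=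
            ENNReal.lintegral_mul_le_Lp_mul_Lq volume hqa.symm hf.1.enorm
              (continuous_bandProj r hgci).measurable.enorm.aemeasurable
        _ = eLpNorm f (ENNReal.ofReal a) volume *
            eLpNorm (bandProj r fun x => (starRingEnd ℂ) (g x)) (ENNReal.ofReal q) volume := by
            rw [hfe, hge]
        _ ≤ eLpNorm f (ENNReal.ofReal a) volume * (C * J ^ (1 / q)) := by gcongr
        _ = _ := by ring
    have hlast : J ^ (1 / a) ≤ C * eLpNorm f (ENNReal.ofReal a) volume := by
      rcases eq_or_ne J 0 with h0 | h0
      · rw [h0, ENNReal.zero_rpow_of_pos (by positivity)]; exact zero_le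
      · have h1 : J ^ (1 / a) * J ^ (1 / q) = J := by
          rw [← ENNReal.rpow_add _ _ h0 hJtop, one_div, one_div, hqa.symm.inv_add_inv_eq_one,
            ENNReal.rpow_one]
        have h2 : J ^ (1 / q) ≠ 0 := by
          rw [Ne, ENNReal.rpow_eq_zero_iff]
          push Not
          exact ⟨fun h => absurd h h0, fun h => absurd h hJtop⟩
        have h3 : J ^ (1 / q) ≠ ⊤ := ENNReal.rpow_ne_top_of_nonneg (by positivity) hJtop
        refine (ENNReal.mul_le_mul_iff_left h2 h3).1 ?_
        rw [h1]
        exact hJle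
    rw [← hJn, ← ENNReal.rpow_mul, mul_one_div_cancel ha0.ne', ENNReal.rpow_one] at hlast
    exact hlast
  have hmeas : ∀ n : ℕ, AEStronglyMeasurable ((Icc (-(n : ℝ)) n).indicator h) volume := fun n =>
    hcont.aestronglyMeasurable.indicator measurableSet_Icc
  refine (Lp.eLpNorm_lim_le_liminf_eLpNorm hmeas h (Eventually.of_forall fun x => ?_)).trans ?_
  · obtain ⟨N, hN⟩ := exists_nat_ge |x|
    refine tendsto_const_nhds.congr' ?_
    filter_upwards [eventually_ge_atTop N] with n hn
    have : x ∈ Icc (-(n : ℝ)) n := by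
      rw [mem_Icc, ← abs_le]
      exact hN.trans (by exact_mod_cast hn)
    rw [indicator_of_mem this]
  · refine (liminf_le_liminf (Eventually.of_forall fun n : ℕ => key n)).trans ?_
    simp

/-- Log-convexity of the `L^p` norms of a fixed function. -/
theorem eLpNorm_le_rpow_mul_rpow {f : ℝ → ℂ} (hf : AEStronglyMeasurable f volume) {p p₀ p₁ θ : ℝ}
    (hp : 0 < p) (hp₀ : 0 < p₀) (hp₁ : 0 < p₁) (hθ0 : 0 ≤ θ) (hθ1 : θ ≤ 1)
    (h : 1 / p = (1 - θ) / p₀ + θ / p₁) :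
    eLpNorm f (ENNReal.ofReal p) volume ≤
      eLpNorm f (ENNReal.ofReal p₀) volume ^ (1 - θ) * eLpNorm f (ENNReal.ofReal p₁) volume ^ θ := by
  have hθ' : 0 ≤ 1 - θ := sub_nonneg.2 hθ1
  have hsum : (1 - θ) * p / p₀ + θ * p / p₁ = 1 := by
    have : (1 - θ) * p / p₀ + θ * p / p₁ = p * ((1 - θ) / p₀ + θ / p₁) := by ring
    rw [this, ← h, mul_one_div_cancel hp.ne']
  have h1 := ENNReal.lintegral_mul_norm_pow_le (μ := volume) (f := fun x => ‖f x‖ₑ ^ p₀)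
    (g := fun x => ‖f x‖ₑ ^ p₁) (hf.enorm.pow_const _) (hf.enorm.pow_const _)
    (p := (1 - θ) * p / p₀) (q := θ * p / p₁) (by positivity) (by positivity) hsum
  have h2 : ∀ x, (‖f x‖ₑ ^ p₀) ^ ((1 - θ) * p / p₀) * (‖f x‖ₑ ^ p₁) ^ (θ * p / p₁) =
      ‖f x‖ₑ ^ p := by
    intro x
    rw [← ENNReal.rpow_mul, ← ENNReal.rpow_mul, mul_div_cancel₀ _ hp₀.ne',
      mul_div_cancel₀ _ hp₁.ne', ← ENNReal.rpow_add_of_nonneg _ _ (by positivity) (by positivity)]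
    congr 1
    ring
  simp_rw [h2] at h1
  rw [← eLpNorm_ofReal_rpow volume f hp, ← eLpNorm_ofReal_rpow volume f hp₀,
    ← eLpNorm_ofReal_rpow volume f hp₁, ← ENNReal.rpow_mul, ← ENNReal.rpow_mul,
    mul_div_cancel₀ _ hp₀.ne', mul_div_cancel₀ _ hp₁.ne', ENNReal.rpow_mul, ENNReal.rpow_mul,
    ← ENNReal.mul_rpow_of_nonneg _ _ hp.le] at h1
  exact (ENNReal.rpow_le_rpow_iff hp).1 h1

/-! ### The accelerant -/

/-- The complex density of `dσ - dλ / 2π`. -/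
def spectralDensity (w : ℝ → ℝ) (ξ : ℝ) : ℂ := (((w ξ - 1) / (2 * Real.pi) : ℝ) : ℂ)

/-- The Fourier transform of `dσ - dλ / 2π`, which is the accelerant of `σ`. -/
def accelerant (w : ℝ → ℝ) (x : ℝ) : ℂ := expIntegral (spectralDensity w) x

theorem integrable_spectralDensity {w : ℝ → ℝ} (hw : Integrable fun ξ => w ξ - 1) :
    Integrable (spectralDensity w) := (hw.div_const _).ofReal

theorem continuous_accelerant {w : ℝ → ℝ} (hw : Integrable fun ξ => w ξ - 1) :
    Continuous (accelerant w) := continuous_expIntegral (integrable_spectralDensity hw)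

theorem accelerant_neg (w : ℝ → ℝ) (x : ℝ) :
    accelerant w (-x) = (starRingEnd ℂ) (accelerant w x) := by
  rw [accelerant, accelerant, expIntegral, expIntegral, ← integral_conj]
  refine integral_congr_ae (Eventually.of_forall fun ξ => ?_)
  simp only [spectralDensity, map_mul, Complex.conj_ofReal, ← Complex.exp_conj, Complex.conj_I]
  congr 2
  push_cast
  ring

theorem integral_sub_mul_exp (x : ℝ) {ξ : ℝ} (hξ : ξ ≠ 0) :
    ∫ s in (0 : ℝ)..x, ((x - s : ℝ) : ℂ) * Complex.exp (Complex.I * s * ξ) =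
      (1 + Complex.I * ξ * x - Complex.exp (Complex.I * ξ * x)) / (ξ : ℂ) ^ 2 := by
  have hξ' : (ξ : ℂ) ≠ 0 := by exact_mod_cast hξ
  have hI := Complex.I_ne_zero
  have hderiv : ∀ s ∈ uIcc 0 x, HasDerivAt (fun s : ℝ => ((x - s : ℝ) : ℂ) *
      Complex.exp (Complex.I * s * ξ) / (Complex.I * ξ) +
      Complex.exp (Complex.I * s * ξ) / (Complex.I * ξ) ^ 2)
      (((x - s : ℝ) : ℂ) * Complex.exp (Complex.I * s * ξ)) s := by
    intro s _
    have h1 : HasDerivAt (fun s : ℝ => Complex.exp (Complex.I * s * ξ))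
        (Complex.exp (Complex.I * s * ξ) * (Complex.I * ξ)) s := by
      have h0 : HasDerivAt (fun s : ℝ => Complex.I * (s : ℂ) * ξ) (Complex.I * ξ) s := by
        simpa using (((hasDerivAt_id s).ofReal_comp).const_mul Complex.I).mul_const (ξ : ℂ)
      exact h0.cexp
    have h2 : HasDerivAt (fun s : ℝ => ((x - s : ℝ) : ℂ)) (-1) s := by
      simpa using! ((hasDerivAt_id s).const_sub x).ofReal_comp
    have h3 := ((h2.mul h1).div_const (Complex.I * ξ)).add (h1.div_const ((Complex.I * ξ) ^ 2))
    refine h3.congr_deriv ?_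
    field_simp
    ring
  rw [intervalIntegral.integral_eq_sub_of_hasDerivAt hderiv
    (Continuous.intervalIntegrable (by fun_prop) _ _)]
  rw [show Complex.I * x * ξ = Complex.I * ξ * x by ring]
  simp only [sub_self, Complex.ofReal_zero, zero_mul, sub_zero, mul_zero, Complex.exp_zero]
  rw [mul_pow, Complex.I_sq]
  field_simp
  linear_combination (-(x : ℂ) * ξ) * Complex.I_sq

theorem isAccelerant_accelerant {w : ℝ → ℝ} (hw : Integrable fun ξ => w ξ - 1) :
    IsAccelerant w (accelerant w) where
  hermitian := accelerant_neg w
  locally_sq_integrable a b := by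
    have hc := continuous_accelerant hw
    obtain ⟨C, hC⟩ := isCompact_Icc.exists_bound_of_continuousOn (s := Icc a b) hc.continuousOn
    refine MemLp.of_bound hc.aestronglyMeasurable C ?_
    exact (ae_restrict_mem measurableSet_Icc).mono hC
  equation := by
    have hv := integrable_spectralDensity hw
    refine ⟨∫ ξ : ℝ, ξ / (1 + ξ ^ 2) * ((w ξ - 1) / (2 * Real.pi)), fun x => ?_⟩
    have hne : ∀ᵐ ξ : ℝ, ξ ≠ 0 := by simp [ae_iff]
    -- Fubini
    have hprod : Integrable (Function.uncurry fun (s ξ : ℝ) =>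
        ((x - s : ℝ) : ℂ) * Complex.exp (Complex.I * s * ξ) * spectralDensity w ξ)
        ((volume.restrict (uIoc 0 x)).prod volume) := by
      have hi : Integrable (fun s : ℝ => ((x - s : ℝ) : ℂ)) (volume.restrict (uIoc 0 x)) :=
        ((by fun_prop : Continuous fun s : ℝ => ((x - s : ℝ) : ℂ)).continuousOn.integrableOn_compact
          isCompact_uIcc).mono_set uIoc_subset_uIcc
      refine (integrable_mul_mul_prod (k := fun p : ℝ × ℝ => Complex.exp (Complex.I * p.1 * p.2))
        (c := 1) hi hv ?_ (fun p => (norm_exp_I_mul_mul _ _).le)).congr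
        (Eventually.of_forall fun p => ?_)
      · exact continuous_exp_I_mul_mul.aestronglyMeasurable
      · simp only [Function.uncurry]
        ring
    have hswap : ∫ s in (0 : ℝ)..x, ((x - s : ℝ) : ℂ) * accelerant w s =
        ∫ ξ : ℝ, ((1 + Complex.I * ξ * x - Complex.exp (Complex.I * ξ * x)) / (ξ : ℂ) ^ 2) *
          spectralDensity w ξ := by
      have h1 := intervalIntegral_integral_swap (a := 0) (b := x) hprod
      have h2 : ∀ s : ℝ, ((x - s : ℝ) : ℂ) * accelerant w s =
          ∫ ξ : ℝ, ((x - s : ℝ) : ℂ) * Complex.exp (Complex.I * s * ξ) * spectralDensity w ξ := by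
        intro s
        rw [accelerant, expIntegral, ← integral_const_mul]
        refine integral_congr_ae (Eventually.of_forall fun ξ => ?_)
        simp only
        ring
      simp_rw [h2]
      rw [h1]
      refine integral_congr_ae ?_
      filter_upwards [hne] with ξ hξ
      rw [intervalIntegral.integral_mul_const, integral_sub_mul_exp x hξ]
    have hint1 : Integrable fun ξ : ℝ =>
        ((1 + Complex.I * ξ * x - Complex.exp (Complex.I * ξ * x)) / (ξ : ℂ) ^ 2) *
          spectralDensity w ξ := by
      have h := hprod.integral_prod_right
      -- the interval integral over `0..x` is the set integral with the sign of `x`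
      have h' := h.smul (if 0 ≤ x then (1 : ℝ) else -1)
      refine h'.congr ?_
      filter_upwards [hne] with ξ hξ
      rw [← integral_sub_mul_exp x hξ, ← intervalIntegral.integral_mul_const,
        intervalIntegral.intervalIntegral_eq_integral_uIoc]
      rfl
    have hb : ∀ ξ : ℝ, |ξ / (1 + ξ ^ 2)| ≤ 1 := by
      intro ξ
      rw [abs_div, abs_of_pos (show 0 < 1 + ξ ^ 2 by positivity), div_le_one (by positivity)]
      nlinarith [sq_nonneg (|ξ| - 1), sq_abs ξ]
    have hint2 : Integrable fun ξ : ℝ => ξ / (1 + ξ ^ 2) * ((w ξ - 1) / (2 * Real.pi)) := by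
      refine (hw.div_const _).bdd_mul (c := 1) ?_ (Eventually.of_forall hb)
      exact (by fun_prop : Measurable fun ξ : ℝ => ξ / (1 + ξ ^ 2)).aestronglyMeasurable
    have hint3 : Integrable fun ξ : ℝ =>
        ((ξ / (1 + ξ ^ 2) * ((w ξ - 1) / (2 * Real.pi)) : ℝ) : ℂ) := hint2.ofReal
    have hsub := integral_sub hint1 (hint3.const_mul (Complex.I * x))
    rw [hswap, ← integral_complex_ofReal, mul_right_comm, ← integral_const_mul]
    rw [eq_comm, add_comm, ← eq_sub_iff_add_eq]
    refine Eq.trans ?_ hsub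
    refine integral_congr_ae ?_
    filter_upwards [hne] with ξ hξ
    have hξ' : (ξ : ℂ) ≠ 0 := by exact_mod_cast hξ
    have h1 : (1 + (ξ : ℂ) ^ 2) ≠ 0 := by
      have : (0 : ℝ) < 1 + ξ ^ 2 := by positivity
      exact_mod_cast this.ne'
    have hpi : (Real.pi : ℂ) ≠ 0 := by exact_mod_cast Real.pi_ne_zero
    simp only [spectralDensity]
    push_cast
    field_simp
    ring

theorem intervalIntegrable_of_locallyIntegrable {f : ℝ → ℂ} (hf : LocallyIntegrable f) (a b : ℝ) :
    IntervalIntegrable f volume a b :=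
  intervalIntegrable_iff.2 ((hf.integrableOn_isCompact isCompact_uIcc).mono_set uIoc_subset_uIcc)

theorem IsAccelerant.locallyIntegrable {w : ℝ → ℝ} {H : ℝ → ℂ} (hH : IsAccelerant w H) :
    LocallyIntegrable H := by
  rw [locallyIntegrable_iff]
  intro K hK
  obtain ⟨R, hR⟩ := hK.isBounded.subset_closedBall 0
  rw [Real.closedBall_eq_Icc] at hR
  exact IntegrableOn.mono_set ((hH.locally_sq_integrable (0 - R) (0 + R)).integrable (by norm_num)) hR

/-- The accelerant is unique up to null sets: the second primitive of a difference `H₁ - H₂` is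
linear. -/
theorem IsAccelerant.ae_eq {w : ℝ → ℝ} {H₁ H₂ : ℝ → ℂ} (h₁ : IsAccelerant w H₁)
    (h₂ : IsAccelerant w H₂) : H₁ =ᵐ[volume] H₂ := by
  obtain ⟨β₁, hβ₁⟩ := h₁.equation
  obtain ⟨β₂, hβ₂⟩ := h₂.equation
  set D : ℝ → ℂ := fun s => H₁ s - H₂ s with hD
  have hDl : LocallyIntegrable D := h₁.locallyIntegrable.sub h₂.locallyIntegrable
  have hDi : ∀ a b : ℝ, IntervalIntegrable D volume a b :=
    intervalIntegrable_of_locallyIntegrable hDl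
  have hmul : ∀ {F : ℝ → ℂ}, LocallyIntegrable F → ∀ x a b : ℝ,
      IntervalIntegrable (fun s => ((x - s : ℝ) : ℂ) * F s) volume a b := fun hF x a b =>
    (intervalIntegrable_of_locallyIntegrable hF a b).continuousOn_mul
      (by fun_prop : Continuous fun s : ℝ => ((x - s : ℝ) : ℂ)).continuousOn
  set c : ℂ := Complex.I * ((β₁ - β₂ : ℝ) : ℂ) with hc
  have hA : ∀ x : ℝ, ∫ s in (0 : ℝ)..x, ((x - s : ℝ) : ℂ) * D s = c * x := by
    intro x
    have : ∀ s : ℝ, ((x - s : ℝ) : ℂ) * D s =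
        ((x - s : ℝ) : ℂ) * H₁ s - ((x - s : ℝ) : ℂ) * H₂ s := fun s => mul_sub _ _ _
    simp_rw [this]
    rw [intervalIntegral.integral_sub (hmul h₁.locallyIntegrable x 0 x)
      (hmul h₂.locallyIntegrable x 0 x), hβ₁, hβ₂, hc]
    push_cast
    ring
  -- the primitive of `D` is constant: take difference quotients of `hA`
  have hΦ : ∀ x : ℝ, ∫ s in (0 : ℝ)..x, D s = c := by
    intro x
    have hN : Continuous fun y : ℝ => ∫ s in (0 : ℝ)..y, ‖D s‖ :=
      intervalIntegral.continuous_primitive (fun a b => (hDi a b).norm) 0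
    have hbound : ∀ h : ℝ, 0 < h → ‖c - ∫ s in (0 : ℝ)..x, D s‖ ≤
        (∫ s in (0 : ℝ)..(x + h), ‖D s‖) - ∫ s in (0 : ℝ)..x, ‖D s‖ := by
      intro h hh
      have e1 : (c - ∫ s in (0 : ℝ)..x, D s) * h =
          ∫ s in x..(x + h), ((x + h - s : ℝ) : ℂ) * D s := by
        have e2 := intervalIntegral.integral_add_adjacent_intervals
          (hmul hDl (x + h) 0 x) (hmul hDl (x + h) x (x + h))
        have e3 : ∫ s in (0 : ℝ)..x, ((x + h - s : ℝ) : ℂ) * D s =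
            c * x + h * ∫ s in (0 : ℝ)..x, D s := by
          have : ∀ s : ℝ, ((x + h - s : ℝ) : ℂ) * D s =
              ((x - s : ℝ) : ℂ) * D s + h * D s := fun s => by push_cast; ring
          simp_rw [this]
          rw [intervalIntegral.integral_add (hmul hDl x 0 x) ((hDi 0 x).const_mul _), hA,
            intervalIntegral.integral_const_mul]
        rw [hA, e3] at e2
        push_cast at e2 ⊢
        linear_combination -e2
      have e4 : ‖∫ s in x..(x + h), ((x + h - s : ℝ) : ℂ) * D s‖ ≤
          h * ∫ s in x..(x + h), ‖D s‖ := by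
        rw [← intervalIntegral.integral_const_mul]
        refine intervalIntegral.norm_integral_le_of_norm_le (by linarith)
          (Eventually.of_forall fun s hs => ?_) ((hDi x (x + h)).norm.const_mul h)
        rw [norm_mul, Complex.norm_real, Real.norm_eq_abs, abs_of_nonneg (by linarith [hs.2])]
        gcongr
        linarith [hs.1]
      rw [intervalIntegral.integral_interval_sub_left (hDi 0 (x + h)).norm (hDi 0 x).norm]
      rw [← e1, norm_mul, Complex.norm_real, Real.norm_of_nonneg hh.le, mul_comm h] at e4
      exact le_of_mul_le_mul_right e4 hh
    have hlim : Tendsto (fun h : ℝ => (∫ s in (0 : ℝ)..(x + h), ‖D s‖) - ∫ s in (0 : ℝ)..x, ‖D s‖)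
        (𝓝[>] 0) (𝓝 0) := by
      have h1 : Continuous fun h : ℝ =>
          (∫ s in (0 : ℝ)..(x + h), ‖D s‖) - ∫ s in (0 : ℝ)..x, ‖D s‖ :=
        (hN.comp (continuous_const.add continuous_id)).sub continuous_const
      have h2 := (h1.tendsto 0).mono_left (nhdsWithin_le_nhds (s := Ioi 0))
      simpa using h2
    have := ge_of_tendsto hlim (eventually_mem_nhdsWithin.mono hbound)
    exact (sub_eq_zero.1 (norm_le_zero_iff.1 this)).symm
  filter_upwards [LocallyIntegrable.ae_hasDerivAt_integral hDl] with x hx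
  have h := hx 0
  simp_rw [hΦ] at h
  exact sub_eq_zero.1 (h.unique (hasDerivAt_const x c))

/-! ### The equation of the resolvent kernel -/

theorem intervalIntegral_sub_mul_congr {H H₀ f f₀ : ℝ → ℂ} {r : ℝ} (hr : 0 ≤ r)
    (hH : H =ᵐ[volume] H₀) (hf : f =ᵐ[volume.restrict (Icc 0 r)] f₀) (x : ℝ) :
    ∫ y in (0 : ℝ)..r, H (x - y) * f y = ∫ y in (0 : ℝ)..r, H₀ (x - y) * f₀ y := by
  rw [intervalIntegral.integral_of_le hr, intervalIntegral.integral_of_le hr,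
    ← integral_Icc_eq_integral_Ioc, ← integral_Icc_eq_integral_Ioc]
  refine integral_congr_ae ?_
  have h1 := (Measure.measurePreserving_sub_left volume x).quasiMeasurePreserving.ae_eq_comp hH
  filter_upwards [hf, ae_restrict_of_ae h1] with y hy hy1
  simp only [Function.comp_apply] at hy1
  rw [hy, hy1]

theorem IsResolventKernel.congr {H H₀ : ℝ → ℂ} {r : ℝ} (hr : 0 ≤ r) {G : ℝ → ℝ → ℂ}
    (hK : IsResolventKernel H r G) (hH : H =ᵐ[volume] H₀) : IsResolventKernel H₀ r G := by
  have h : onePlusConv H r = onePlusConv H₀ r := by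
    funext f x
    rw [onePlusConv, onePlusConv, intervalIntegral_sub_mul_congr hr hH (ae_eq_refl f)]
  exact ⟨hK.continuousOn, h ▸ hK.right_inverse, h ▸ hK.left_inverse⟩

theorem integrableOn_uIoc_prod_of_continuous {F : ℝ × ℝ → ℂ} (hF : Continuous F) (a b c d : ℝ) :
    IntegrableOn F (uIoc a b ×ˢ uIoc c d) :=
  (hF.continuousOn.integrableOn_compact (isCompact_uIcc.prod isCompact_uIcc)).mono_set
    (prod_mono uIoc_subset_uIcc uIoc_subset_uIcc)

theorem memLp_two_of_continuous {f : ℝ → ℂ} (hf : Continuous f) (a b : ℝ) :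
    MemLp f 2 (volume.restrict (Icc a b)) := by
  obtain ⟨C, hC⟩ := isCompact_Icc.exists_bound_of_continuousOn (s := Icc a b) hf.continuousOn
  exact MemLp.of_bound hf.aestronglyMeasurable C ((ae_restrict_mem measurableSet_Icc).mono hC)

/-- A continuous kernel on a square that annihilates all continuous functions vanishes there. -/
theorem eqOn_zero_of_forall_integral_mul_eq_zero {N : ℝ × ℝ → ℂ} (hN : Continuous N) {r : ℝ}
    (hr : 0 < r)
    (h : ∀ f : ℝ → ℂ, Continuous f →
      (fun s => ∫ t in (0 : ℝ)..r, N (s, t) * f t) =ᵐ[volume.restrict (Icc 0 r)] fun _ => 0)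
    {s t : ℝ} (hs : s ∈ Icc 0 r) (ht : t ∈ Icc 0 r) : N (s, t) = 0 := by
  set f : ℝ → ℂ := fun t => (starRingEnd ℂ) (N (s, t)) with hf
  have hfc : Continuous f := Complex.continuous_conj.comp (hN.comp (by fun_prop))
  have hcont : Continuous fun s => ∫ t in (0 : ℝ)..r, N (s, t) * f t :=
    intervalIntegral.continuous_parametric_intervalIntegral_of_continuous'
      (hN.mul (hfc.comp continuous_snd)) 0 r
  have h1 := Measure.eqOn_Icc_of_ae_eq volume hr.ne (h f hfc) hcont.continuousOn
    continuousOn_const hs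
  simp only [hf, Complex.mul_conj, Complex.normSq_eq_norm_sq] at h1
  rw [intervalIntegral.integral_ofReal, Complex.ofReal_eq_zero] at h1
  have hc2 : Continuous fun t => ‖N (s, t)‖ ^ 2 := by fun_prop
  have h2 := (intervalIntegral.integral_eq_zero_iff_of_le_of_nonneg_ae hr.le
    (Eventually.of_forall fun t => by simp only [Pi.zero_apply]; positivity)
    (hc2.intervalIntegrable 0 r)).1 h1
  rw [Measure.restrict_congr_set Ioc_ae_eq_Icc] at h2
  have h3 := Measure.eqOn_Icc_of_ae_eq volume hr.ne h2 hc2.continuousOn continuousOn_const ht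
  simpa using h3

/-- The resolvent equation `Γ + Γ ℋ = ℋ`, pointwise on the square. It is the left inverse property
tested against continuous functions. -/
theorem IsResolventKernel.eq_sub_integral {H : ℝ → ℂ} (hH : Continuous H) {r : ℝ} (hr : 0 < r)
    {G : ℝ → ℝ → ℂ} (hK : IsResolventKernel H r G) {s t : ℝ} (hs : s ∈ Icc 0 r)
    (ht : t ∈ Icc 0 r) : G s t = H (s - t) - ∫ u in (0 : ℝ)..r, G s u * H (u - t) := by
  -- a continuous extension of the kernel to the plane
  set π : ℝ → ℝ := fun x => (projIcc 0 r hr.le x : ℝ) with hπ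
  have hπc : Continuous π := continuous_subtype_val.comp continuous_projIcc
  have hπm : ∀ x, π x ∈ Icc 0 r := fun x => (projIcc 0 r hr.le x).2
  have hπe : ∀ x ∈ Icc 0 r, π x = x := fun x hx => by simp only [hπ, projIcc_of_mem hr.le hx]
  set G' : ℝ × ℝ → ℂ := fun p => G (π p.1) (π p.2) with hG'
  have hG'c : Continuous G' := hK.continuousOn.comp_continuous
    (f := fun p : ℝ × ℝ => (π p.1, π p.2)) (by fun_prop) (fun p => ⟨hπm _, hπm _⟩)
  have hGG : ∀ x ∈ Icc 0 r, ∀ y ∈ Icc 0 r, G x y = G' (x, y) := fun x hx y hy => by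
    simp only [hG', hπe x hx, hπe y hy]
  have hGint : ∀ x ∈ Icc 0 r, ∀ F : ℝ → ℂ,
      ∫ u in (0 : ℝ)..r, G x u * F u = ∫ u in (0 : ℝ)..r, G' (x, u) * F u := by
    intro x hx F
    refine intervalIntegral.integral_congr fun u hu => ?_
    rw [uIcc_of_le hr.le] at hu
    simp only [hGG x hx u hu]
  set N : ℝ × ℝ → ℂ := fun p =>
    H (p.1 - p.2) - G' p - ∫ u in (0 : ℝ)..r, G' (p.1, u) * H (u - p.2) with hN
  have hNc : Continuous N := by
    refine ((hH.comp (continuous_fst.sub continuous_snd)).sub hG'c).sub ?_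
    refine intervalIntegral.continuous_parametric_intervalIntegral_of_continuous' ?_ 0 r
    exact (hG'c.comp (by fun_prop : Continuous fun q : (ℝ × ℝ) × ℝ => (q.1.1, q.2))).mul
      (hH.comp (by fun_prop : Continuous fun q : (ℝ × ℝ) × ℝ => q.2 - q.1.2))
  have hzero := eqOn_zero_of_forall_integral_mul_eq_zero hNc hr (fun f hf => ?_) hs ht
  · rw [hGint s hs, hGG s hs t ht]
    simp only [hN] at hzero
    linear_combination -hzero
  · filter_upwards [hK.left_inverse f (memLp_two_of_continuous hf 0 r),
      ae_restrict_mem measurableSet_Icc] with x hx hxr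
    have hHf : Continuous fun u => ∫ y in (0 : ℝ)..r, H (u - y) * f y :=
      intervalIntegral.continuous_parametric_intervalIntegral_of_continuous' (by fun_prop) 0 r
    have hGx : Continuous fun u => G' (x, u) := hG'c.comp (by fun_prop)
    simp only [oneMinusKernel, onePlusConv] at hx
    rw [hGint x hxr] at hx
    have e1 : ∫ u in (0 : ℝ)..r, G' (x, u) * (f u + ∫ y in (0 : ℝ)..r, H (u - y) * f y) =
        (∫ u in (0 : ℝ)..r, G' (x, u) * f u) +
          ∫ u in (0 : ℝ)..r, G' (x, u) * ∫ y in (0 : ℝ)..r, H (u - y) * f y := by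
      simp_rw [mul_add]
      exact intervalIntegral.integral_add ((hGx.mul hf).intervalIntegrable _ _)
        ((hGx.mul hHf).intervalIntegrable _ _)
    have e2 : ∫ u in (0 : ℝ)..r, G' (x, u) * ∫ y in (0 : ℝ)..r, H (u - y) * f y =
        ∫ y in (0 : ℝ)..r, (∫ u in (0 : ℝ)..r, G' (x, u) * H (u - y)) * f y := by
      simp_rw [← intervalIntegral.integral_const_mul, ← intervalIntegral.integral_mul_const]
      rw [intervalIntegral_intervalIntegral_swap]
      · refine intervalIntegral.integral_congr fun y _ =>
          intervalIntegral.integral_congr fun u _ => ?_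
        ring
      · refine integrableOn_uIoc_prod_of_continuous ?_ _ _ _ _
        simp only [Function.uncurry_def]
        exact (hGx.comp continuous_fst).mul (by fun_prop)
    have e3 : ∫ y in (0 : ℝ)..r, N (x, y) * f y =
        (∫ y in (0 : ℝ)..r, H (x - y) * f y) - (∫ y in (0 : ℝ)..r, G' (x, y) * f y) -
          ∫ y in (0 : ℝ)..r, (∫ u in (0 : ℝ)..r, G' (x, u) * H (u - y)) * f y := by
      have hI : Continuous fun y => ∫ u in (0 : ℝ)..r, G' (x, u) * H (u - y) := by
        refine intervalIntegral.continuous_parametric_intervalIntegral_of_continuous' ?_ 0 r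
        exact (hGx.comp continuous_snd).mul (by fun_prop)
      have h1 : IntervalIntegrable (fun y => H (x - y) * f y) volume 0 r :=
        Continuous.intervalIntegrable (by fun_prop) _ _
      have h2 : IntervalIntegrable (fun y => G' (x, y) * f y) volume 0 r :=
        (hGx.mul hf).intervalIntegrable _ _
      have h3 : IntervalIntegrable (fun y => (∫ u in (0 : ℝ)..r, G' (x, u) * H (u - y)) * f y)
          volume 0 r := (hI.mul hf).intervalIntegrable _ _
      simp only [hN, sub_mul]
      rw [intervalIntegral.integral_sub (h1.sub h2) h3, intervalIntegral.integral_sub h1 h2]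
    rw [e3, ← e2]
    rw [e1] at hx
    linear_combination hx

/-! ### Existence of the resolvent kernel -/

theorem enorm_le_ofReal_of_norm_le {E : Type*} [NormedAddCommGroup E] {x : E} {c : ℝ}
    (h : ‖x‖ ≤ c) : ‖x‖ₑ ≤ ENNReal.ofReal c := by
  rw [← ofReal_norm]; exact ENNReal.ofReal_le_ofReal h

theorem norm_two_pi_mul_spectralDensity (w : ℝ → ℝ) (ξ : ℝ) :
    ‖(2 * Real.pi : ℂ) * spectralDensity w ξ‖ = |w ξ - 1| := by
  have hpi : (Real.pi : ℂ) ≠ 0 := by exact_mod_cast Real.pi_ne_zero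
  have : (2 * Real.pi : ℂ) * spectralDensity w ξ = ((w ξ - 1 : ℝ) : ℂ) := by
    rw [spectralDensity]; push_cast; field_simp
  rw [this, Complex.norm_real, Real.norm_eq_abs]

/-- Convolution with the accelerant is the Fourier multiplier `w - 1`. -/
theorem integral_accelerant_mul_eq {w : ℝ → ℝ} (hw : Integrable fun ξ => w ξ - 1) {F : ℝ → ℂ}
    (hF : Integrable F) (x : ℝ) :
    ∫ y, accelerant w (x - y) * F y = expIntegral (fun ξ =>
      ((2 * Real.pi : ℂ) * spectralDensity w ξ) * ((2 * Real.pi : ℂ)⁻¹ * expIntegral F (-ξ))) x := by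
  have hpi : (Real.pi : ℂ) ≠ 0 := by exact_mod_cast Real.pi_ne_zero
  have hL : ∀ y, accelerant w (x - y) * F y =
      ∫ ξ : ℝ, Complex.exp (Complex.I * (x - y : ℝ) * ξ) * (F y * spectralDensity w ξ) := by
    intro y
    rw [accelerant, expIntegral, ← integral_mul_const]
    refine integral_congr_ae (Eventually.of_forall fun ξ => ?_)
    simp only
    ring
  have hR : ∀ ξ : ℝ, Complex.exp (Complex.I * x * ξ) * (((2 * Real.pi : ℂ) * spectralDensity w ξ) *
      ((2 * Real.pi : ℂ)⁻¹ * expIntegral F (-ξ))) =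
      ∫ y, Complex.exp (Complex.I * (x - y : ℝ) * ξ) * (F y * spectralDensity w ξ) := by
    intro ξ
    have : Complex.exp (Complex.I * x * ξ) * (((2 * Real.pi : ℂ) * spectralDensity w ξ) *
      ((2 * Real.pi : ℂ)⁻¹ * expIntegral F (-ξ))) =
      (Complex.exp (Complex.I * x * ξ) * spectralDensity w ξ) * expIntegral F (-ξ) := by
      field_simp
    rw [this, expIntegral, ← integral_const_mul]
    refine integral_congr_ae (Eventually.of_forall fun y => ?_)
    have h2 : Complex.exp (Complex.I * (x - y : ℝ) * ξ) =
        Complex.exp (Complex.I * x * ξ) * Complex.exp (Complex.I * (-ξ : ℝ) * y) := by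
      rw [← Complex.exp_add]; congr 1; push_cast; ring
    simp only [h2]
    ring
  rw [expIntegral]
  simp_rw [hL, hR]
  refine integral_integral_swap (f := fun (y ξ : ℝ) =>
    Complex.exp (Complex.I * (x - y : ℝ) * ξ) * (F y * spectralDensity w ξ)) ?_
  refine integrable_mul_mul_prod (k := fun p : ℝ × ℝ =>
    Complex.exp (Complex.I * (x - p.1 : ℝ) * p.2)) (c := 1) hF (integrable_spectralDensity hw) ?_
    (fun p => (norm_exp_I_mul_mul _ _).le)
  exact (by fun_prop : Continuous fun p : ℝ × ℝ =>
    Complex.exp (Complex.I * (x - p.1 : ℝ) * p.2)).aestronglyMeasurable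

theorem eLpNorm_integral_accelerant_mul_le {w : ℝ → ℝ} (hw : Integrable fun ξ => w ξ - 1) {δ : ℝ}
    (hδ : ∀ᵐ ξ, |w ξ - 1| ≤ δ) {F : ℝ → ℂ} (hF : Integrable F) (hF2 : MemLp F 2) :
    eLpNorm (fun x => ∫ y, accelerant w (x - y) * F y) 2 volume ≤
      ENNReal.ofReal δ * eLpNorm F 2 volume := by
  set u : ℝ → ℂ := fun ξ => (2 * Real.pi : ℂ)⁻¹ * expIntegral F (-ξ) with hu
  set v : ℝ → ℂ := fun ξ => (2 * Real.pi : ℂ) * spectralDensity w ξ with hv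
  have hvi : Integrable v := (integrable_spectralDensity hw).const_mul _
  have huc : Continuous u := continuous_const.mul ((continuous_expIntegral hF).comp continuous_neg)
  have huv : Integrable fun ξ => v ξ * u ξ := by
    refine hvi.mul_bdd (c := (2 * Real.pi)⁻¹ * ∫ t, ‖F t‖) huc.aestronglyMeasurable
      (Eventually.of_forall fun ξ => ?_)
    rw [hu, norm_mul, norm_two_pi_inv]
    gcongr
    exact norm_expIntegral_le F _
  have hle : ∫⁻ ξ, ‖v ξ * u ξ‖ₑ ^ (2 : ℝ) ≤
      ENNReal.ofReal δ ^ (2 : ℝ) * (ENNReal.ofReal (2 * Real.pi)⁻¹ * ∫⁻ x, ‖F x‖ₑ ^ (2 : ℝ)) := by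
    rw [← lintegral_enorm_expIntegral_neg_sq hF hF2,
      ← lintegral_const_mul _ (huc.measurable.enorm.pow_const _)]
    refine lintegral_mono_ae ?_
    filter_upwards [hδ] with ξ hξ
    rw [enorm_mul, ENNReal.mul_rpow_of_nonneg _ _ (by norm_num)]
    gcongr
    exact enorm_le_ofReal_of_norm_le (by rw [hv, norm_two_pi_mul_spectralDensity]; exact hξ)
  have huv2 : MemLp (fun ξ => v ξ * u ξ) 2 := by
    refine ⟨huv.1, ?_⟩
    rw [← eLpNorm_two_eq_lintegral, ← eLpNorm_two_eq_lintegral] at hle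
    refine (ENNReal.rpow_lt_top_iff_of_pos (show (0 : ℝ) < 2 by norm_num)).1 (hle.trans_lt ?_)
    refine ENNReal.mul_lt_top ?_ (ENNReal.mul_lt_top ENNReal.ofReal_lt_top ?_)
    · exact ENNReal.rpow_lt_top_of_nonneg (by norm_num) ENNReal.ofReal_ne_top
    · exact ENNReal.rpow_lt_top_of_nonneg (by norm_num) hF2.2.ne
  have hconv : (fun x => ∫ y, accelerant w (x - y) * F y) = expIntegral fun ξ => v ξ * u ξ :=
    funext fun x => integral_accelerant_mul_eq hw hF x
  rw [hconv]
  have h2 : ENNReal.ofReal 2 = 2 := by simp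
  rw [← h2]
  refine eLpNorm_le_of_lintegral_rpow_le (by norm_num) ?_
  rw [lintegral_enorm_expIntegral_sq huv huv2]
  calc _ ≤ ENNReal.ofReal (2 * Real.pi) * (ENNReal.ofReal δ ^ (2 : ℝ) *
        (ENNReal.ofReal (2 * Real.pi)⁻¹ * ∫⁻ x, ‖F x‖ₑ ^ (2 : ℝ))) := by gcongr
    _ = (ENNReal.ofReal (2 * Real.pi) * ENNReal.ofReal (2 * Real.pi)⁻¹) *
        (ENNReal.ofReal δ ^ (2 : ℝ) * ∫⁻ x, ‖F x‖ₑ ^ (2 : ℝ)) := by ring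
    _ = _ := by
        rw [← ENNReal.ofReal_mul (by positivity), mul_inv_cancel₀ (by positivity),
          ENNReal.ofReal_one, one_mul]

theorem eLpNorm_truncated_conv_le {w : ℝ → ℝ} (hw : Integrable fun ξ => w ξ - 1) {δ : ℝ}
    (hδ : ∀ᵐ ξ, |w ξ - 1| ≤ δ) {r : ℝ} (hr : 0 ≤ r) {f : ℝ → ℂ}
    (hf : MemLp f 2 (volume.restrict (Icc 0 r))) :
    eLpNorm (fun x => ∫ y in (0 : ℝ)..r, accelerant w (x - y) * f y) 2 (volume.restrict (Icc 0 r)) ≤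
      ENNReal.ofReal δ * eLpNorm f 2 (volume.restrict (Icc 0 r)) := by
  have hF2 : MemLp ((Icc 0 r).indicator f) 2 := (memLp_indicator_iff_restrict measurableSet_Icc).2 hf
  have hF : Integrable ((Icc 0 r).indicator f) :=
    (integrable_indicator_iff measurableSet_Icc).2 (hf.integrable (by norm_num))
  have heq : (fun x => ∫ y in (0 : ℝ)..r, accelerant w (x - y) * f y) =
      fun x => ∫ y, accelerant w (x - y) * (Icc 0 r).indicator f y := by
    funext x
    rw [intervalIntegral.integral_of_le hr, ← integral_Icc_eq_integral_Ioc,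
      ← integral_indicator measurableSet_Icc]
    refine integral_congr_ae (Eventually.of_forall fun y => ?_)
    by_cases hy : y ∈ Icc 0 r <;> simp [hy]
  rw [heq, ← eLpNorm_indicator_eq_eLpNorm_restrict measurableSet_Icc (f := f)]
  exact (eLpNorm_mono_measure _ Measure.restrict_le_self).trans
    (eLpNorm_integral_accelerant_mul_le hw hδ hF hF2)

theorem norm_accelerant_le (w : ℝ → ℝ) (x : ℝ) :
    ‖accelerant w x‖ ≤ ∫ ξ, ‖spectralDensity w ξ‖ := norm_expIntegral_le _ _

theorem integrable_sub_mul {μ : Measure ℝ} {H f : ℝ → ℂ} {B : ℝ} (hH : Continuous H)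
    (hB : ∀ x, ‖H x‖ ≤ B) (hf : Integrable f μ) (x : ℝ) :
    Integrable (fun y => H (x - y) * f y) μ :=
  hf.bdd_mul (by fun_prop : Continuous fun y => H (x - y)).aestronglyMeasurable
    (Eventually.of_forall fun _ => hB _)

theorem integrable_Icc_iff_intervalIntegrable {f : ℝ → ℂ} {r : ℝ} (hr : 0 ≤ r) :
    Integrable f (volume.restrict (Icc 0 r)) ↔ IntervalIntegrable f volume 0 r := by
  rw [intervalIntegrable_iff_integrableOn_Icc_of_le hr, IntegrableOn]

/-- The operator `ℋ_r` on `L²([0, r])`, for the accelerant of `w`, has norm at most `‖w - 1‖_∞`. -/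
theorem exists_convolution_operator {w : ℝ → ℝ} (hw : Integrable fun ξ => w ξ - 1) {δ : ℝ}
    (hδ0 : 0 ≤ δ) (hδ : ∀ᵐ ξ, |w ξ - 1| ≤ δ) {r : ℝ} (hr : 0 ≤ r) :
    ∃ T : Lp ℂ 2 (volume.restrict (Icc 0 r)) →L[ℂ] Lp ℂ 2 (volume.restrict (Icc 0 r)),
      ‖T‖ ≤ δ ∧ ∀ f : Lp ℂ 2 (volume.restrict (Icc 0 r)),
        T f =ᵐ[volume.restrict (Icc 0 r)]
          fun x => ∫ y in (0 : ℝ)..r, accelerant w (x - y) * f y := by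
  set μ : Measure ℝ := volume.restrict (Icc 0 r) with hμ
  have hH := continuous_accelerant hw
  have hB := norm_accelerant_le w
  have hI : ∀ f : Lp ℂ 2 μ, Integrable f μ := fun f => (Lp.memLp f).integrable (by norm_num)
  have hII : ∀ (f : Lp ℂ 2 μ) (x : ℝ),
      IntervalIntegrable (fun y => accelerant w (x - y) * f y) volume 0 r := fun f x =>
    (integrable_Icc_iff_intervalIntegrable hr).1 (integrable_sub_mul hH hB (hI f) x)
  have hcont : ∀ f : Lp ℂ 2 μ,
      Continuous fun x => ∫ y in (0 : ℝ)..r, accelerant w (x - y) * f y := by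
    intro f
    simp_rw [intervalIntegral.integral_of_le hr, ← integral_Icc_eq_integral_Ioc]
    refine continuous_of_dominated
      (bound := fun y => (∫ ξ, ‖spectralDensity w ξ‖) * ‖f y‖)
      (fun x => (integrable_sub_mul hH hB (hI f) x).1) (fun x => ?_) ((hI f).norm.const_mul _) ?_
    · filter_upwards with y
      rw [norm_mul]
      gcongr
      exact hB _
    · filter_upwards with y
      exact (hH.comp (continuous_id.sub continuous_const)).mul_const _
  have hmem : ∀ f : Lp ℂ 2 μ,
      MemLp (fun x => ∫ y in (0 : ℝ)..r, accelerant w (x - y) * f y) 2 μ := fun f =>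
    memLp_two_of_continuous (hcont f) 0 r
  let T₀ : Lp ℂ 2 μ →ₗ[ℂ] Lp ℂ 2 μ :=
    { toFun := fun f => (hmem f).toLp _
      map_add' := by
        intro f g
        rw [← MemLp.toLp_add]
        refine MemLp.toLp_congr _ _ (Eventually.of_forall fun x => ?_)
        simp only [Pi.add_apply]
        rw [← intervalIntegral.integral_add (hII f x) (hII g x),
          intervalIntegral_sub_mul_congr hr (ae_eq_refl _) (Lp.coeFn_add f g)]
        simp only [Pi.add_apply, mul_add]
      map_smul' := by
        intro c f
        simp only [RingHom.id_apply]
        rw [← MemLp.toLp_const_smul]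
        refine MemLp.toLp_congr _ _ (Eventually.of_forall fun x => ?_)
        simp only [Pi.smul_apply, smul_eq_mul]
        rw [← intervalIntegral.integral_const_mul,
          intervalIntegral_sub_mul_congr hr (ae_eq_refl _) (Lp.coeFn_smul c f)]
        simp only [Pi.smul_apply, smul_eq_mul, mul_left_comm] }
  have hbound : ∀ f, ‖T₀ f‖ ≤ δ * ‖f‖ := by
    intro f
    have h := eLpNorm_truncated_conv_le hw hδ hr (Lp.memLp f)
    change ‖(hmem f).toLp _‖ ≤ δ * ‖f‖
    rw [Lp.norm_toLp, Lp.norm_def]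
    refine (ENNReal.toReal_mono (ENNReal.mul_ne_top ENNReal.ofReal_ne_top
      (Lp.eLpNorm_ne_top f)) h).trans (le_of_eq ?_)
    rw [ENNReal.toReal_mul, ENNReal.toReal_ofReal hδ0]
  exact ⟨T₀.mkContinuous δ hbound, T₀.mkContinuous_norm_le hδ0 _, fun f => (hmem f).coeFn_toLp⟩

open scoped FourierTransform in
/-- The accelerant tends to zero at infinity by the Riemann-Lebesgue lemma. -/
theorem uniformContinuous_accelerant {w : ℝ → ℝ} (hw : Integrable fun ξ => w ξ - 1) :
    UniformContinuous (accelerant w) := by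
  refine (continuous_accelerant hw).uniformContinuous_of_tendsto_cocompact (x := 0) ?_
  have h := Real.zero_at_infty_fourier (spectralDensity w)
  have ha : (-(2 * Real.pi)⁻¹ : ℝ) ≠ 0 := by simp [Real.pi_ne_zero]
  have h2 := h.comp (Homeomorph.mulLeft₀ _ ha).isClosedEmbedding.tendsto_cocompact
  refine h2.congr fun x => ?_
  rw [accelerant, expIntegral_eq_fourier]
  rfl

/-- Translates of a uniformly continuous function depend continuously on the shift in `L²([0, r])`.
Both `k t u = u - t` and `k t u = t - u` occur. -/
theorem continuous_toLp_of_uniformContinuous {H : ℝ → ℂ} (hH : UniformContinuous H)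
    {k : ℝ → ℝ → ℝ} (hk : ∀ t, Continuous (k t))
    (hkd : ∀ t t' u, dist (k t u) (k t' u) = dist t t') (r : ℝ) :
    Continuous fun t : ℝ =>
      (memLp_two_of_continuous (hH.continuous.comp (hk t)) 0 r).toLp (H ∘ k t) := by
  rw [Metric.continuous_iff]
  intro t₀ ε hε
  set m : ℝ := measureUnivNNReal (volume.restrict (Icc 0 r)) ^ (ENNReal.toReal 2)⁻¹ with hm
  have hm0 : 0 ≤ m := by positivity
  obtain ⟨η, hη, hH'⟩ := Metric.uniformContinuous_iff.1 hH (ε / (m + 1)) (by positivity)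
  refine ⟨η, hη, fun t ht => ?_⟩
  rw [dist_eq_norm, ← MemLp.toLp_sub]
  refine (Lp.norm_le_of_ae_bound (C := ε / (m + 1)) (by positivity) ?_).trans_lt ?_
  · have hc := MemLp.coeFn_toLp ((memLp_two_of_continuous (hH.continuous.comp (hk t)) 0 r).sub
      (memLp_two_of_continuous (hH.continuous.comp (hk t₀)) 0 r))
    filter_upwards [hc] with u hu
    rw [hu, Pi.sub_apply, ← dist_eq_norm]
    exact (hH' (by rw [hkd]; exact ht)).le
  · rw [mul_div_assoc', div_lt_iff₀ (by positivity)]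
    change m * ε < ε * (m + 1)
    nlinarith

theorem intervalIntegral_kernel_mul_congr {G : ℝ → ℝ → ℂ} {f f₀ : ℝ → ℂ} {r : ℝ} (hr : 0 ≤ r)
    (hf : f =ᵐ[volume.restrict (Icc 0 r)] f₀) (x : ℝ) :
    ∫ y in (0 : ℝ)..r, G x y * f y = ∫ y in (0 : ℝ)..r, G x y * f₀ y := by
  rw [intervalIntegral.integral_of_le hr, intervalIntegral.integral_of_le hr,
    ← integral_Icc_eq_integral_Ioc, ← integral_Icc_eq_integral_Ioc]
  refine integral_congr_ae ?_
  filter_upwards [hf] with y hy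
  rw [hy]

theorem integral_sub_mul_mul_swap {μ : Measure ℝ} [SFinite μ] {H a f : ℝ → ℂ} {B : ℝ}
    (hH : Continuous H) (hB : ∀ x, ‖H x‖ ≤ B) (ha : Integrable a μ) (hf : Integrable f μ) :
    ∫ u, ∫ y, H (u - y) * (a u * f y) ∂μ ∂μ = ∫ y, ∫ u, H (u - y) * (a u * f y) ∂μ ∂μ := by
  refine integral_integral_swap (f := fun u y => H (u - y) * (a u * f y)) ?_
  exact integrable_mul_mul_prod (k := fun p : ℝ × ℝ => H (p.1 - p.2)) ha hf
    (hH.comp (by fun_prop)).aestronglyMeasurable (fun p => hB _)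

/-- If `A = I - ℋ_r + ℋ_r A ℋ_r` then `I - A` has a continuous kernel, namely
`H(s - t) - ⟪conj H(s - ·), A H(· - t)⟫`. -/
theorem exists_kernel_of_eq {H : ℝ → ℂ} (hHu : UniformContinuous H) {B : ℝ}
    (hB : ∀ x, ‖H x‖ ≤ B) {r : ℝ} (hr : 0 ≤ r) :
    ∀ T A : Lp ℂ 2 (volume.restrict (Icc 0 r)) →L[ℂ] Lp ℂ 2 (volume.restrict (Icc 0 r)),
    (∀ f : Lp ℂ 2 (volume.restrict (Icc 0 r)), T f =ᵐ[volume.restrict (Icc 0 r)]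
      fun x => ∫ y in (0 : ℝ)..r, H (x - y) * f y) →
    (∀ f, A f = f - T f + T (A (T f))) →
    ∃ G : ℝ → ℝ → ℂ, (Continuous fun p : ℝ × ℝ => G p.1 p.2) ∧
      ∀ f : Lp ℂ 2 (volume.restrict (Icc 0 r)),
        A f =ᵐ[volume.restrict (Icc 0 r)] oneMinusKernel G r f := by
  set μ : Measure ℝ := volume.restrict (Icc 0 r) with hμ
  intro T A hT hAT
  have hH : Continuous H := hHu.continuous
  have hcol : ∀ t : ℝ, MemLp (H ∘ fun u => u - t) 2 μ := fun t =>
    memLp_two_of_continuous (hH.comp (by fun_prop)) 0 r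
  have hcolc : Continuous fun t => (hcol t).toLp _ :=
    continuous_toLp_of_uniformContinuous hHu (k := fun t u => u - t) (fun t => by fun_prop)
      (fun t t' u => by rw [Real.dist_eq, Real.dist_eq, abs_sub_comm]; congr 1; ring) r
  have hHcu : UniformContinuous fun x => (starRingEnd ℂ) (H x) :=
    (LipschitzWith.of_dist_le_mul (K := 1) (fun a b => by
      rw [Complex.dist_conj_conj]; simp)).uniformContinuous.comp hHu
  have hrow : ∀ s : ℝ, MemLp ((fun x => (starRingEnd ℂ) (H x)) ∘ fun u => s - u) 2 μ := fun s =>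
    memLp_two_of_continuous (hHcu.continuous.comp (by fun_prop)) 0 r
  have hrowc : Continuous fun s => (hrow s).toLp _ :=
    continuous_toLp_of_uniformContinuous hHcu (k := fun s u => s - u) (fun t => by fun_prop)
      (fun t t' u => by simp) r
  set col : ℝ → Lp ℂ 2 μ := fun t => (hcol t).toLp _ with hcoldef
  set row : ℝ → Lp ℂ 2 μ := fun s => (hrow s).toLp _ with hrowdef
  have hrowi : ∀ (s : ℝ) (g : Lp ℂ 2 μ),
      inner ℂ (row s) g = ∫ u in (0 : ℝ)..r, H (s - u) * g u := by
    intro s g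
    rw [L2.inner_def, intervalIntegral.integral_of_le hr, ← integral_Icc_eq_integral_Ioc]
    refine integral_congr_ae ?_
    filter_upwards [(hrow s).coeFn_toLp] with u hu
    rw [hrowdef, RCLike.inner_apply, hu]
    simp [mul_comm]
  set G : ℝ → ℝ → ℂ := fun s t => H (s - t) - inner ℂ (row s) (A (col t)) with hG
  have hGc : Continuous fun p : ℝ × ℝ => G p.1 p.2 :=
    (hH.comp (by fun_prop)).sub ((hrowc.comp continuous_fst).inner
      (A.continuous.comp (hcolc.comp continuous_snd)))
  have hI : ∀ f : Lp ℂ 2 μ, Integrable f μ := fun f => (Lp.memLp f).integrable (by norm_num)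
  -- move `A` to the other side by its adjoint, then apply Fubini
  have hinner : ∀ (x : ℝ) (f : Lp ℂ 2 μ), inner ℂ (row x) (A (T f)) =
      ∫ y in (0 : ℝ)..r, inner ℂ (row x) (A (col y)) * f y := by
    intro x f
    set φ : Lp ℂ 2 μ := ContinuousLinearMap.adjoint A (row x) with hφ
    have hadj : ∀ g : Lp ℂ 2 μ, inner ℂ (row x) (A g) = inner ℂ φ g := fun g =>
      (ContinuousLinearMap.adjoint_inner_left A g (row x)).symm
    have hφc : Integrable (fun u => (starRingEnd ℂ) (φ u)) μ :=
      (hI φ).mono (Complex.continuous_conj.comp_aestronglyMeasurable (hI φ).1)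
        (Eventually.of_forall fun u => by simp)
    simp_rw [hadj]
    have hL : inner ℂ φ (T f) =
        ∫ u, ∫ y, H (u - y) * ((starRingEnd ℂ) (φ u) * f y) ∂μ ∂μ := by
      rw [L2.inner_def]
      refine integral_congr_ae ?_
      filter_upwards [hT f] with u hu
      rw [RCLike.inner_apply, hu, intervalIntegral.integral_of_le hr,
        ← integral_Icc_eq_integral_Ioc, ← integral_mul_const]
      refine integral_congr_ae (Eventually.of_forall fun y => ?_)
      simp only
      ring
    have hR : ∫ y in (0 : ℝ)..r, inner ℂ φ (col y) * f y =
        ∫ y, ∫ u, H (u - y) * ((starRingEnd ℂ) (φ u) * f y) ∂μ ∂μ := by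
      rw [intervalIntegral.integral_of_le hr, ← integral_Icc_eq_integral_Ioc]
      refine integral_congr_ae (Eventually.of_forall fun y => ?_)
      simp only
      rw [L2.inner_def, ← integral_mul_const]
      refine integral_congr_ae ?_
      filter_upwards [(hcol y).coeFn_toLp] with u hu
      rw [hcoldef, RCLike.inner_apply, hu]
      simp only [Function.comp_apply]
      ring
    rw [hL, hR]
    exact integral_sub_mul_mul_swap hH hB hφc (hI f)
  have hAG : ∀ f : Lp ℂ 2 μ, A f =ᵐ[μ] oneMinusKernel G r f := by
    intro f
    rw [hAT f]
    filter_upwards [Lp.coeFn_add (f - T f) (T (A (T f))), Lp.coeFn_sub f (T f), hT f,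
      hT (A (T f))] with x h1 h2 h3 h4
    rw [h1, Pi.add_apply, h2, Pi.sub_apply, h3, h4, ← hrowi x (A (T f)), hinner, oneMinusKernel]
    have i1 : IntervalIntegrable (fun y => H (x - y) * f y) volume 0 r :=
      (integrable_Icc_iff_intervalIntegrable hr).1 (integrable_sub_mul hH hB (hI f) x)
    have i2 : IntervalIntegrable (fun y => inner ℂ (row x) (A (col y)) * f y) volume 0 r := by
      refine (((integrable_Icc_iff_intervalIntegrable hr).1 (hI f))).continuousOn_mul ?_
      exact (continuous_const.inner (A.continuous.comp hcolc)).continuousOn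
    have : ∫ y in (0 : ℝ)..r, G x y * f y = (∫ y in (0 : ℝ)..r, H (x - y) * f y) -
        ∫ y in (0 : ℝ)..r, inner ℂ (row x) (A (col y)) * f y := by
      rw [← intervalIntegral.integral_sub i1 i2]
      simp only [hG, sub_mul]
    rw [this]
    ring
  exact ⟨G, hGc, hAG⟩

/-- For `‖w - 1‖_∞ < 1` the operator `I + ℋ_r` is invertible by a Neumann series, and
`I - (I + ℋ_r)⁻¹` has a continuous kernel. -/
theorem exists_isResolventKernel {w : ℝ → ℝ} (hw : Integrable fun ξ => w ξ - 1) {δ : ℝ}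
    (hδ0 : 0 ≤ δ) (hδ1 : δ < 1) (hδ : ∀ᵐ ξ, |w ξ - 1| ≤ δ) {r : ℝ} (hr : 0 ≤ r) :
    ∃ G : ℝ → ℝ → ℂ, IsResolventKernel (accelerant w) r G := by
  set μ : Measure ℝ := volume.restrict (Icc 0 r) with hμ
  obtain ⟨T, hTδ, hT⟩ := exists_convolution_operator hw hδ0 hδ hr
  set H : ℝ → ℂ := accelerant w with hHdef
  have hHu : UniformContinuous H := uniformContinuous_accelerant hw
  have hB : ∀ x, ‖H x‖ ≤ ∫ ξ, ‖spectralDensity w ξ‖ := norm_accelerant_le w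
  have hunit : IsUnit (1 + T) := by
    have := isUnit_one_sub_of_norm_lt_one (x := -T) (by rw [norm_neg]; linarith)
    rwa [sub_neg_eq_add] at this
  obtain ⟨A, hA1, hA2⟩ : ∃ A, A * (1 + T) = 1 ∧ (1 + T) * A = 1 :=
    ⟨_, hunit.unit.inv_mul, hunit.unit.mul_inv⟩
  have hAT : ∀ f, A f = f - T f + T (A (T f)) := by
    have h1 : A = 1 - A * T := by rw [eq_sub_iff_add_eq, ← hA1, mul_add, mul_one]
    have h2 : A = 1 - T * A := by rw [eq_sub_iff_add_eq, ← hA2, add_mul, one_mul]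
    intro f
    have h3 : A = 1 - T + T * (A * T) := by
      calc A = 1 - T * A := h2
        _ = 1 - T * (1 - A * T) := by rw [← h1]
        _ = _ := by noncomm_ring
    exact congrArg (fun B : Lp ℂ 2 μ →L[ℂ] Lp ℂ 2 μ => B f) h3
  obtain ⟨G, hGc, hAG⟩ := exists_kernel_of_eq hHu hB hr T A hT hAT
  have hTG : ∀ f : Lp ℂ 2 μ, ((1 + T) f : Lp ℂ 2 μ) =ᵐ[μ] onePlusConv H r f := by
    intro f
    have : (1 + T) f = f + T f := rfl
    rw [this]
    filter_upwards [Lp.coeFn_add f (T f), hT f] with x h1 h2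
    rw [h1, Pi.add_apply, h2, onePlusConv]
  have hGcongr : ∀ {f f₀ : ℝ → ℂ}, f =ᵐ[μ] f₀ → oneMinusKernel G r f =ᵐ[μ] oneMinusKernel G r f₀ := by
    intro f f₀ hf
    filter_upwards [hf] with x hx
    rw [oneMinusKernel, oneMinusKernel, hx, intervalIntegral_kernel_mul_congr hr hf]
  have hHcongr : ∀ {f f₀ : ℝ → ℂ}, f =ᵐ[μ] f₀ → onePlusConv H r f =ᵐ[μ] onePlusConv H r f₀ := by
    intro f f₀ hf
    filter_upwards [hf] with x hx
    rw [onePlusConv, onePlusConv, hx, intervalIntegral_sub_mul_congr hr (ae_eq_refl H) hf]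
  refine ⟨G, hGc.continuousOn, fun f hf => ?_, fun f hf => ?_⟩
  · have h1 := hf.coeFn_toLp
    have h2 : (1 + T) (A (hf.toLp f)) = hf.toLp f :=
      congrArg (fun B : Lp ℂ 2 μ →L[ℂ] Lp ℂ 2 μ => B (hf.toLp f)) hA2
    have h3 := hTG (A (hf.toLp f))
    rw [h2] at h3
    exact (hHcongr ((hGcongr h1.symm).trans (hAG _).symm)).trans (h3.symm.trans h1)
  · have h1 := hf.coeFn_toLp
    have h2 : A ((1 + T) (hf.toLp f)) = hf.toLp f :=
      congrArg (fun B : Lp ℂ 2 μ →L[ℂ] Lp ℂ 2 μ => B (hf.toLp f)) hA1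
    have h3 := hAG ((1 + T) (hf.toLp f))
    rw [h2] at h3
    exact (hGcongr ((hHcongr h1.symm).trans (hTG _).symm)).trans (h3.symm.trans h1)

/-! ### The weights -/

theorem one_le_bracket (x : ℝ) : 1 ≤ bracket x := by
  rw [bracket, Real.one_le_sqrt]
  nlinarith [sq_nonneg x]

theorem abs_le_bracket (x : ℝ) : |x| ≤ bracket x := by
  rw [bracket]
  exact Real.abs_le_sqrt (by linarith)

/-- The function `ξ ↦ ξ^j (w(ξ) - 1)`. -/
def moment (w : ℝ → ℝ) (j : ℕ) (ξ : ℝ) : ℂ := (ξ : ℂ) ^ j * ((w ξ - 1 : ℝ) : ℂ)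

theorem norm_moment_le (w : ℝ → ℝ) {j k : ℕ} (hjk : j ≤ k) (ξ : ℝ) :
    ‖moment w j ξ‖ ≤ ‖weightedDiff k w ξ‖ := by
  rw [moment, weightedDiff, norm_mul, norm_mul, norm_pow, norm_pow, Complex.norm_real,
    Complex.norm_real, mul_comm]
  have h1 := one_le_bracket ξ
  have h2 := abs_le_bracket ξ
  rw [Real.norm_of_nonneg (by linarith : 0 ≤ bracket ξ), Real.norm_eq_abs ξ]
  gcongr
  exact (pow_le_pow_left₀ (abs_nonneg _) h2 j).trans (pow_le_pow_right₀ h1 hjk)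

theorem Admissible.ae_norm_le {k : ℕ} {δ : ℝ} {w : ℝ → ℝ} (h : Admissible k δ w) :
    ∀ᵐ ξ, ‖weightedDiff k w ξ‖ ≤ δ := by
  have hb := h.bound
  rw [eLpNorm_exponent_top] at hb
  filter_upwards [ae_le_eLpNormEssSup (f := weightedDiff k w) (μ := volume)] with ξ hξ
  have := hξ.trans hb
  rw [← ofReal_norm] at this
  exact (ENNReal.ofReal_le_ofReal_iff h.delta_mem.1).1 this

theorem Admissible.aestronglyMeasurable_sub_one {k : ℕ} {δ : ℝ} {w : ℝ → ℝ}
    (h : Admissible k δ w) : AEStronglyMeasurable (fun ξ => w ξ - 1) volume := by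
  have hc : Continuous fun ξ => (bracket ξ ^ k)⁻¹ := by
    refine Continuous.inv₀ ?_ fun ξ => pow_ne_zero _ (by linarith [one_le_bracket ξ])
    unfold bracket
    fun_prop
  refine (h.integrable.1.mul hc.aestronglyMeasurable).congr (Eventually.of_forall fun ξ => ?_)
  have : bracket ξ ^ k ≠ 0 := pow_ne_zero _ (by linarith [one_le_bracket ξ])
  simp only [weightedDiff, Pi.mul_apply]
  field_simp

theorem Admissible.integrable_moment {k : ℕ} {δ : ℝ} {w : ℝ → ℝ} (h : Admissible k δ w) {j : ℕ}
    (hj : j ≤ k) : Integrable (moment w j) := by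
  refine h.integrable.mono ?_ (Eventually.of_forall (norm_moment_le w hj))
  refine AEStronglyMeasurable.mul ?_ ?_
  · exact (by fun_prop : Continuous fun ξ : ℝ => (ξ : ℂ) ^ j).aestronglyMeasurable
  · exact Complex.continuous_ofReal.comp_aestronglyMeasurable h.aestronglyMeasurable_sub_one

theorem Admissible.ae_norm_moment_le {k : ℕ} {δ : ℝ} {w : ℝ → ℝ} (h : Admissible k δ w) {j : ℕ}
    (hj : j ≤ k) : ∀ᵐ ξ, ‖moment w j ξ‖ ≤ δ :=
  h.ae_norm_le.mono fun ξ hξ => (norm_moment_le w hj ξ).trans hξ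

theorem norm_moment_zero (w : ℝ → ℝ) (ξ : ℝ) : ‖moment w 0 ξ‖ = |w ξ - 1| := by
  rw [moment, pow_zero, one_mul, Complex.norm_real, Real.norm_eq_abs]

theorem Admissible.integrable_sub_one {k : ℕ} {δ : ℝ} {w : ℝ → ℝ} (h : Admissible k δ w) :
    Integrable fun ξ => w ξ - 1 :=
  (h.integrable_moment (Nat.zero_le k)).mono h.aestronglyMeasurable_sub_one
    (Eventually.of_forall fun ξ => by rw [norm_moment_zero, Real.norm_eq_abs])

theorem Admissible.ae_abs_sub_one_le {k : ℕ} {δ : ℝ} {w : ℝ → ℝ} (h : Admissible k δ w) :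
    ∀ᵐ ξ, |w ξ - 1| ≤ δ :=
  (h.ae_norm_moment_le (Nat.zero_le k)).mono fun ξ hξ => by rwa [norm_moment_zero] at hξ

theorem Admissible.exists_isResolventFamily {k : ℕ} {δ : ℝ} {w : ℝ → ℝ} (h : Admissible k δ w) :
    ∃ Γ : ℝ → ℝ → ℝ → ℂ, IsResolventFamily w Γ := by
  have hex : ∀ r : ℝ, ∃ G : ℝ → ℝ → ℂ, 0 < r → IsResolventKernel (accelerant w) r G := by
    intro r
    by_cases hr : 0 < r
    · obtain ⟨G, hG⟩ := exists_isResolventKernel h.integrable_sub_one h.delta_mem.1 h.delta_mem.2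
        h.ae_abs_sub_one_le hr.le
      exact ⟨G, fun _ => hG⟩
    · exact ⟨0, fun hr' => absurd hr' hr⟩
  choose Γ hΓ using hex
  exact ⟨Γ, accelerant w, isAccelerant_accelerant h.integrable_sub_one, hΓ⟩

theorem IsResolventFamily.isResolventKernel {w : ℝ → ℝ} (hw : Integrable fun ξ => w ξ - 1)
    {Γ : ℝ → ℝ → ℝ → ℂ} (hΓ : IsResolventFamily w Γ) {r : ℝ} (hr : 0 < r) :
    IsResolventKernel (accelerant w) r (Γ r) := by
  obtain ⟨H, hH, hK⟩ := hΓ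
  exact (hK r hr).congr hr.le (hH.ae_eq (isAccelerant_accelerant hw))

/-! ### Differentiation of Fourier integrals -/

theorem hasDerivAt_expIntegral_neg {f : ℝ → ℂ} (hf : Integrable f)
    (hf' : Integrable fun ξ : ℝ => -Complex.I * ξ * f ξ) (t : ℝ) :
    HasDerivAt (fun t : ℝ => expIntegral f (-t))
      (expIntegral (fun ξ : ℝ => -Complex.I * ξ * f ξ) (-t)) t := by
  refine (hasDerivAt_integral_of_dominated_loc_of_deriv_le (μ := volume) (s := univ)
    (bound := fun ξ : ℝ => ‖-Complex.I * ξ * f ξ‖)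
    (F := fun (t ξ : ℝ) => Complex.exp (Complex.I * (-t : ℝ) * ξ) * f ξ)
    (F' := fun (t ξ : ℝ) => Complex.exp (Complex.I * (-t : ℝ) * ξ) * (-Complex.I * ξ * f ξ))
    univ_mem ?_ (integrable_exp_mul hf _) (integrable_exp_mul hf' _).1 ?_ hf'.norm ?_).2
  · exact Eventually.of_forall fun t => (integrable_exp_mul hf _).1
  · refine Eventually.of_forall fun ξ t _ => ?_
    rw [norm_mul, norm_exp_I_mul_mul, one_mul]
  · refine Eventually.of_forall fun ξ t _ => ?_
    have h0 : HasDerivAt (fun t : ℝ => Complex.I * ((-t : ℝ) : ℂ) * ξ) (-Complex.I * ξ) t := by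
      have h1 : HasDerivAt (fun t : ℝ => ((-t : ℝ) : ℂ)) (-1) t := by
        simpa using! (hasDerivAt_id t).neg.ofReal_comp
      simpa using (h1.const_mul Complex.I).mul_const (ξ : ℂ)
    refine (h0.cexp.mul_const (f ξ)).congr_deriv ?_
    ring

theorem iteratedDeriv_expIntegral_neg {f : ℝ → ℂ} {k : ℕ}
    (hf : ∀ j ≤ k, Integrable fun ξ : ℝ => (-Complex.I * ξ) ^ j * f ξ) {j : ℕ} (hj : j ≤ k) :
    iteratedDeriv j (fun t : ℝ => expIntegral f (-t)) =
      fun t : ℝ => expIntegral (fun ξ : ℝ => (-Complex.I * ξ) ^ j * f ξ) (-t) := by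
  induction j with
  | zero => simp
  | succ j ih =>
    rw [iteratedDeriv_succ, ih (by omega)]
    funext t
    have h1 : (fun ξ : ℝ => -Complex.I * ξ * ((-Complex.I * ξ) ^ j * f ξ)) =
        fun ξ : ℝ => (-Complex.I * ξ) ^ (j + 1) * f ξ := by funext ξ; ring
    have h := hasDerivAt_expIntegral_neg (hf j (by omega)) (by rw [h1]; exact hf (j + 1) hj) t
    rw [h1] at h
    exact h.deriv

theorem contDiff_expIntegral_neg {f : ℝ → ℂ} {k : ℕ}
    (hf : ∀ j ≤ k, Integrable fun ξ : ℝ => (-Complex.I * ξ) ^ j * f ξ) :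
    ContDiff ℝ (k : ℕ∞) fun t : ℝ => expIntegral f (-t) := by
  rw [contDiff_iff_iteratedDeriv]
  refine ⟨fun m hm => ?_, fun m hm => ?_⟩
  · have hm' : m ≤ k := by exact_mod_cast hm
    rw [iteratedDeriv_expIntegral_neg hf hm']
    exact (continuous_expIntegral (hf m hm')).comp continuous_neg
  · have hm' : m < k := by exact_mod_cast hm
    rw [iteratedDeriv_expIntegral_neg hf hm'.le]
    intro t
    have h1 : (fun ξ : ℝ => -Complex.I * ξ * ((-Complex.I * ξ) ^ m * f ξ)) =
        fun ξ : ℝ => (-Complex.I * ξ) ^ (m + 1) * f ξ := by funext ξ; ring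
    exact (hasDerivAt_expIntegral_neg (hf m hm'.le)
      (by rw [h1]; exact hf (m + 1) hm') t).differentiableAt

/-! ### The remainder as a band projection -/

/-- The Krein function `P_r(x) = e^{ixr} + R_{0,r}(x)`, the continuous analogue of an orthogonal
polynomial. -/
def kreinFunction (Γ : ℝ → ℝ → ℝ → ℂ) (r x : ℝ) : ℂ :=
  Complex.exp (Complex.I * x * r) + remainder Γ 0 r x

theorem remainder_zero (Γ : ℝ → ℝ → ℝ → ℂ) {r : ℝ} (hr : 0 < r) (x : ℝ) :
    remainder Γ 0 r x = -expIntegral ((Ioc 0 r).indicator (Γ r r)) x := by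
  rw [remainder, expIntegral, intervalIntegral.integral_of_le hr.le, pow_zero, neg_one_mul,
    ← integral_indicator measurableSet_Ioc]
  congr 1
  refine integral_congr_ae (Eventually.of_forall fun t => ?_)
  by_cases ht : t ∈ Ioc 0 r
  · simp only [indicator_of_mem ht, iteratedDerivWithin_zero, mul_comm]
  · simp only [indicator_of_notMem ht, mul_zero]

theorem IsResolventKernel.integrable_last_row {H : ℝ → ℂ} {r : ℝ} (hr : 0 < r) {G : ℝ → ℝ → ℂ}
    (hG : IsResolventKernel H r G) : Integrable ((Ioc 0 r).indicator (G r)) := by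
  rw [integrable_indicator_iff measurableSet_Ioc]
  have h : ContinuousOn (G r) (Icc 0 r) :=
    hG.continuousOn.comp (f := fun t => (r, t)) (by fun_prop)
      (fun t ht => ⟨right_mem_Icc.2 hr.le, ht⟩)
  exact h.integrableOn_Icc.mono_set Ioc_subset_Icc_self

theorem IsResolventKernel.continuous_remainder_zero {H : ℝ → ℂ} {r : ℝ} (hr : 0 < r)
    {Γ : ℝ → ℝ → ℝ → ℂ} (hG : IsResolventKernel H r (Γ r)) : Continuous (remainder Γ 0 r) := by
  rw [show remainder Γ 0 r = fun x => -expIntegral ((Ioc 0 r).indicator (Γ r r)) x from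
    funext (remainder_zero Γ hr)]
  exact (continuous_expIntegral (hG.integrable_last_row hr)).neg

theorem norm_remainder_zero_le (Γ : ℝ → ℝ → ℝ → ℂ) {r : ℝ} (hr : 0 < r) (x : ℝ) :
    ‖remainder Γ 0 r x‖ ≤ ∫ t, ‖(Ioc 0 r).indicator (Γ r r) t‖ := by
  rw [remainder_zero Γ hr, norm_neg]
  exact norm_expIntegral_le _ _

theorem IsResolventKernel.continuous_kreinFunction {H : ℝ → ℂ} {r : ℝ} (hr : 0 < r)
    {Γ : ℝ → ℝ → ℝ → ℂ} (hG : IsResolventKernel H r (Γ r)) : Continuous (kreinFunction Γ r) :=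
  (by fun_prop : Continuous fun x : ℝ => Complex.exp (Complex.I * x * r)).add
    (hG.continuous_remainder_zero hr)

theorem norm_kreinFunction_le (Γ : ℝ → ℝ → ℝ → ℂ) {r : ℝ} (hr : 0 < r) (x : ℝ) :
    ‖kreinFunction Γ r x‖ ≤ 1 + ∫ t, ‖(Ioc 0 r).indicator (Γ r r) t‖ :=
  (norm_add_le _ _).trans (add_le_add (norm_exp_I_mul_mul _ _).le (norm_remainder_zero_le Γ hr x))

/-- The last row of the resolvent kernel is a Fourier integral: the resolvent equation for `s = r`,
with the accelerant written as a Fourier transform. -/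
theorem IsResolventKernel.last_row_eq {w : ℝ → ℝ} (hw : Integrable fun ξ => w ξ - 1) {r : ℝ}
    (hr : 0 < r) {Γ : ℝ → ℝ → ℝ → ℂ} (hG : IsResolventKernel (accelerant w) r (Γ r)) {t : ℝ}
    (ht : t ∈ Icc 0 r) :
    Γ r r t = (2 * Real.pi : ℂ)⁻¹ *
      expIntegral (fun ξ => moment w 0 ξ * kreinFunction Γ r ξ) (-t) := by
  have hpi : (Real.pi : ℂ) ≠ 0 := by exact_mod_cast Real.pi_ne_zero
  set g : ℝ → ℂ := (Ioc 0 r).indicator (Γ r r) with hg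
  have hgi : Integrable g := hG.integrable_last_row hr
  have hsd := integrable_spectralDensity hw
  have h1 : Γ r r t = accelerant w (r - t) - ∫ u, g u * accelerant w (u - t) := by
    rw [hG.eq_sub_integral (continuous_accelerant hw) hr (right_mem_Icc.2 hr.le) ht,
      intervalIntegral.integral_of_le hr.le, ← integral_indicator measurableSet_Ioc]
    congr 1
    refine integral_congr_ae (Eventually.of_forall fun u => ?_)
    by_cases hu : u ∈ Ioc 0 r
    · simp only [hg, indicator_of_mem hu]
    · simp only [hg, indicator_of_notMem hu, zero_mul]
  have h2 : ∫ u, g u * accelerant w (u - t) =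
      ∫ ξ : ℝ, Complex.exp (Complex.I * (-t : ℝ) * ξ) * (spectralDensity w ξ * expIntegral g ξ) := by
    have hL : ∀ u : ℝ, g u * accelerant w (u - t) =
        ∫ ξ : ℝ, Complex.exp (Complex.I * (u - t : ℝ) * ξ) * (g u * spectralDensity w ξ) := by
      intro u
      rw [accelerant, expIntegral, ← integral_const_mul]
      refine integral_congr_ae (Eventually.of_forall fun ξ => ?_)
      simp only
      ring
    have hR : ∀ ξ : ℝ, Complex.exp (Complex.I * (-t : ℝ) * ξ) *
        (spectralDensity w ξ * expIntegral g ξ) =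
        ∫ u : ℝ, Complex.exp (Complex.I * (u - t : ℝ) * ξ) * (g u * spectralDensity w ξ) := by
      intro ξ
      rw [expIntegral, ← mul_assoc, ← integral_const_mul]
      refine integral_congr_ae (Eventually.of_forall fun u => ?_)
      have : Complex.exp (Complex.I * (u - t : ℝ) * ξ) =
          Complex.exp (Complex.I * (-t : ℝ) * ξ) * Complex.exp (Complex.I * ξ * u) := by
        rw [← Complex.exp_add]; congr 1; push_cast; ring
      simp only [this]
      ring
    simp_rw [hL, hR]
    refine integral_integral_swap (f := fun (u ξ : ℝ) =>
      Complex.exp (Complex.I * (u - t : ℝ) * ξ) * (g u * spectralDensity w ξ)) ?_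
    refine integrable_mul_mul_prod (k := fun p : ℝ × ℝ =>
      Complex.exp (Complex.I * (p.1 - t : ℝ) * p.2)) (c := 1) hgi hsd ?_
      (fun p => (norm_exp_I_mul_mul _ _).le)
    exact (by fun_prop : Continuous fun p : ℝ × ℝ =>
      Complex.exp (Complex.I * (p.1 - t : ℝ) * p.2)).aestronglyMeasurable
  have h3 : Integrable fun ξ : ℝ =>
      Complex.exp (Complex.I * (-t : ℝ) * ξ) * (spectralDensity w ξ * expIntegral g ξ) := by
    refine integrable_exp_mul ?_ _
    exact hsd.mul_bdd (continuous_expIntegral hgi).aestronglyMeasurable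
      (Eventually.of_forall (norm_expIntegral_le g))
  rw [h1, h2, accelerant, expIntegral, ← integral_sub (integrable_exp_mul hsd _) h3, expIntegral,
    ← integral_const_mul]
  refine integral_congr_ae (Eventually.of_forall fun ξ => ?_)
  have h4 : Complex.exp (Complex.I * (r - t : ℝ) * ξ) =
      Complex.exp (Complex.I * (-t : ℝ) * ξ) * Complex.exp (Complex.I * ξ * r) := by
    rw [← Complex.exp_add]; congr 1; push_cast; ring
  simp only [h4, kreinFunction, remainder_zero Γ hr, ← hg, moment, spectralDensity, pow_zero,
    one_mul]
  push_cast
  field_simp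
  ring

theorem bandProj_const_mul (r : ℝ) (c : ℂ) (f : ℝ → ℂ) (x : ℝ) :
    bandProj r (fun ξ => c * f ξ) x = c * bandProj r f x := by
  rw [bandProj, bandProj, ← integral_const_mul]
  refine integral_congr_ae (Eventually.of_forall fun t => ?_)
  simp only
  ring

section LastRow

variable {k : ℕ} {δ : ℝ} {w : ℝ → ℝ} {Γ : ℝ → ℝ → ℝ → ℂ} {r : ℝ}

theorem Admissible.integrable_moment_mul (h : Admissible k δ w) {j : ℕ} (hj : j ≤ k)
    {f : ℝ → ℂ} (hf : Continuous f) {K : ℝ} (hK : ∀ x, ‖f x‖ ≤ K) :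
    Integrable fun ξ => moment w j ξ * f ξ :=
  (h.integrable_moment hj).mul_bdd hf.aestronglyMeasurable (Eventually.of_forall hK)

theorem Admissible.integrable_pow_mul_moment_mul (h : Admissible k δ w)
    (hG : IsResolventKernel (accelerant w) r (Γ r)) (hr : 0 < r) {j : ℕ} (hj : j ≤ k) :
    Integrable fun ξ : ℝ => (-Complex.I * ξ) ^ j * (moment w 0 ξ * kreinFunction Γ r ξ) := by
  have h1 := (h.integrable_moment_mul hj (hG.continuous_kreinFunction hr)
    (norm_kreinFunction_le Γ hr)).const_mul ((-Complex.I) ^ j)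
  refine h1.congr (Eventually.of_forall fun ξ => ?_)
  simp only [moment]
  ring

theorem Admissible.contDiffOn_last_row (h : Admissible k δ w)
    (hG : IsResolventKernel (accelerant w) r (Γ r)) (hr : 0 < r) :
    ContDiffOn ℝ (k : ℕ∞) (fun t : ℝ => Γ r r t) (Icc 0 r) := by
  have hc := contDiff_expIntegral_neg fun j hj => h.integrable_pow_mul_moment_mul hG hr hj
  refine (contDiff_const.mul hc).contDiffOn.congr (f := fun t => (2 * Real.pi : ℂ)⁻¹ * expIntegral
    (fun ξ => moment w 0 ξ * kreinFunction Γ r ξ) (-t)) fun t ht => ?_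
  exact hG.last_row_eq h.integrable_sub_one hr ht

/-- `R_{k,r}` is the projection of `-λ^k (w - 1) P_r` onto the frequencies in `[0, r]`. For `k = 0`
this is an integral equation for `R_{0,r}`. -/
theorem Admissible.remainder_eq (h : Admissible k δ w)
    (hG : IsResolventKernel (accelerant w) r (Γ r)) (hr : 0 < r) (x : ℝ) :
    remainder Γ k r x = -bandProj r (fun ξ => moment w k ξ * kreinFunction Γ r ξ) x := by
  have hj := fun j (hj : j ≤ k) => h.integrable_pow_mul_moment_mul (Γ := Γ) hG hr hj
  have hc := contDiff_expIntegral_neg hj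
  have hderiv : ∀ t ∈ Icc 0 r, iteratedDerivWithin k (fun u : ℝ => Γ r r u) (Icc 0 r) t =
      (2 * Real.pi : ℂ)⁻¹ * expIntegral (fun ξ : ℝ =>
        (-Complex.I * ξ) ^ k * (moment w 0 ξ * kreinFunction Γ r ξ)) (-t) := by
    intro t ht
    rw [iteratedDerivWithin_congr (g := fun t => (2 * Real.pi : ℂ)⁻¹ * expIntegral
      (fun ξ => moment w 0 ξ * kreinFunction Γ r ξ) (-t))
      (fun t ht => hG.last_row_eq h.integrable_sub_one hr ht) ht,
      iteratedDerivWithin_eq_iteratedDeriv (uniqueDiffOn_Icc hr)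
        (contDiff_const.mul hc).contDiffAt ht,
      iteratedDeriv_const_mul _ hc.contDiffAt, iteratedDeriv_expIntegral_neg hj le_rfl]
  have hmom : (fun ξ : ℝ => (-Complex.I * ξ) ^ k * (moment w 0 ξ * kreinFunction Γ r ξ)) =
      fun ξ : ℝ => (-Complex.I) ^ k * (moment w k ξ * kreinFunction Γ r ξ) := by
    funext ξ
    simp only [moment]
    ring
  have hI : Complex.I ^ k * (-Complex.I) ^ k = 1 := by
    rw [← mul_pow, mul_neg, Complex.I_mul_I, neg_neg, one_pow]
  have hband : ∫ t in (0 : ℝ)..r, iteratedDerivWithin k (fun u : ℝ => Γ r r u) (Icc 0 r) t *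
      Complex.exp (Complex.I * x * t) = bandProj r (fun ξ : ℝ =>
        (-Complex.I * ξ) ^ k * (moment w 0 ξ * kreinFunction Γ r ξ)) x := by
    rw [bandProj_eq_expIntegral hr.le (hj k le_rfl), expIntegral,
      intervalIntegral.integral_of_le hr.le, ← integral_indicator measurableSet_Ioc]
    refine integral_congr_ae (Eventually.of_forall fun t => ?_)
    by_cases ht : t ∈ Ioc 0 r
    · simp only [indicator_of_mem ht]
      rw [hderiv t (Ioc_subset_Icc_self ht), mul_comm]
    · simp only [indicator_of_notMem ht, mul_zero]
  rw [remainder, hband, hmom, bandProj_const_mul]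
  linear_combination -bandProj r (fun ξ => moment w k ξ * kreinFunction Γ r ξ) x * hI

end LastRow

/-! ### The integral equation in `L^p` -/

/-- The operator `φ ↦ -bandProj r (m φ)` with symbol `m`. -/
def bandStep (r : ℝ) (m φ : ℝ → ℂ) (x : ℝ) : ℂ := -bandProj r (fun ξ => m ξ * φ ξ) x

/-- Bounded continuous functions. Integrable symbols map this class to itself under `bandStep`, so
that the iterates make sense. -/
def IsBddCont (φ : ℝ → ℂ) : Prop := Continuous φ ∧ ∃ K, ∀ x, ‖φ x‖ ≤ K

theorem IsBddCont.integrable_mul {φ m : ℝ → ℂ} (hφ : IsBddCont φ) (hm : Integrable m) :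
    Integrable fun ξ => m ξ * φ ξ := by
  obtain ⟨hc, K, hK⟩ := hφ
  exact hm.mul_bdd hc.aestronglyMeasurable (Eventually.of_forall hK)

theorem IsBddCont.add {φ ψ : ℝ → ℂ} (hφ : IsBddCont φ) (hψ : IsBddCont ψ) : IsBddCont (φ + ψ) := by
  obtain ⟨hc, K, hK⟩ := hφ
  obtain ⟨hc', K', hK'⟩ := hψ
  exact ⟨hc.add hc', K + K', fun x => (norm_add_le _ _).trans (add_le_add (hK x) (hK' x))⟩

theorem IsBddCont.bandStep {φ m : ℝ → ℂ} (hφ : IsBddCont φ) (hm : Integrable m) (r : ℝ) :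
    IsBddCont (bandStep r m φ) := by
  have hi := hφ.integrable_mul hm
  refine ⟨(continuous_bandProj r hi).neg, (2 * Real.pi)⁻¹ * |r| * ∫ t, ‖m t * φ t‖, fun x => ?_⟩
  rw [Krein.bandStep, norm_neg]
  exact norm_bandProj_le r hi x

theorem IsBddCont.iterate {φ m : ℝ → ℂ} (hφ : IsBddCont φ) (hm : Integrable m) (r : ℝ) (n : ℕ) :
    IsBddCont ((Krein.bandStep r m)^[n] φ) := by
  induction n with
  | zero => exact hφ
  | succ n ih => rw [Function.iterate_succ_apply']; exact ih.bandStep hm r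

theorem bandStep_add {φ ψ m : ℝ → ℂ} (hφ : IsBddCont φ) (hψ : IsBddCont ψ) (hm : Integrable m)
    (r : ℝ) : bandStep r m (φ + ψ) = bandStep r m φ + bandStep r m ψ := by
  funext x
  simp only [bandStep, Pi.add_apply, bandProj]
  rw [← neg_add, ← integral_add (integrable_dirichletKernel_mul r x (hφ.integrable_mul hm))
    (integrable_dirichletKernel_mul r x (hψ.integrable_mul hm))]
  congr 1
  refine integral_congr_ae (Eventually.of_forall fun t => ?_)
  simp only
  ring

theorem iterate_bandStep_add {φ ψ m : ℝ → ℂ} (hφ : IsBddCont φ) (hψ : IsBddCont ψ)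
    (hm : Integrable m) (r : ℝ) (n : ℕ) :
    (bandStep r m)^[n] (φ + ψ) = (bandStep r m)^[n] φ + (bandStep r m)^[n] ψ := by
  induction n with
  | zero => rfl
  | succ n ih =>
    rw [Function.iterate_succ_apply', ih, bandStep_add (hφ.iterate hm r n) (hψ.iterate hm r n) hm,
      Function.iterate_succ_apply', Function.iterate_succ_apply']

theorem isBddCont_exp (r : ℝ) : IsBddCont fun x : ℝ => Complex.exp (Complex.I * x * r) :=
  ⟨by fun_prop, 1, fun x => (norm_exp_I_mul_mul x r).le⟩

theorem eLpNorm_mul_le_of_ae_norm_le {m φ : ℝ → ℂ} {c : ℝ} (hm : ∀ᵐ ξ, ‖m ξ‖ ≤ c) (q : ENNReal) :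
    eLpNorm (fun ξ => m ξ * φ ξ) q volume ≤ ENNReal.ofReal c * eLpNorm φ q volume := by
  refine eLpNorm_le_mul_eLpNorm_of_ae_le_mul (hm.mono fun ξ hξ => ?_) q
  rw [norm_mul]
  gcongr

theorem eLpNorm_mul_le_of_norm_le {m φ : ℝ → ℂ} {b : ℝ → ℝ} (hm : ∀ ξ, ‖m ξ‖ ≤ ‖b ξ‖) {K : ℝ}
    (hK : ∀ x, ‖φ x‖ ≤ K) (q : ENNReal) :
    eLpNorm (fun ξ => m ξ * φ ξ) q volume ≤ ENNReal.ofReal K * eLpNorm b q volume := by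
  refine eLpNorm_le_mul_eLpNorm_of_ae_le_mul (Eventually.of_forall fun ξ => ?_) q
  rw [norm_mul, mul_comm]
  exact mul_le_mul (hK ξ) (hm ξ) (norm_nonneg _) ((norm_nonneg _).trans (hK ξ))

/-- Interpolation between `L¹` and `L^∞`. -/
theorem eLpNorm_le_of_ae_norm_le {b : ℝ → ℝ} {δ : ℝ} (hδ : ∀ᵐ ξ, ‖b ξ‖ ≤ δ)
    {q : ℝ} (hq : 1 ≤ q) :
    eLpNorm b (ENNReal.ofReal q) volume ≤
      ENNReal.ofReal δ ^ (1 - 1 / q) * eLpNorm b 1 volume ^ (1 / q) := by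
  have hq0 : 0 < q := by linarith
  rw [← ENNReal.rpow_le_rpow_iff hq0, eLpNorm_ofReal_rpow _ _ hq0,
    ENNReal.mul_rpow_of_nonneg _ _ hq0.le, ← ENNReal.rpow_mul, ← ENNReal.rpow_mul,
    one_div_mul_cancel hq0.ne', ENNReal.rpow_one, eLpNorm_one_eq_lintegral_enorm, sub_mul,
    one_div_mul_cancel hq0.ne', one_mul,
    ← lintegral_const_mul' _ _ (ENNReal.rpow_ne_top_of_nonneg (by linarith) ENNReal.ofReal_ne_top)]
  refine lintegral_mono_ae (hδ.mono fun ξ hξ => ?_)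
  have h1 : ‖b ξ‖ₑ ^ q = ‖b ξ‖ₑ ^ (q - 1) * ‖b ξ‖ₑ := by
    nth_rewrite 3 [← ENNReal.rpow_one ‖b ξ‖ₑ]
    rw [← ENNReal.rpow_add_of_nonneg _ _ (by linarith) zero_le_one, sub_add_cancel]
  rw [h1]
  gcongr
  exact enorm_le_ofReal_of_norm_le hξ

/-- `bandProj r` is bounded on `L^q` with constant `C`, tested on integrable functions. -/
def BandBound (r q C : ℝ) : Prop :=
  ∀ f : ℝ → ℂ, Integrable f → eLpNorm (bandProj r f) (ENNReal.ofReal q) volume ≤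
    ENNReal.ofReal C * eLpNorm f (ENNReal.ofReal q) volume

theorem BandBound.mono {r q C C' : ℝ} (h : BandBound r q C) (hC : C ≤ C') : BandBound r q C' :=
  fun f hf => (h f hf).trans (by gcongr)

theorem bandBound_two {r : ℝ} (hr : 0 ≤ r) : BandBound r 2 1 := by
  intro f hf
  have : ENNReal.ofReal 2 = 2 := by simp
  rw [this, ENNReal.ofReal_one, one_mul]
  exact eLpNorm_two_bandProj_le hr hf

theorem bandBound_even (r : ℝ) {n : ℕ} (hn : Even n) (hn0 : 0 < n) {q : ℝ}
    (hq : q = n ∨ (n : ℝ).HolderConjugate q) : BandBound r q (24 * n) := by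
  intro f hf
  rcases hq with rfl | hq
  · exact eLpNorm_bandProj_even_le r hf hn hn0
  · exact eLpNorm_bandProj_le_of_dual r hq (fun g hg => eLpNorm_bandProj_even_le r hg hn hn0) hf

theorem eLpNorm_bandStep_le {r q C : ℝ} (hB : BandBound r q C) {m φ : ℝ → ℂ} (hm : Integrable m)
    (hφ : IsBddCont φ) :
    eLpNorm (bandStep r m φ) (ENNReal.ofReal q) volume ≤
      ENNReal.ofReal C * eLpNorm (fun ξ => m ξ * φ ξ) (ENNReal.ofReal q) volume := by
  have : bandStep r m φ = -bandProj r fun ξ => m ξ * φ ξ := rfl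
  rw [this, eLpNorm_neg]
  exact hB _ (hφ.integrable_mul hm)

section Estimates

variable {r δ : ℝ} {m₀ m₁ : ℝ → ℂ} {b : ℝ → ℝ}

/-- If `P = e^{ixr} + T P` with `‖T‖ ≤ 1/2` on `L^q`, the right side of the integral equation is
bounded by twice the norm of the first term. -/
theorem eLpNorm_bandStep_solution_le {q C : ℝ} (hq : 1 ≤ q) (hB : BandBound r q C) (hC : 0 ≤ C)
    (hCδ : C * δ ≤ 1 / 2) (hm₀ : Integrable m₀) (hm₁ : Integrable m₁)
    (hb₀ : ∀ ξ, ‖m₀ ξ‖ ≤ ‖b ξ‖) (hb₁ : ∀ ξ, ‖m₁ ξ‖ ≤ ‖b ξ‖) (hbδ : ∀ᵐ ξ, ‖b ξ‖ ≤ δ)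
    (hbq : eLpNorm b (ENNReal.ofReal q) volume ≠ ⊤) {P : ℝ → ℂ} (hP : IsBddCont P)
    (hPeq : P = (fun x : ℝ => Complex.exp (Complex.I * x * r)) + bandStep r m₀ P) :
    eLpNorm (bandStep r m₁ P) (ENNReal.ofReal q) volume ≤
      ENNReal.ofReal (2 * C) * eLpNorm b (ENNReal.ofReal q) volume := by
  set Q : ENNReal := ENNReal.ofReal q with hQ
  have hQ1 : 1 ≤ Q := by rw [hQ, ENNReal.one_le_ofReal]; exact hq
  set N : ENNReal := eLpNorm b Q volume with hN
  set e : ℝ → ℂ := fun x : ℝ => Complex.exp (Complex.I * x * r) with he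
  have hR : IsBddCont (bandStep r m₀ P) := hP.bandStep hm₀ r
  -- the a priori bound which allows the left side to be absorbed
  have hfin : eLpNorm (bandStep r m₀ P) Q volume ≠ ⊤ := by
    obtain ⟨-, K, hK⟩ := id hP
    refine ne_top_of_le_ne_top ?_ ((eLpNorm_bandStep_le hB hm₀ hP).trans
      (mul_le_mul_right (eLpNorm_mul_le_of_norm_le hb₀ hK Q) _))
    exact ENNReal.mul_ne_top ENNReal.ofReal_ne_top (ENNReal.mul_ne_top ENNReal.ofReal_ne_top hbq)
  set x : ENNReal := eLpNorm (bandStep r m₀ P) Q volume with hx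
  have hstep : ∀ m : ℝ → ℂ, Integrable m → (∀ ξ, ‖m ξ‖ ≤ ‖b ξ‖) →
      eLpNorm (bandStep r m P) Q volume ≤ ENNReal.ofReal C * N + x / 2 := by
    intro m hm hmb
    have hmδ : ∀ᵐ ξ, ‖m ξ‖ ≤ δ := hbδ.mono fun ξ hξ => (hmb ξ).trans hξ
    have h1 : bandStep r m P = bandStep r m e + bandStep r m (bandStep r m₀ P) := by
      rw [← bandStep_add (isBddCont_exp r) hR hm, ← hPeq]
    rw [h1]
    refine (eLpNorm_add_le ((isBddCont_exp r).bandStep hm r).1.aestronglyMeasurable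
      (hR.bandStep hm r).1.aestronglyMeasurable hQ1).trans ?_
    refine add_le_add ?_ ?_
    · refine (eLpNorm_bandStep_le hB hm (isBddCont_exp r)).trans ?_
      gcongr
      have := eLpNorm_mul_le_of_norm_le hmb (fun x => (norm_exp_I_mul_mul x r).le) Q
      rwa [ENNReal.ofReal_one, one_mul] at this
    · refine (eLpNorm_bandStep_le hB hm hR).trans ?_
      refine (mul_le_mul_right (eLpNorm_mul_le_of_ae_norm_le hmδ Q) _).trans ?_
      rw [← mul_assoc, ← ENNReal.ofReal_mul hC, ENNReal.div_eq_inv_mul]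
      gcongr
      refine (ENNReal.ofReal_le_ofReal hCδ).trans (le_of_eq ?_)
      rw [one_div, ENNReal.ofReal_inv_of_pos (by norm_num)]
      norm_num
  have hx2 : x / 2 ≤ ENNReal.ofReal C * N := by
    have h1 := hstep m₀ hm₀ hb₀
    rw [← hx] at h1
    nth_rewrite 1 [← ENNReal.add_halves x] at h1
    exact (ENNReal.add_le_add_iff_right (ENNReal.div_ne_top hfin (by norm_num))).1 h1
  refine (hstep m₁ hm₁ hb₁).trans ((add_le_add_right hx2 _).trans (le_of_eq ?_))
  rw [← two_mul, ENNReal.ofReal_mul (by norm_num), mul_assoc]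
  simp

/-- Decay of the Neumann series in `L^q`, multiplied by a second symbol `m` which is dominated by `b`.
A bounded `φ` need not be in `L^q`, but its product with `m` is. -/
theorem eLpNorm_mul_iterate_le {q C : ℝ} (hB : BandBound r q C) (hm₀ : Integrable m₀)
    (hb₀ : ∀ ξ, ‖m₀ ξ‖ ≤ ‖b ξ‖) (hbδ : ∀ᵐ ξ, ‖b ξ‖ ≤ δ) {φ : ℝ → ℂ} (hφ : IsBddCont φ) {K : ℝ}
    (hK : ∀ x, ‖φ x‖ ≤ K) (n : ℕ) :
    ∀ m : ℝ → ℂ, (∀ ξ, ‖m ξ‖ ≤ ‖b ξ‖) →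
      eLpNorm (fun ξ => m ξ * (bandStep r m₀)^[n] φ ξ) (ENNReal.ofReal q) volume ≤
        (ENNReal.ofReal C * ENNReal.ofReal δ) ^ n *
          (ENNReal.ofReal K * eLpNorm b (ENNReal.ofReal q) volume) := by
  induction n with
  | zero =>
    intro m hm
    simpa using eLpNorm_mul_le_of_norm_le hm hK (ENNReal.ofReal q)
  | succ n ih =>
    intro m hm
    have hmδ : ∀ᵐ ξ, ‖m ξ‖ ≤ δ := hbδ.mono fun ξ hξ => (hm ξ).trans hξ
    rw [Function.iterate_succ_apply']
    refine (eLpNorm_mul_le_of_ae_norm_le hmδ _).trans ?_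
    refine (mul_le_mul_right (eLpNorm_bandStep_le hB hm₀ (hφ.iterate hm₀ r n)) _).trans ?_
    refine (mul_le_mul_right (mul_le_mul_right (ih m₀ hb₀) _) _).trans (le_of_eq ?_)
    rw [pow_succ]
    ring

theorem ennreal_rpow_pow_comm (x : ENNReal) (n : ℕ) (θ : ℝ) : (x ^ n) ^ θ = (x ^ θ) ^ n := by
  rw [← ENNReal.rpow_natCast, ← ENNReal.rpow_mul, mul_comm, ENNReal.rpow_mul, ENNReal.rpow_natCast]

theorem ennreal_rpow_one_sub_mul_rpow (x : ENNReal) {θ : ℝ} (hθ0 : 0 ≤ θ) (hθ1 : θ ≤ 1) :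
    x ^ (1 - θ) * x ^ θ = x := by
  rw [← ENNReal.rpow_add_of_nonneg _ _ (by linarith) hθ0, sub_add_cancel, ENNReal.rpow_one]

/-- The terms of the Neumann series decay geometrically in `L^p`: the norms of each term in `L²` and
`L^q` are interpolated, so that no interpolation of operators is needed. -/
theorem eLpNorm_bandStep_iterate_le {p q C θ : ℝ} (hr : 0 ≤ r) (hp : 0 < p) (hq : 0 < q)
    (hθ0 : 0 ≤ θ) (hθ1 : θ ≤ 1) (hpq : 1 / p = (1 - θ) / 2 + θ / q) (hB : BandBound r q C)
    (hm₀ : Integrable m₀) (hm₁ : Integrable m₁)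
    (hb₀ : ∀ ξ, ‖m₀ ξ‖ ≤ ‖b ξ‖) (hb₁ : ∀ ξ, ‖m₁ ξ‖ ≤ ‖b ξ‖) (hbδ : ∀ᵐ ξ, ‖b ξ‖ ≤ δ)
    {φ : ℝ → ℂ} (hφ : IsBddCont φ) {K : ℝ} (hK : ∀ x, ‖φ x‖ ≤ K) (n : ℕ) :
    eLpNorm (bandStep r m₁ ((bandStep r m₀)^[n] φ)) (ENNReal.ofReal p) volume ≤
      (ENNReal.ofReal δ * ENNReal.ofReal C ^ θ) ^ n * (ENNReal.ofReal K *
        (ENNReal.ofReal C ^ θ * (eLpNorm b (ENNReal.ofReal 2) volume ^ (1 - θ) *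
          eLpNorm b (ENNReal.ofReal q) volume ^ θ))) := by
  have hθ' : 0 ≤ 1 - θ := sub_nonneg.2 hθ1
  have hit := hφ.iterate hm₀ r n
  have h2 := (eLpNorm_bandStep_le (bandBound_two hr) hm₁ hit).trans
    (mul_le_mul_right (eLpNorm_mul_iterate_le (bandBound_two hr) hm₀ hb₀ hbδ hφ hK n m₁ hb₁) _)
  have hq' := (eLpNorm_bandStep_le hB hm₁ hit).trans
    (mul_le_mul_right (eLpNorm_mul_iterate_le hB hm₀ hb₀ hbδ hφ hK n m₁ hb₁) _)
  rw [ENNReal.ofReal_one, one_mul, one_mul] at h2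
  have h := eLpNorm_le_rpow_mul_rpow (hit.bandStep hm₁ r).1.aestronglyMeasurable hp
    (by norm_num) hq hθ0 hθ1 hpq
  refine h.trans ((mul_le_mul' (ENNReal.rpow_le_rpow h2 hθ') (ENNReal.rpow_le_rpow hq' hθ0)).trans
    (le_of_eq ?_))
  set D := ENNReal.ofReal δ
  set c := ENNReal.ofReal C
  set k := ENNReal.ofReal K
  set N₂ := eLpNorm b (ENNReal.ofReal 2) volume
  set N := eLpNorm b (ENNReal.ofReal q) volume
  rw [ENNReal.mul_rpow_of_nonneg _ _ hθ', ENNReal.mul_rpow_of_nonneg _ _ hθ',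
    ENNReal.mul_rpow_of_nonneg _ _ hθ0, ENNReal.mul_rpow_of_nonneg _ _ hθ0,
    ENNReal.mul_rpow_of_nonneg _ _ hθ0, ennreal_rpow_pow_comm, ennreal_rpow_pow_comm,
    ENNReal.mul_rpow_of_nonneg _ _ hθ0]
  calc (D ^ (1 - θ)) ^ n * (k ^ (1 - θ) * N₂ ^ (1 - θ)) *
        (c ^ θ * ((c ^ θ * D ^ θ) ^ n * (k ^ θ * N ^ θ)))
      = ((D ^ (1 - θ) * D ^ θ) * c ^ θ) ^ n * ((k ^ (1 - θ) * k ^ θ) *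
          (c ^ θ * (N₂ ^ (1 - θ) * N ^ θ))) := by
        rw [mul_pow, mul_pow, mul_pow]; ring
    _ = _ := by
        rw [ennreal_rpow_one_sub_mul_rpow D hθ0 hθ1,
          ennreal_rpow_one_sub_mul_rpow k hθ0 hθ1]

/-- Summation of the Neumann series in `L^p`. The bound does not depend on the supremum of `P`, which
enters only through the remainder after `n` terms. -/
theorem eLpNorm_bandStep_solution_le_of_lt_one {p q C θ : ℝ} (hr : 0 ≤ r) (hp : 1 ≤ p)
    (hq : 0 < q) (hθ0 : 0 ≤ θ) (hθ1 : θ ≤ 1) (hpq : 1 / p = (1 - θ) / 2 + θ / q)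
    (hB : BandBound r q C)
    (hρ : ENNReal.ofReal δ * ENNReal.ofReal C ^ θ < 1) (hm₀ : Integrable m₀) (hm₁ : Integrable m₁)
    (hb₀ : ∀ ξ, ‖m₀ ξ‖ ≤ ‖b ξ‖) (hb₁ : ∀ ξ, ‖m₁ ξ‖ ≤ ‖b ξ‖) (hbδ : ∀ᵐ ξ, ‖b ξ‖ ≤ δ)
    (hb2 : eLpNorm b (ENNReal.ofReal 2) volume ≠ ⊤) (hbq : eLpNorm b (ENNReal.ofReal q) volume ≠ ⊤)
    {P : ℝ → ℂ} (hP : IsBddCont P)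
    (hPeq : P = (fun x : ℝ => Complex.exp (Complex.I * x * r)) + bandStep r m₀ P) :
    eLpNorm (bandStep r m₁ P) (ENNReal.ofReal p) volume ≤
      (1 - ENNReal.ofReal δ * ENNReal.ofReal C ^ θ)⁻¹ *
        (ENNReal.ofReal C ^ θ * (eLpNorm b (ENNReal.ofReal 2) volume ^ (1 - θ) *
          eLpNorm b (ENNReal.ofReal q) volume ^ θ)) := by
  have hp1 : 1 ≤ ENNReal.ofReal p := by rw [ENNReal.one_le_ofReal]; exact hp
  set e : ℝ → ℂ := fun x : ℝ => Complex.exp (Complex.I * x * r) with he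
  have heb : IsBddCont e := isBddCont_exp r
  obtain ⟨-, K, hK⟩ := id hP
  set ρ : ENNReal := ENNReal.ofReal δ * ENNReal.ofReal C ^ θ with hρdef
  set A : ENNReal := ENNReal.ofReal C ^ θ * (eLpNorm b (ENNReal.ofReal 2) volume ^ (1 - θ) *
    eLpNorm b (ENNReal.ofReal q) volume ^ θ) with hA
  have hAtop : A ≠ ⊤ := by
    refine ENNReal.mul_ne_top (ENNReal.rpow_ne_top_of_nonneg hθ0 ENNReal.ofReal_ne_top)
      (ENNReal.mul_ne_top (ENNReal.rpow_ne_top_of_nonneg (by linarith) hb2)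
        (ENNReal.rpow_ne_top_of_nonneg hθ0 hbq))
  have hterm : ∀ n, eLpNorm (bandStep r m₁ ((bandStep r m₀)^[n] e)) (ENNReal.ofReal p) volume ≤
      ρ ^ n * A := by
    intro n
    have := eLpNorm_bandStep_iterate_le hr (by linarith) hq hθ0 hθ1 hpq hB hm₀ hm₁ hb₀ hb₁ hbδ
      heb (fun x => (norm_exp_I_mul_mul x r).le) n
    rwa [ENNReal.ofReal_one, one_mul] at this
  have hrest : ∀ n, eLpNorm (bandStep r m₁ ((bandStep r m₀)^[n] P)) (ENNReal.ofReal p) volume ≤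
      ρ ^ n * (ENNReal.ofReal K * A) := fun n =>
    eLpNorm_bandStep_iterate_le hr (by linarith) hq hθ0 hθ1 hpq hB hm₀ hm₁ hb₀ hb₁ hbδ hP hK n
  have hsplit : ∀ n, eLpNorm (bandStep r m₁ P) (ENNReal.ofReal p) volume ≤
      (∑ j ∈ Finset.range n, ρ ^ j * A) +
        eLpNorm (bandStep r m₁ ((bandStep r m₀)^[n] P)) (ENNReal.ofReal p) volume := by
    intro n
    induction n with
    | zero => simp
    | succ n ih =>
      have h1 : (bandStep r m₀)^[n] P = (bandStep r m₀)^[n] e + (bandStep r m₀)^[n + 1] P := by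
        nth_rewrite 1 [hPeq]
        rw [iterate_bandStep_add heb (hP.bandStep hm₀ r) hm₀, Function.iterate_succ_apply]
      have h2 := (heb.iterate hm₀ r n).bandStep hm₁ r
      have h3 := (hP.iterate hm₀ r (n + 1)).bandStep hm₁ r
      rw [h1, bandStep_add (heb.iterate hm₀ r n) (hP.iterate hm₀ r (n + 1)) hm₁] at ih
      refine ih.trans ?_
      rw [Finset.sum_range_succ, add_assoc]
      gcongr
      exact (eLpNorm_add_le h2.1.aestronglyMeasurable h3.1.aestronglyMeasurable hp1).trans
        (add_le_add_left (hterm n) _)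
  have hbound : ∀ n, eLpNorm (bandStep r m₁ P) (ENNReal.ofReal p) volume ≤
      (1 - ρ)⁻¹ * A + ρ ^ n * (ENNReal.ofReal K * A) := by
    intro n
    refine (hsplit n).trans (add_le_add ?_ (hrest n))
    rw [← Finset.sum_mul, ← ENNReal.tsum_geometric]
    gcongr
    exact ENNReal.sum_le_tsum _
  have hlim : Tendsto (fun n : ℕ => (1 - ρ)⁻¹ * A + ρ ^ n * (ENNReal.ofReal K * A)) atTop
      (𝓝 ((1 - ρ)⁻¹ * A + 0 * (ENNReal.ofReal K * A))) := by
    refine tendsto_const_nhds.add (ENNReal.Tendsto.mul_const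
      (ENNReal.tendsto_pow_atTop_nhds_zero_of_lt_one hρ) (Or.inr ?_))
    exact ENNReal.mul_ne_top ENNReal.ofReal_ne_top hAtop
  have := ge_of_tendsto' hlim hbound
  simpa using this

end Estimates

/-! ### Uniform bounds for the remainders -/

theorem Admissible.zero {k : ℕ} {δ : ℝ} {w : ℝ → ℝ} (h : Admissible k δ w) :
    Admissible 0 δ w where
  nonneg := h.nonneg
  integrable := by
    have : weightedDiff 0 w = fun ξ => w ξ - 1 := by funext ξ; simp [weightedDiff]
    rw [this]
    exact h.integrable_sub_one
  delta_mem := h.delta_mem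
  bound := by
    refine (eLpNorm_le_of_ae_bound (C := δ) (h.ae_abs_sub_one_le.mono fun ξ hξ => ?_)).trans ?_
    · simpa [weightedDiff] using hξ
    · simp

section Bounds

variable {k : ℕ} {δ : ℝ} {w : ℝ → ℝ} {Γ : ℝ → ℝ → ℝ → ℂ}

theorem Admissible.remainder_eq_bandStep (h : Admissible k δ w) (hΓ : IsResolventFamily w Γ)
    {r : ℝ} (hr : 0 < r) : remainder Γ k r = bandStep r (moment w k) (kreinFunction Γ r) :=
  funext fun x => h.remainder_eq (hΓ.isResolventKernel h.integrable_sub_one hr) hr x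

theorem Admissible.kreinFunction_eq (h : Admissible k δ w) (hΓ : IsResolventFamily w Γ)
    {r : ℝ} (hr : 0 < r) : kreinFunction Γ r =
      (fun x : ℝ => Complex.exp (Complex.I * x * r)) +
        bandStep r (moment w 0) (kreinFunction Γ r) := by
  rw [← h.zero.remainder_eq_bandStep hΓ hr]
  rfl

theorem Admissible.isBddCont_kreinFunction (h : Admissible k δ w) (hΓ : IsResolventFamily w Γ)
    {r : ℝ} (hr : 0 < r) : IsBddCont (kreinFunction Γ r) :=
  ⟨(hΓ.isResolventKernel h.integrable_sub_one hr).continuous_kreinFunction hr,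
    1 + ∫ t, ‖(Ioc 0 r).indicator (Γ r r) t‖, norm_kreinFunction_le Γ hr⟩

theorem Admissible.eLpNorm_weightedDiff_ne_top (h : Admissible k δ w) {q : ℝ} (hq : 1 ≤ q) :
    eLpNorm (weightedDiff k w) (ENNReal.ofReal q) volume ≠ ⊤ := by
  have h1 : 1 / q ≤ 1 := by rw [div_le_one (by linarith)]; exact hq
  refine ne_top_of_le_ne_top ?_ (eLpNorm_le_of_ae_norm_le h.ae_norm_le hq)
  exact ENNReal.mul_ne_top (ENNReal.rpow_ne_top_of_nonneg (by linarith) ENNReal.ofReal_ne_top)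
    (ENNReal.rpow_ne_top_of_nonneg (by positivity) (memLp_one_iff_integrable.2 h.integrable).2.ne)

/-- An exponent `p` with `|1/2 - 1/p| ≤ 1/2 - 1/n` lies between `2` and either `n` or the conjugate
exponent of `n`. -/
theorem exists_interpolation_exponent {n : ℕ} (hn : 4 ≤ n) {p θ : ℝ}
    (hp : |1 / 2 - 1 / p| = θ * (1 / 2 - 1 / n)) :
    ∃ q : ℝ, 1 ≤ q ∧ (q = n ∨ (n : ℝ).HolderConjugate q) ∧ 1 / p = (1 - θ) / 2 + θ / q := by
  have hn' : (4 : ℝ) ≤ n := by exact_mod_cast hn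
  rcases le_total 0 (1 / 2 - 1 / p) with h0 | h0
  · rw [abs_of_nonneg h0] at hp
    exact ⟨n, by linarith, Or.inl rfl, by linear_combination -hp⟩
  · rw [abs_of_nonpos h0] at hp
    have hc : (n : ℝ).HolderConjugate (n : ℝ).conjExponent :=
      Real.HolderConjugate.conjExponent (by linarith)
    refine ⟨(n : ℝ).conjExponent, hc.symm.lt.le, Or.inr hc, ?_⟩
    have h1 : (n : ℝ).conjExponent⁻¹ = 1 - 1 / n := by
      have := hc.inv_add_inv_eq_one
      rw [one_div]
      linarith
    rw [div_eq_mul_inv θ, h1]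
    linear_combination hp

/-- Boundedness in `L^p` when the Neumann series converges with ratio `δ (24 n)^θ < 1`. -/
theorem Admissible.supNorm_lt_top (h : Admissible k δ w) (hΓ : IsResolventFamily w Γ) {p : ℝ}
    (hp : 1 ≤ p) {n : ℕ} (hn : Even n) (hn4 : 4 ≤ n) {θ : ℝ} (hθ0 : 0 ≤ θ) (hθ1 : θ ≤ 1)
    (hpθ : |1 / 2 - 1 / p| = θ * (1 / 2 - 1 / n)) (hδ : δ * (24 * n : ℝ) ^ θ < 1) :
    supNorm Γ k p < ⊤ := by
  obtain ⟨q, hq, hqn, hpq⟩ := exists_interpolation_exponent hn4 hpθ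
  have hn' : (0 : ℝ) < n := by exact_mod_cast (by omega : 0 < n)
  have hρ : ENNReal.ofReal δ * ENNReal.ofReal (24 * n) ^ θ < 1 := by
    rw [ENNReal.ofReal_rpow_of_pos (by positivity), ← ENNReal.ofReal_mul h.delta_mem.1]
    exact ENNReal.ofReal_lt_one.2 hδ
  have hb2 := h.eLpNorm_weightedDiff_ne_top one_le_two
  have hbq := h.eLpNorm_weightedDiff_ne_top hq
  refine lt_of_le_of_lt (iSup₂_le fun r hr => ?_) (b := (1 - ENNReal.ofReal δ *
    ENNReal.ofReal (24 * n) ^ θ)⁻¹ * (ENNReal.ofReal (24 * n) ^ θ *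
      (eLpNorm (weightedDiff k w) (ENNReal.ofReal 2) volume ^ (1 - θ) *
        eLpNorm (weightedDiff k w) (ENNReal.ofReal q) volume ^ θ))) ?_
  · rw [h.remainder_eq_bandStep hΓ hr]
    exact eLpNorm_bandStep_solution_le_of_lt_one hr.le hp (by linarith) hθ0 hθ1 hpq
      (bandBound_even r hn (by omega) hqn) hρ (h.integrable_moment (Nat.zero_le k))
      (h.integrable_moment le_rfl) (norm_moment_le w (Nat.zero_le k)) (norm_moment_le w le_rfl)
      h.ae_norm_le hb2 hbq (h.isBddCont_kreinFunction hΓ hr) (h.kreinFunction_eq hΓ hr)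
  · refine (ENNReal.mul_ne_top (ENNReal.inv_ne_top.2 (tsub_pos_of_lt hρ).ne') ?_).lt_top
    exact ENNReal.mul_ne_top (ENNReal.rpow_ne_top_of_nonneg hθ0 ENNReal.ofReal_ne_top)
      (ENNReal.mul_ne_top (ENNReal.rpow_ne_top_of_nonneg (by linarith) hb2)
        (ENNReal.rpow_ne_top_of_nonneg hθ0 hbq))

/-- For small `δ` the bounds in `L²` and in `L^q` are explicit, and log-convexity gives the one in
`L^p`. -/
theorem Admissible.supNorm_le (h : Admissible k δ w) (hΓ : IsResolventFamily w Γ) {p : ℝ}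
    (hp : 0 < p) {n : ℕ} (hn : Even n) (hn4 : 4 ≤ n) {θ : ℝ} (hθ0 : 0 ≤ θ) (hθ1 : θ ≤ 1)
    (hpθ : |1 / 2 - 1 / p| = θ * (1 / 2 - 1 / n)) (hδ : 24 * n * δ ≤ 1 / 2) :
    supNorm Γ k p ≤ ENNReal.ofReal (2 * (24 * n)) * (ENNReal.ofReal δ ^ (1 - 1 / p) *
      eLpNorm (weightedDiff k w) 1 volume ^ (1 / p)) := by
  obtain ⟨q, hq, hqn, hpq⟩ := exists_interpolation_exponent hn4 hpθ
  have hn' : (4 : ℝ) ≤ n := by exact_mod_cast hn4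
  have hq0 : 0 < q := by linarith
  have hq1 : 1 / q ≤ 1 := by rw [div_le_one hq0]; exact hq
  have hθ' : 0 ≤ 1 - θ := sub_nonneg.2 hθ1
  set c : ENNReal := ENNReal.ofReal (2 * (24 * n)) with hc
  set D : ENNReal := ENNReal.ofReal δ with hD
  set V : ENNReal := eLpNorm (weightedDiff k w) 1 volume with hV
  refine iSup₂_le fun r hr => ?_
  have hP := h.isBddCont_kreinFunction hΓ hr
  have key : ∀ s : ℝ, 1 ≤ s → BandBound r s (24 * n) →
      eLpNorm (remainder Γ k r) (ENNReal.ofReal s) volume ≤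
        c * (D ^ (1 - 1 / s) * V ^ (1 / s)) := by
    intro s hs hB
    rw [h.remainder_eq_bandStep hΓ hr]
    refine (eLpNorm_bandStep_solution_le hs hB (by positivity) hδ
      (h.integrable_moment (Nat.zero_le k)) (h.integrable_moment le_rfl)
      (norm_moment_le w (Nat.zero_le k)) (norm_moment_le w le_rfl) h.ae_norm_le
      (h.eLpNorm_weightedDiff_ne_top hs) hP (h.kreinFunction_eq hΓ hr)).trans ?_
    gcongr
    exact eLpNorm_le_of_ae_norm_le h.ae_norm_le hs
  have h2 := key 2 one_le_two ((bandBound_two hr.le).mono (by linarith))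
  have hq2 := key q hq (bandBound_even r hn (by omega) hqn)
  have hmeas : AEStronglyMeasurable (remainder Γ k r) volume := by
    rw [h.remainder_eq_bandStep hΓ hr]
    exact (hP.bandStep (h.integrable_moment le_rfl) r).1.aestronglyMeasurable
  refine (eLpNorm_le_rpow_mul_rpow hmeas hp (by norm_num) hq0 hθ0 hθ1 hpq).trans
    ((mul_le_mul' (ENNReal.rpow_le_rpow h2 hθ') (ENNReal.rpow_le_rpow hq2 hθ0)).trans
      (le_of_eq ?_))
  have hDp : D ^ (1 - 1 / p) = (D ^ (1 - 1 / (2 : ℝ))) ^ (1 - θ) * (D ^ (1 - 1 / q)) ^ θ := by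
    rw [← ENNReal.rpow_mul, ← ENNReal.rpow_mul, ← ENNReal.rpow_add_of_nonneg _ _
      (by nlinarith) (mul_nonneg (by linarith) hθ0), hpq]
    congr 1
    ring
  have hVp : V ^ (1 / p) = (V ^ (1 / (2 : ℝ))) ^ (1 - θ) * (V ^ (1 / q)) ^ θ := by
    rw [← ENNReal.rpow_mul, ← ENNReal.rpow_mul, ← ENNReal.rpow_add_of_nonneg _ _
      (by nlinarith) (by positivity), hpq]
    congr 1
    ring
  rw [hDp, hVp, ENNReal.mul_rpow_of_nonneg _ _ hθ', ENNReal.mul_rpow_of_nonneg _ _ hθ',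
    ENNReal.mul_rpow_of_nonneg _ _ hθ0, ENNReal.mul_rpow_of_nonneg _ _ hθ0]
  nth_rewrite 3 [← ennreal_rpow_one_sub_mul_rpow c hθ0 hθ1]
  ring

end Bounds

/-! ### The range of exponents -/

/-- The values of `|1/2 - 1/p|` for which the Neumann series is shown to converge in `L^p`, where `p`
is between `2` and `n` or its conjugate exponent and `24 n` is the bound for the projection. -/
def exponentRange (δ : ℝ) : Set ℝ :=
  {s | ∃ n : ℕ, Even n ∧ 4 ≤ n ∧ ∃ θ : ℝ, 0 < θ ∧ θ ≤ 1 ∧ δ * (24 * n : ℝ) ^ θ < 1 ∧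
    s = θ * (1 / 2 - 1 / n)}

theorem exponentRange_le {δ s : ℝ} (hs : s ∈ exponentRange δ) : s ≤ 1 / 2 := by
  obtain ⟨n, -, hn4, θ, hθ0, hθ1, -, rfl⟩ := hs
  have hn' : (0 : ℝ) ≤ 1 / n := by positivity
  nlinarith

theorem bddAbove_exponentRange (δ : ℝ) : BddAbove (exponentRange δ) :=
  ⟨1 / 2, fun _ hs => exponentRange_le hs⟩

theorem exists_pos_mem_exponentRange {δ : ℝ} (hδ : δ < 1) : ∃ s ∈ exponentRange δ, 0 < s := by
  have hc : ContinuousAt (fun θ : ℝ => δ * (24 * (4 : ℕ) : ℝ) ^ θ) 0 := by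
    refine ContinuousAt.const_mul ?_ δ
    exact Real.continuousAt_const_rpow (by norm_num)
  have h1 : ∀ᶠ θ : ℝ in 𝓝[>] 0, δ * (24 * (4 : ℕ) : ℝ) ^ θ < 1 :=
    (hc.eventually_lt continuousAt_const (by simpa using hδ)).filter_mono nhdsWithin_le_nhds
  have h2 : ∀ᶠ θ : ℝ in 𝓝[>] 0, θ ∈ Ioc (0 : ℝ) 1 := Ioc_mem_nhdsGT one_pos
  obtain ⟨θ, hθ, hθ0, hθ1⟩ := (h1.and h2).exists
  exact ⟨θ * (1 / 2 - 1 / (4 : ℕ)), ⟨4, by decide, le_rfl, θ, hθ0, hθ1, hθ, rfl⟩,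
    mul_pos hθ0 (by norm_num)⟩

theorem exists_even_lt_sub_one_div {a : ℝ} (ha : a < 1 / 2) :
    ∃ n : ℕ, Even n ∧ 4 ≤ n ∧ a < 1 / 2 - 1 / n := by
  obtain ⟨N, hN⟩ := exists_nat_one_div_lt (sub_pos.2 ha)
  refine ⟨2 * N + 4, ⟨N + 2, by ring⟩, by omega, ?_⟩
  have : 1 / ((2 * N + 4 : ℕ) : ℝ) ≤ 1 / ((N : ℝ) + 1) := by
    refine one_div_le_one_div_of_le (by positivity) ?_
    push_cast
    linarith [(Nat.cast_nonneg N : (0 : ℝ) ≤ N)]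
  linarith

/-- The radius `ε(δ)`. The factor `1 - δ` and the separate value at `0` keep it strictly below the
supremum of `exponentRange δ`, which is at most `1/2`. -/
def exponentRadius (δ : ℝ) : ℝ := if δ = 0 then 1 / 4 else (1 - δ) * sSup (exponentRange δ)

theorem sSup_exponentRange_pos {δ : ℝ} (hδ : δ < 1) : 0 < sSup (exponentRange δ) := by
  obtain ⟨s, hs, hs0⟩ := exists_pos_mem_exponentRange hδ
  exact hs0.trans_le (le_csSup (bddAbove_exponentRange δ) hs)

theorem sSup_exponentRange_le {δ : ℝ} (hδ : δ < 1) : sSup (exponentRange δ) ≤ 1 / 2 := by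
  obtain ⟨s, hs, -⟩ := exists_pos_mem_exponentRange hδ
  exact csSup_le ⟨s, hs⟩ fun _ h => exponentRange_le h

theorem exponentRadius_mem {δ : ℝ} (hδ : δ ∈ Ico (0 : ℝ) 1) :
    exponentRadius δ ∈ Ioo (0 : ℝ) (1 / 2) := by
  rw [exponentRadius]
  split_ifs with h
  · norm_num
  · have h0 : 0 < δ := lt_of_le_of_ne hδ.1 (Ne.symm h)
    have h1 := sSup_exponentRange_pos hδ.2
    have h2 := sSup_exponentRange_le hδ.2
    exact ⟨mul_pos (sub_pos.2 hδ.2) h1, by nlinarith⟩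

theorem exists_mem_exponentRange_of_lt {δ a : ℝ} (hδ : δ ∈ Ico (0 : ℝ) 1)
    (ha : a < exponentRadius δ) : ∃ s ∈ exponentRange δ, a < s := by
  rw [exponentRadius] at ha
  split_ifs at ha with h
  · subst h
    exact ⟨1 / 4, ⟨4, by decide, le_rfl, 1, one_pos, le_rfl, by simp, by norm_num⟩, ha⟩
  · obtain ⟨s, hs, -⟩ := exists_pos_mem_exponentRange hδ.2
    refine exists_lt_of_lt_csSup ⟨s, hs⟩ (ha.trans_le ?_)
    nlinarith [sSup_exponentRange_pos hδ.2, hδ.1]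

theorem tendsto_exponentRadius : Tendsto exponentRadius (𝓝[>] 0) (𝓝 (1 / 2)) := by
  have hI : ∀ᶠ δ : ℝ in 𝓝[>] 0, δ ∈ Ioo (0 : ℝ) 1 := Ioo_mem_nhdsGT one_pos
  refine tendsto_order.2 ⟨fun a ha => ?_, fun a ha => ?_⟩
  · obtain ⟨n, hn, hn4, hna⟩ := exists_even_lt_sub_one_div ha
    have h1 : ∀ᶠ δ : ℝ in 𝓝[>] 0, δ * (24 * n : ℝ) < 1 := by
      refine Eventually.filter_mono nhdsWithin_le_nhds ?_
      exact (by fun_prop : ContinuousAt (fun δ : ℝ => δ * (24 * n : ℝ)) 0).eventually_lt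
        continuousAt_const (by simp)
    have h2 : ∀ᶠ δ : ℝ in 𝓝[>] 0, a < (1 - δ) * (1 / 2 - 1 / n) := by
      refine Eventually.filter_mono nhdsWithin_le_nhds ?_
      exact continuousAt_const.eventually_lt
        (by fun_prop : ContinuousAt (fun δ : ℝ => (1 - δ) * (1 / 2 - 1 / (n : ℝ))) 0)
        (by simpa using hna)
    filter_upwards [hI, h1, h2] with δ hδ hδ1 hδ2
    rw [exponentRadius, if_neg hδ.1.ne']
    refine hδ2.trans_le (mul_le_mul_of_nonneg_left ?_ (sub_nonneg.2 hδ.2.le))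
    refine le_csSup (bddAbove_exponentRange δ) ⟨n, hn, hn4, 1, one_pos, le_rfl, ?_, by ring⟩
    rwa [Real.rpow_one]
  · filter_upwards [hI] with δ hδ
    exact (exponentRadius_mem ⟨hδ.1.le, hδ.2⟩).2.trans ha

theorem one_lt_of_abs_lt {p : ℝ} (hp : |1 / 2 - 1 / p| < 1 / 2) : 1 < p := by
  rw [abs_lt] at hp
  have h0 : 0 < 1 / p := by linarith
  have h1 := one_div_pos.1 h0
  have h2 : 1 / p < 1 := by linarith
  rwa [div_lt_one h1] at h2

theorem abs_lt_of_one_lt {p : ℝ} (hp : 1 < p) : |1 / 2 - 1 / p| < 1 / 2 := by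
  have h1 : 0 < 1 / p := by positivity
  have h2 : 1 / p < 1 := by rwa [div_lt_one (by linarith)]
  rw [abs_lt]
  constructor <;> linarith

theorem Admissible.supNorm_lt_top_of_lt {k : ℕ} {δ : ℝ} {w : ℝ → ℝ} (h : Admissible k δ w)
    {Γ : ℝ → ℝ → ℝ → ℂ} (hΓ : IsResolventFamily w Γ) {p : ℝ}
    (hp : |1 / 2 - 1 / p| < exponentRadius δ) : supNorm Γ k p < ⊤ := by
  have hp1 := one_lt_of_abs_lt (hp.trans (exponentRadius_mem h.delta_mem).2)
  obtain ⟨s, ⟨n, hn, hn4, θ, hθ0, hθ1, hθ, rfl⟩, hs⟩ :=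
    exists_mem_exponentRange_of_lt h.delta_mem hp
  have hn' : (4 : ℝ) ≤ n := by exact_mod_cast hn4
  have hn2 : 0 < 1 / 2 - 1 / (n : ℝ) := by
    have : 1 / (n : ℝ) ≤ 1 / 4 := one_div_le_one_div_of_le (by norm_num) hn'
    linarith
  have hθθ : |1 / 2 - 1 / p| / (1 / 2 - 1 / n) ≤ θ := (div_le_iff₀ hn2).2 hs.le
  refine h.supNorm_lt_top hΓ hp1.le hn hn4 (θ := |1 / 2 - 1 / p| / (1 / 2 - 1 / n))
    (by positivity) (hθθ.trans hθ1) (div_mul_cancel₀ _ hn2.ne').symm (lt_of_le_of_lt ?_ hθ)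
  exact mul_le_mul_of_nonneg_left (Real.rpow_le_rpow_of_exponent_le (by linarith) hθθ)
    h.delta_mem.1

end Krein

end

theorem theorem3 :
    -- the remainders are well defined
    (∀ (k : ℕ) (δ : ℝ) (w : ℝ → ℝ), Krein.Admissible k δ w →
      (∃ Γ : ℝ → ℝ → ℝ → ℂ, Krein.IsResolventFamily w Γ) ∧
      ∀ Γ : ℝ → ℝ → ℝ → ℂ, Krein.IsResolventFamily w Γ →
        ∀ r : ℝ, 0 < r → ContDiffOn ℝ (k : ℕ∞) (fun t : ℝ => Γ r r t) (Icc 0 r)) ∧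
    -- (a)
    (∃ ε : ℝ → ℝ, (∀ δ ∈ Ico (0 : ℝ) 1, ε δ ∈ Ioo (0 : ℝ) (1 / 2)) ∧
      Tendsto ε (𝓝[>] 0) (𝓝 (1 / 2)) ∧
      ∀ (k : ℕ) (δ : ℝ) (w : ℝ → ℝ), Krein.Admissible k δ w →
      ∀ Γ : ℝ → ℝ → ℝ → ℂ, Krein.IsResolventFamily w Γ →
      ∀ p : ℝ, |1 / 2 - 1 / p| < ε δ → Krein.supNorm Γ k p < ⊤) ∧
    -- (b)
    (∀ p : ℝ, 1 < p → ∃ δ₀ : ℝ, 0 < δ₀ ∧ ∀ k : ℕ, ∃ C : NNReal,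
      ∀ δ ∈ Ioo (0 : ℝ) δ₀, ∀ w : ℝ → ℝ, Krein.Admissible k δ w →
      ∀ Γ : ℝ → ℝ → ℝ → ℂ, Krein.IsResolventFamily w Γ →
        Krein.supNorm Γ k p ≤
          (C : ENNReal) * ENNReal.ofReal δ ^ (1 - 1 / p) *
            (eLpNorm (Krein.weightedDiff k w) 1 volume ^ (1 / p) +
              eLpNorm (Krein.weightedDiff k w) 1 volume ^ (1 + 1 / p))) := by
  refine ⟨fun k δ w h => ⟨h.exists_isResolventFamily, fun Γ hΓ r hr =>
    h.contDiffOn_last_row (hΓ.isResolventKernel h.integrable_sub_one hr) hr⟩,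
    ⟨Krein.exponentRadius, fun δ hδ => Krein.exponentRadius_mem hδ, Krein.tendsto_exponentRadius,
      fun k δ w h Γ hΓ p hp => h.supNorm_lt_top_of_lt hΓ hp⟩, fun p hp => ?_⟩
  obtain ⟨n, hn, hn4, hnp⟩ := Krein.exists_even_lt_sub_one_div (Krein.abs_lt_of_one_lt hp)
  have hn0 : (0 : ℝ) < n := by exact_mod_cast (by omega : 0 < n)
  have hn2 : 0 < 1 / 2 - 1 / (n : ℝ) := (abs_nonneg _).trans_lt hnp
  -- `48 n` is twice the bound `24 n` for the projection in `L^n`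
  refine ⟨1 / (48 * n), by positivity, fun k => ⟨(2 * (24 * n) : ℝ).toNNReal,
    fun δ hδ w h Γ hΓ => ?_⟩⟩
  have hδ' : 24 * n * δ ≤ 1 / 2 := by
    have := (lt_div_iff₀ (by positivity : (0 : ℝ) < 48 * n)).1 hδ.2
    linarith
  refine (h.supNorm_le hΓ (by linarith) hn hn4 (by positivity) ((div_le_one hn2).2 hnp.le)
    (div_mul_cancel₀ _ hn2.ne').symm hδ').trans ?_
  rw [mul_assoc]
  exact mul_le_mul' le_rfl (mul_le_mul' le_rfl le_self_add)
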